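/- **Setting.** Let $\mathbb H$ be a real separable Hilbert space with orthonormal basis $(\psi_j)_{j\ge1}$; write $[h]_j=\langle h,\psi_j\rangle$, $[h]_{\underline m}=([h]_1,\dots,[h]_m)^t$, and $\|h\|_w^2=\sum_{j\ge1} w_j[h]_j^2$ for a sequence of weights $w$. Let $\omega,b,\lambda$ be strictly positive sequences with $\omega_1=b_1=\lambda_1=1$ and $\sum_j\lambda_j<\infty$, such that $b^{-1}$, $\omega b^{-1}$, $\lambda$ and $\lambda^2\omega^{-1}$ are nonincreasing and converge to zero. For $r>0$ and $d\ge1$ let $\mathcal F_b^r=\{h\in\mathbb H:\|h\|_b^2\le r\}$, and let $\mathcal G_\lambda^d$ be the set of strictly positive nuclear operators $T$ on $\mathbb H$ with $d^{-2}\|f\|_{\lambda^2}^2\le\|Tf\|^2\le d^2\|f\|_{\lambda^2}^2$ for all $f\in\mathbb H$. **Model.** Let $\sigma>0$, $\beta\in\mathbb H$ and $Y=\langle\beta,X\rangle+\sigma\varepsilon$, where $X$ (with values in $\mathbb H$) and $\varepsilon$ are independent and jointly normal, $X$ is centred with covariance operator $\Gamma$, and $\varepsilon$ is standard normal. Observe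 $n$ independent copies $(Y_i,X_i)$ of $(Y,X)$. **Notation.** $\|A\|_s$ is the spectral norm of a matrix, with $\|A^{-1}\|_s:=\infty$ if $A$ is singular; $\nabla_{\underline k}=\mathrm{diag}(\omega_1,\dots,\omega_k)$; $\omega_{(m)}=\max_{k\le m}\omega_k$; an $\arg\min$ is the smallest minimizer. For a sequence $A=(A_{\underline k})_{k\ge1}$ of $k\times k$ matrices, $$\Delta_m^{A}=\max_{1\le k\le m}\|\nabla_{\underline k}^{1/2}A_{\underline k}^{-1}\nabla_{\underline k}^{1/2}\|_s,\qquad \delta_m^{A}=m\,\Delta_m^{A}\,\frac{\log(\Delta_m^{A}\vee(m+2))}{\log(m+2)},$$ and $\Delta_m^\lambda,\delta_m^\lambda$ are these quantities for $A_{\underline k}=\mathrm{diag}(\lambda_1,\dots,\lambda_k)$. Let $M_n^\omega=\max\{1\le m\le\lfloor n^{1/4}\rfloor:\omega_{(m)}\le n\}$ and, for a sequence $a$ in $[0,\infty]$, $M_n(a)=\min\{2\le m\le M_n^\omega: m\,\omega_{(m)}a_m>n/(1+\log n)\}-1$, with $M_n(a)=M_n^\omega$ if this set is empty. **Estimator.**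 Put $[\hat g]_{\underline m}=\frac1n\sum_i Y_i[X_i]_{\underline m}$ and $[\hat\Gamma]_{\underline m}=\frac1n\sum_i[X_i]_{\underline m}[X_i]_{\underline m}^t$. Let $\hat\beta_m\in\mathrm{span}\{\psi_1,\dots,\psi_m\}$ have coordinate vector $[\hat\Gamma]_{\underline m}^{-1}[\hat g]_{\underline m}$ if $\|[\hat\Gamma]_{\underline m}^{-1}\|_s\le n$, and let $\hat\beta_m=0$ otherwise. With $\kappa=96$ let $$\widehat{\mathrm{pen}}_m=14\,\kappa\,\hat\sigma_m^2\,\delta_m^{[\hat\Gamma]}\,n^{-1},\qquad \hat\sigma_m^2=2\Big(\tfrac1n\sum_{i}Y_i^2+[\hat g]_{\underline m}^t[\hat\Gamma]_{\underline m}^{-1}[\hat g]_{\underline m}\Big),\qquad \hat M=M_n\big((\|[\hat\Gamma]_{\underline m}^{-1}\|_s)_{m\ge1}\big),$$ $$\Psi_m=\max_{m\le k\le\hat M}\{\|\hat\beta_k-\hat\beta_m\|_\omega^2-\widehat{\mathrm{pen}}_k\},\qquad \hat m=\arg\min_{1\le m\le\hat M}\{\Psi_m+\widehat{\mathrm{pen}}_m\}.$$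 **Rate.** Let $M_n^-=M_n(16d^3\lambda^{-1})$ and $$m_n^\diamond=\arg\min_{1\le m\le M_n^-}\max\Big(\frac{\omega_m}{b_m},\frac{\delta_m^\lambda}{n}\Big),\qquad R_n^\diamond=\max\Big(\frac{\omega_{m_n^\diamond}}{b_{m_n^\diamond}},\frac{\delta^\lambda_{m_n^\diamond}}{n}\Big),$$ and let $\Sigma$ be any finite constant with $$\Sigma\ge\sum_{j\ge1}\lambda_j\quad\text{and}\quad \Sigma\ge\sum_{m\ge1}\Delta_m^\lambda\exp\Big(-\frac{m\log(\Delta_m^\lambda\vee(m+2))}{16(1+\log d)\log(m+2)}\Big).$$ **Theorem.** For every $d\ge1$ there is a finite constant $K=K(d)$, depending on $d$ only, such that in the above setting $$\sup_{\beta\in\mathcal F_b^r}\ \sup_{\Gamma\in\mathcal G_\lambda^d}\ \mathbb E\,\|\hat\beta_{\hat m}-\beta\|_\omega^2\ \le\ K\,(\sigma^2+r)\,\Big\{R_n^\diamond+\frac{\Sigma}{n}\Big\}\qquad\text{for all } n\ge1 .$$ -/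

import Mathlib

open MeasureTheory ProbabilityTheory
open scoped ENNReal

namespace FunctionalRegression

/-! Indexing convention. Sequences and the orthonormal basis, which the mathematics indexes by
`j = 1, 2, …`, are indexed by `ℕ` from `0`: `w j` is the weight `w_{j+1}` and `ψ j` is the basis
vector `ψ_{j+1}`.  Dimensions `m ≥ 1` and the sample size `n ≥ 1` are not shifted, so that
`w_m` is `w (m - 1)`, and the first `m` coordinates are indexed by `Fin m`. -/

section Basics

variable {H : Type*} [NormedAddCommGroup H] [InnerProductSpace ℝ H]

/-- The squared weighted norm `‖h‖_w² = ∑_j w_j ⟨h, ψ_j⟩²`, possibly infinite. -/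
noncomputable def wNormSq (ψ : HilbertBasis ℕ ℝ H) (w : ℕ → ℝ) (h : H) : ℝ≥0∞ :=
  ∑' j, ENNReal.ofReal (w j * (inner ℝ (ψ j) h) ^ 2)

/-- The vector `[h]_m` of the first `m` coordinates of `h`. -/
noncomputable def coords (ψ : HilbertBasis ℕ ℝ H) (m : ℕ) (h : H) : Fin m → ℝ :=
  fun j => inner ℝ (ψ j) h

/-- The element of the span of the first `m` basis vectors with coordinates `c`. -/
noncomputable def ofCoords (ψ : HilbertBasis ℕ ℝ H) {m : ℕ} (c : Fin m → ℝ) : H :=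
  ∑ j : Fin m, c j • ψ j

/-- The ellipsoid `F_b^r`.  For weights `b` bounded away from zero, the completion of `H` in
`‖·‖_b` consists of the `h ∈ H` with `‖h‖_b < ∞`. -/
def ellipsoid (ψ : HilbertBasis ℕ ℝ H) (b : ℕ → ℝ) (r : ℝ) : Set H :=
  {h | wNormSq ψ b h ≤ ENNReal.ofReal r}

/-- The class `G_l^d` of strictly positive nuclear operators `T` with
`d⁻² ‖f‖_{l²}² ≤ ‖T f‖² ≤ d² ‖f‖_{l²}²` for all `f`.  A positive operator is nuclear exactly when
its trace with respect to one orthonormal basis converges. -/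
def opClass (ψ : HilbertBasis ℕ ℝ H) (l : ℕ → ℝ) (d : ℝ) : Set (H →L[ℝ] H) :=
  {T | T.IsPositive ∧ (∀ f : H, f ≠ 0 → 0 < inner ℝ (T f) f) ∧
    Summable (fun j => inner ℝ (T (ψ j)) (ψ j)) ∧
    ∀ f : H,
      ENNReal.ofReal ((d ^ 2)⁻¹) * wNormSq ψ (fun j => l j ^ 2) f ≤ ENNReal.ofReal (‖T f‖ ^ 2) ∧
      ENNReal.ofReal (‖T f‖ ^ 2) ≤ ENNReal.ofReal (d ^ 2) * wNormSq ψ (fun j => l j ^ 2) f}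

end Basics

/-- The minimal regularity conditions on the weight sequences `w`, `b`, `l`. -/
structure WeightAssumption (w b l : ℕ → ℝ) : Prop where
  w_pos : ∀ j, 0 < w j
  b_pos : ∀ j, 0 < b j
  l_pos : ∀ j, 0 < l j
  w_first : w 0 = 1
  b_first : b 0 = 1
  l_first : l 0 = 1
  l_summable : Summable l
  b_inv_antitone : Antitone fun j => (b j)⁻¹
  b_inv_tendsto : Filter.Tendsto (fun j => (b j)⁻¹) Filter.atTop (nhds 0)
  w_div_b_antitone : Antitone fun j => w j / b j
  w_div_b_tendsto : Filter.Tendsto (fun j => w j / b j) Filter.atTop (nhds 0)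
  l_antitone : Antitone l
  l_tendsto : Filter.Tendsto l Filter.atTop (nhds 0)
  l_sq_div_w_antitone : Antitone fun j => l j ^ 2 / w j
  l_sq_div_w_tendsto : Filter.Tendsto (fun j => l j ^ 2 / w j) Filter.atTop (nhds 0)

/-- The spectral norm of a square matrix: its operator norm for the Euclidean norm. -/
noncomputable def specNorm {m : ℕ} (A : Matrix (Fin m) (Fin m) ℝ) : ℝ :=
  ‖Matrix.toEuclideanCLM (n := Fin m) (𝕜 := ℝ) A‖

open Classical in
/-- The spectral norm of the inverse of `A`, equal to `∞` when `A` is singular. -/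
noncomputable def invNorm {m : ℕ} (A : Matrix (Fin m) (Fin m) ℝ) : ℝ≥0∞ :=
  if IsUnit A.det then ENNReal.ofReal (specNorm A⁻¹) else ⊤

/-- The diagonal matrix with entries `w_1, …, w_m`. -/
def diagMat (w : ℕ → ℝ) (m : ℕ) : Matrix (Fin m) (Fin m) ℝ :=
  Matrix.diagonal fun j : Fin m => w j

/-- `Δ_m` of a sequence of matrices `A = (A_k)_k` with `A_k` of size `k`: the maximum over
`1 ≤ k ≤ m` of `‖D_k^{1/2} A_k⁻¹ D_k^{1/2}‖`, `D_k` the diagonal matrix of `w_1, …, w_k`. -/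
noncomputable def bigDelta (w : ℕ → ℝ) (A : (k : ℕ) → Matrix (Fin k) (Fin k) ℝ) (m : ℕ) : ℝ :=
  ⨆ k : Fin m, specNorm
    (diagMat (fun j => √(w j)) (k + 1) * (A (k + 1))⁻¹ * diagMat (fun j => √(w j)) (k + 1))

/-- `δ_m = m Δ_m log(Δ_m ∨ (m + 2)) / log(m + 2)`. -/
noncomputable def smallDelta (w : ℕ → ℝ) (A : (k : ℕ) → Matrix (Fin k) (Fin k) ℝ) (m : ℕ) : ℝ :=
  m * bigDelta w A m * (Real.log (max (bigDelta w A m) (m + 2)) / Real.log (m + 2))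

/-- `w_(m) = max_{1 ≤ k ≤ m} w_k`. -/
noncomputable def wMax (w : ℕ → ℝ) (m : ℕ) : ℝ := ⨆ k : Fin m, w k

/-- `M^w_n = max {1 ≤ m ≤ ⌊n^{1/4}⌋ : w_(m) ≤ n}`. -/
noncomputable def dimCap (w : ℕ → ℝ) (n : ℕ) : ℕ :=
  sSup {m : ℕ | 1 ≤ m ∧ m ≤ ⌊(n : ℝ) ^ (1 / 4 : ℝ)⌋₊ ∧ wMax w m ≤ n}

/-- The set `{2 ≤ m ≤ M^w_n : m w_(m) a_m > n / (1 + log n)}`. -/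
def exceedSet (w : ℕ → ℝ) (n : ℕ) (a : ℕ → ℝ≥0∞) : Set ℕ :=
  {m : ℕ | 2 ≤ m ∧ m ≤ dimCap w n ∧
    ENNReal.ofReal (n / (1 + Real.log n)) < m * ENNReal.ofReal (wMax w m) * a m}

open Classical in
/-- `M_n(a) = min {2 ≤ m ≤ M^w_n : m w_(m) a_m > n / (1 + log n)} - 1`, equal to `M^w_n` when the
set is empty. -/
noncomputable def dimBound (w : ℕ → ℝ) (n : ℕ) (a : ℕ → ℝ≥0∞) : ℕ :=
  if (exceedSet w n a).Nonempty then sInf (exceedSet w n a) - 1 else dimCap w n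

/-- The smallest minimizer of `c` over `{1, …, M}`. -/
noncomputable def argminUpTo (M : ℕ) (c : ℕ → ℝ) : ℕ :=
  sInf {m : ℕ | 1 ≤ m ∧ m ≤ M ∧ ∀ k, 1 ≤ k → k ≤ M → c m ≤ c k}

section Estimator

variable {H : Type*} [NormedAddCommGroup H] [InnerProductSpace ℝ H]

/-- The vector `[ĝ]_m = n⁻¹ ∑_i Y_i [X_i]_m`. -/
noncomputable def gHat (ψ : HilbertBasis ℕ ℝ H) {n : ℕ} (X : Fin n → H) (Y : Fin n → ℝ) (m : ℕ) :
    Fin m → ℝ :=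
  (n : ℝ)⁻¹ • ∑ i, Y i • coords ψ m (X i)

/-- The empirical covariance matrix `[Γ̂]_m = n⁻¹ ∑_i [X_i]_m [X_i]_mᵗ`. -/
noncomputable def covHat (ψ : HilbertBasis ℕ ℝ H) {n : ℕ} (X : Fin n → H) (m : ℕ) :
    Matrix (Fin m) (Fin m) ℝ :=
  (n : ℝ)⁻¹ • ∑ i, Matrix.vecMulVec (coords ψ m (X i)) (coords ψ m (X i))

open Classical in
/-- The thresholded projection estimator `β̂_m`, with `[β̂_m]_m = [Γ̂]_m⁻¹ [ĝ]_m` if `[Γ̂]_m` is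
nonsingular with `‖[Γ̂]_m⁻¹‖ ≤ n`, and `β̂_m = 0` otherwise. -/
noncomputable def betaHat (ψ : HilbertBasis ℕ ℝ H) {n : ℕ} (X : Fin n → H) (Y : Fin n → ℝ)
    (m : ℕ) : H :=
  if invNorm (covHat ψ X m) ≤ n then
    ofCoords ψ ((covHat ψ X m)⁻¹.mulVec (gHat ψ X Y m))
  else 0

/-- `σ̂_m² = 2 (n⁻¹ ∑_i Y_i² + [ĝ]_mᵗ [Γ̂]_m⁻¹ [ĝ]_m)`. -/
noncomputable def sigmaHatSq (ψ : HilbertBasis ℕ ℝ H) {n : ℕ} (X : Fin n → H) (Y : Fin n → ℝ)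
    (m : ℕ) : ℝ :=
  2 * ((n : ℝ)⁻¹ * ∑ i, Y i ^ 2 +
    dotProduct (gHat ψ X Y m) ((covHat ψ X m)⁻¹.mulVec (gHat ψ X Y m)))

/-- The random penalty `14 κ σ̂_m² δ_m^{[Γ̂]} n⁻¹`. -/
noncomputable def penHat (ψ : HilbertBasis ℕ ℝ H) (w : ℕ → ℝ) (κ : ℝ) {n : ℕ} (X : Fin n → H)
    (Y : Fin n → ℝ) (m : ℕ) : ℝ :=
  14 * κ * sigmaHatSq ψ X Y m * smallDelta w (covHat ψ X) m * (n : ℝ)⁻¹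

/-- The random upper bound `M̂ = M_n(a)` with `a_m = ‖[Γ̂]_m⁻¹‖`. -/
noncomputable def dimHat (ψ : HilbertBasis ℕ ℝ H) (w : ℕ → ℝ) {n : ℕ} (X : Fin n → H) : ℕ :=
  dimBound w n fun m => invNorm (covHat ψ X m)

/-- The contrast `max_{m ≤ k ≤ M̂} (‖β̂_k - β̂_m‖_w² - pen_k)`, with the random penalty. -/
noncomputable def contrast (ψ : HilbertBasis ℕ ℝ H) (w : ℕ → ℝ) (κ : ℝ) {n : ℕ} (X : Fin n → H)
    (Y : Fin n → ℝ) (m : ℕ) : ℝ :=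
  ⨆ k : Set.Icc m (dimHat ψ w X),
    ((wNormSq ψ w (betaHat ψ X Y k - betaHat ψ X Y m)).toReal - penHat ψ w κ X Y k)

/-- The data-driven dimension `m̂`. -/
noncomputable def mHat (ψ : HilbertBasis ℕ ℝ H) (w : ℕ → ℝ) (κ : ℝ) {n : ℕ} (X : Fin n → H)
    (Y : Fin n → ℝ) : ℕ :=
  argminUpTo (dimHat ψ w X) fun m => contrast ψ w κ X Y m + penHat ψ w κ X Y m

/-- The data-driven thresholded projection estimator `β̂_{m̂}`. -/
noncomputable def adaptiveEstimator (ψ : HilbertBasis ℕ ℝ H) (w : ℕ → ℝ) (κ : ℝ) {n : ℕ}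
    (X : Fin n → H) (Y : Fin n → ℝ) : H :=
  betaHat ψ X Y (mHat ψ w κ X Y)

end Estimator

section Risk

variable {H : Type*} [NormedAddCommGroup H] [InnerProductSpace ℝ H] [MeasurableSpace H]

/-- `ρ` is the joint law of a regressor `X` and an error `ε` that are jointly normal and
independent, `X` being centred with covariance operator `Γ` and `ε` standard normal.  (These
properties determine `ρ`.) -/
structure IsGaussianDesign (ρ : Measure (H × ℝ)) (Γ : H →L[ℝ] H) : Prop where
  gaussian : IsGaussian ρ
  indep : IndepFun Prod.fst Prod.snd ρ
  centred : ∀ h : H, ∫ z, inner ℝ h z.1 ∂ρ = 0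
  cov : ∀ h h' : H, ∫ z, inner ℝ h z.1 * inner ℝ h' z.1 ∂ρ = inner ℝ (Γ h) h'
  error : ρ.map Prod.snd = gaussianReal 0 1

/-- The risk `E ‖est - β‖_w²` of an estimator `est` which is computed from `n` independent copies
`(X_i, Y_i)` of `(X, Y)`, `Y = ⟨β, X⟩ + σ ε`, where `(X, ε)` has law `ρ`. -/
noncomputable def risk (ψ : HilbertBasis ℕ ℝ H) (w : ℕ → ℝ) {n : ℕ}
    (est : (Fin n → H) → (Fin n → ℝ) → H) (σ : ℝ) (β : H) (ρ : Measure (H × ℝ)) : ℝ≥0∞ :=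
  ∫⁻ z : Fin n → H × ℝ,
    wNormSq ψ w (est (fun i => (z i).1) (fun i => inner ℝ β (z i).1 + σ * (z i).2) - β)
    ∂(Measure.pi fun _ => ρ)

/-- The maximal risk `sup_{β ∈ F} sup_{Γ ∈ G} E ‖est - β‖_w²` under Gaussian designs. -/
noncomputable def maxRisk (ψ : HilbertBasis ℕ ℝ H) (w : ℕ → ℝ) {n : ℕ}
    (est : (Fin n → H) → (Fin n → ℝ) → H) (σ : ℝ) (F : Set H) (G : Set (H →L[ℝ] H)) : ℝ≥0∞ :=
  ⨆ β ∈ F, ⨆ Γ ∈ G, ⨆ (ρ : Measure (H × ℝ)) (_ : IsGaussianDesign ρ Γ), risk ψ w est σ β ρ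

end Risk

/-- `Δ_m^l`, that is `Δ_m` for the diagonal matrices of `l`. -/
noncomputable def bigDeltaOf (w l : ℕ → ℝ) (m : ℕ) : ℝ := bigDelta w (diagMat l) m

/-- `δ_m^l`, that is `δ_m` for the diagonal matrices of `l`. -/
noncomputable def smallDeltaOf (w l : ℕ → ℝ) (m : ℕ) : ℝ := smallDelta w (diagMat l) m

/-- `M⁻_n = M_n(16 d³ l⁻¹)`. -/
noncomputable def dimLower (w l : ℕ → ℝ) (d : ℝ) (n : ℕ) : ℕ :=
  dimBound w n fun m => ENNReal.ofReal (16 * d ^ 3 * (l (m - 1))⁻¹)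

/-- `max(w_m / b_m, δ_m^l / n)`. -/
noncomputable def tradeOff (w b l : ℕ → ℝ) (n m : ℕ) : ℝ :=
  max (w (m - 1) / b (m - 1)) (smallDeltaOf w l m / n)

/-- `m^⋄_n`, the smallest minimizer of `max(w_m / b_m, δ_m^l / n)` over `1 ≤ m ≤ M⁻_n`. -/
noncomputable def mDiamond (w b l : ℕ → ℝ) (d : ℝ) (n : ℕ) : ℕ :=
  argminUpTo (dimLower w l d n) (tradeOff w b l n)

/-- `R^⋄_n`, the value of `max(w_m / b_m, δ_m^l / n)` at `m = m^⋄_n`. -/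
noncomputable def RDiamond (w b l : ℕ → ℝ) (d : ℝ) (n : ℕ) : ℝ :=
  tradeOff w b l n (mDiamond w b l d n)

/-- `S` is an admissible value of the constant `Σ`: it is at least `∑_{j ≥ 1} l_j` and at least
`∑_{m ≥ 1} Δ_m^l exp(- m log(Δ_m^l ∨ (m + 2)) / (16 (1 + log d) log(m + 2)))`. -/
def IsSigma (w l : ℕ → ℝ) (d S : ℝ) : Prop :=
  ∑' j : ℕ, ENNReal.ofReal (l j) ≤ ENNReal.ofReal S ∧
  ∑' i : ℕ, (fun m : ℕ => ENNReal.ofReal (bigDeltaOf w l m *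
      Real.exp (-(m * Real.log (max (bigDeltaOf w l m) (m + 2)) /
        (16 * (1 + Real.log d) * Real.log (m + 2)))))) (i + 1) ≤ ENNReal.ofReal S

end FunctionalRegression

/-! Fix `Γ = T` and `β`. Let `β_k` be the projection of `β` onto the first `k` basis vectors,
orthogonal for `⟨T x, y⟩`, and let `E = σ² + ⟨T β, β⟩` be the second moment of the response. The
error of `β̂_k` splits into a fluctuation `β̂_k - β_k` and a bias `β_k - β`.

Selection. The criterion is nonnegative and vanishes at the largest admissible dimension, so `m̂` is
its first zero (`mHat_spec`). Put `a = m⋄`. If `m̂ ≤ a`, the distance from `β̂_m̂` to `β̂_a` is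
bounded by the penalty at `a`. If `m̂ > a`, every dimension below `m̂` has a larger `k` whose
penalty exceeds the present one by at most the squared distance of the two estimators. Iterating
gives an increasing chain from `a` to some `K ≥ m̂` (`exists_chain`), and the penalty at `K` is at
most the penalty at `a` plus the sum of the squared increments of the estimators along the chain. It
remains to bound such sums, for all chains at once because the chain is random.

Bias increments. The increments of `β_k` are blocks of a Gram–Schmidt expansion. In the energy norm
of `T` they obey Bessel's inequality; by operator monotonicity of the square root this norm is
comparable with the `λ`-weighted one (`opClass_inner_le`). The blocks are triangular in the basis,
and a bound for triangular maps survives multiplication of the weights by a nondecreasing sequence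
(`wNormSq_le_of_triangular`). One such passage, a duality and a second passage lead to the weights
`ω` (`sum_wNormSq_gramPart_le`), so the whole sum is of the order of the bias at `a`.

Fluctuation increments. Whitening turns the first `K` regressors and the residual of the response
into `K + 1` independent standard Gaussian columns in `ℝⁿ`, and the response is a fixed combination
of them with squared coefficients summing to `E`. The fitted values are orthogonal projections, and
the errors of all dimensions come from sums of columns projected onto the span of their predecessors
(`colError_eq`). Such a sum is subgaussian uniformly over unit coefficient vectors, up to a random
factor `smoothMax` whose mean is exponential in `K` (`lintegral_smoothMax_le`). Hence every chain
ending at `K` has squared fluctuation increments at most `64 E log Θ_K` in the sample space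
(`sum_norm_sq_colError_sub_le`), and `Δ_K^{Γ̂} / n` converts this to the weighted norm. The penalty
absorbs the typical size of this quantity; the excess has mean of order `d E / n` times the `K`-th
term of the series bounded by `Σ`, so that summing over `K` gives `Σ / n`.

Good samples. Outside an event of probability `O(n⁻⁶)`, empirical and population second moments
agree up to a factor (`measure_gramDev_le`), which makes the random penalty and the random range of
dimensions comparable with their population versions. On the exceptional event, and for `n < 2 d`,
the threshold in the estimator yields a crude bound that suffices. -/

namespace FunctionalRegression

/-! ### Gaussian integrals and products of Gaussian measures -/

section GaussianIntegrals

/-- Completing the square turns the integrand times the standard density into a constant multiple of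
the Gaussian density with variance `c⁻¹` and mean `2 s a u c⁻¹`, where `c = 1 - 2 s u²`. -/
theorem lintegral_exp_sq_gaussianReal (a u s : ℝ) (h : 2 * s * u ^ 2 < 1) :
    ∫⁻ x, ENNReal.ofReal (Real.exp (s * (a + u * x) ^ 2)) ∂(gaussianReal 0 1)
      = ENNReal.ofReal ((√(1 - 2 * s * u ^ 2))⁻¹ *
          Real.exp (s * a ^ 2 / (1 - 2 * s * u ^ 2))) := by
  have hc : 0 < 1 - 2 * s * u ^ 2 := by linarith
  set c := 1 - 2 * s * u ^ 2 with hcdef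
  have hv : (0 : ℝ) ≤ c⁻¹ := by positivity
  set v : NNReal := ⟨c⁻¹, hv⟩ with hvdef
  have hvc : (v : ℝ) = c⁻¹ := rfl
  have hv0 : v ≠ 0 := by
    intro h0
    have : (v : ℝ) = 0 := by rw [h0]; rfl
    rw [hvc] at this
    have := inv_eq_zero.1 this
    linarith
  rw [gaussianReal_of_var_ne_zero _ one_ne_zero,
    lintegral_withDensity_eq_lintegral_mul _ (measurable_gaussianPDF 0 1) (by fun_prop)]
  have key : ∀ x : ℝ, (gaussianPDF 0 1 * fun x =>
      ENNReal.ofReal (Real.exp (s * (a + u * x) ^ 2))) x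
      = ENNReal.ofReal ((√c)⁻¹ * Real.exp (s * a ^ 2 / c)) *
        gaussianPDF (2 * s * a * u * c⁻¹) v x := by
    intro x
    simp only [Pi.mul_apply, gaussianPDF]
    rw [← ENNReal.ofReal_mul (gaussianPDFReal_nonneg _ _ _),
      ← ENNReal.ofReal_mul (by positivity)]
    congr 1
    simp only [gaussianPDFReal, hvc, NNReal.coe_one]
    have h1 : √(2 * Real.pi * c⁻¹) = √(2 * Real.pi) * (√c)⁻¹ := by
      rw [Real.sqrt_mul (by positivity), Real.sqrt_inv]
    have h2 : 0 < √c := Real.sqrt_pos.2 hc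
    rw [h1, mul_one, mul_assoc, ← Real.exp_add, mul_inv, inv_inv,
      show (√c)⁻¹ * Real.exp (s * a ^ 2 / c) * ((√(2 * Real.pi))⁻¹ * √c *
        Real.exp (-(x - 2 * s * a * u * c⁻¹) ^ 2 / (2 * c⁻¹)))
        = (√(2 * Real.pi))⁻¹ * ((√c)⁻¹ * √c) * (Real.exp (s * a ^ 2 / c) *
        Real.exp (-(x - 2 * s * a * u * c⁻¹) ^ 2 / (2 * c⁻¹))) by ring,
      inv_mul_cancel₀ h2.ne', ← Real.exp_add]
    simp only [mul_one]
    congr 2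
    have h3 : s * u ^ 2 = (1 - c) / 2 := by rw [hcdef]; ring
    have h4 : c * c⁻¹ = 1 := mul_inv_cancel₀ hc.ne'
    have h5 : -(x - 2 * s * a * u * c⁻¹) ^ 2 / (2 * c⁻¹)
        = -(c * (x - 2 * s * a * u * c⁻¹) ^ 2) / 2 := by
      field_simp
    rw [h5, div_eq_mul_inv (s * a ^ 2)]
    clear_value c
    linear_combination (x ^ 2 + 2 * s * a ^ 2 * c⁻¹ * (c * c⁻¹)) * h3 +
      (-2 * x * s * a * u + s * a ^ 2 * (c⁻¹ - c * c⁻¹ - 1)) * h4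
  simp_rw [key]
  rw [lintegral_const_mul _ (measurable_gaussianPDF _ _), lintegral_gaussianPDF_eq_one _ hv0,
    mul_one]

/-- Jointly Gaussian variables that are uncorrelated are independent; the marginals are identified
by their mean and variance. -/
theorem map_eq_pi_gaussianReal {F : Type*} [NormedAddCommGroup F] [NormedSpace ℝ F]
    [MeasurableSpace F] [BorelSpace F] {μ : Measure F} [IsGaussian μ] {ι : Type*} [Fintype ι]
    [DecidableEq ι]
    (L : ι → F →L[ℝ] ℝ) (h0 : ∀ i, ∫ x, L i x ∂μ = 0)
    (h1 : ∀ i j, ∫ x, L i x * L j x ∂μ = if i = j then 1 else 0) :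
    μ.map (fun x i => L i x) = Measure.pi fun _ => gaussianReal 0 1 := by
  have hG : HasGaussianLaw (fun x i => L i x) μ :=
    ⟨(isGaussian_map (ContinuousLinearMap.pi L) : IsGaussian (μ.map (ContinuousLinearMap.pi L)))⟩
  have hL2 : ∀ i, MemLp (L i) 2 μ := fun i => IsGaussian.memLp_dual μ (L i) 2 (by simp)
  have hcov : ∀ i j, cov[L i, L j; μ] = if i = j then 1 else 0 := by
    intro i j
    rw [covariance_eq_sub (hL2 i) (hL2 j)]
    have := h1 i j
    simp only [Pi.mul_apply, h0, zero_mul, sub_zero]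
    exact this
  have hind : iIndepFun (fun i x => L i x) μ :=
    hG.iIndepFun_of_covariance_eq_zero fun i j hij => by
      have := hcov i j
      rwa [if_neg hij] at this
  rw [(iIndepFun_iff_map_fun_eq_pi_map (fun i => (L i).continuous.measurable.aemeasurable)).1 hind]
  congr 1
  ext1 i
  have h2 := IsGaussian.map_eq_gaussianReal (μ := μ) (L i)
  have h3 : Var[L i; μ] = 1 := by
    rw [← covariance_self (L i).continuous.measurable.aemeasurable, hcov i i, if_pos rfl]
  rw [h3, h0 i] at h2
  simpa using h2

theorem isGaussian_pi {F : Type*} [NormedAddCommGroup F] [NormedSpace ℝ F]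
    [MeasurableSpace F] [BorelSpace F] [SecondCountableTopology F] [CompleteSpace F]
    (μ : Measure F) [IsGaussian μ] (n : ℕ) :
    IsGaussian (Measure.pi fun _ : Fin n => μ) := by
  have h : iIndepFun (fun (i : Fin n) (z : Fin n → F) => z i) (Measure.pi fun _ => μ) :=
    iIndepFun_pi (μ := fun _ : Fin n => μ) (X := fun _ => id) (fun _ => aemeasurable_id)
  have h2 : HasGaussianLaw (fun (z : Fin n → F) (i : Fin n) => z i) (Measure.pi fun _ => μ) := by
    refine iIndepFun.hasGaussianLaw (fun i => ⟨?_⟩) h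
    have := (measurePreserving_eval (fun _ : Fin n => μ) i).map_eq
    rw [show (fun z : Fin n → F => z i) = Function.eval i from rfl, this]
    infer_instance
  have := h2.isGaussian_map
  simpa using this

theorem lintegral_pi_prod {ι : Type*} [Fintype ι] {F : Type*} [MeasurableSpace F]
    (μ : Measure F) [IsProbabilityMeasure μ] (f : ι → F → ℝ≥0∞) (hf : ∀ i, Measurable (f i)) :
    ∫⁻ z, ∏ i, f i (z i) ∂(Measure.pi fun _ : ι => μ) = ∏ i, ∫⁻ x, f i x ∂μ := by
  have h : iIndepFun (fun (i : ι) (z : ι → F) => f i (z i)) (Measure.pi fun _ => μ) :=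
    iIndepFun_pi (μ := fun _ : ι => μ) (X := f) (fun i => (hf i).aemeasurable)
  have h' := lintegral_prod_eq_prod_lintegral_of_indepFun Finset.univ
    (fun i (z : ι → F) => f i (z i)) h (fun i => (hf i).comp (measurable_pi_apply i))
  refine h'.trans ?_
  refine Finset.prod_congr rfl fun i _ => ?_
  exact (measurePreserving_eval (fun _ : ι => μ) i).lintegral_comp (hf i)

end GaussianIntegrals

/-! ### Deviations and moments of chi-square variables -/

section ChiSquare

theorem exp_neg_add_sq_le {y : ℝ} (h2 : y ≤ 1 / 2) :
    Real.exp (-(y + y ^ 2)) ≤ 1 - y := by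
  rw [Real.exp_neg, inv_le_comm₀ (Real.exp_pos _) (by linarith), inv_le_iff_one_le_mul₀ (by linarith)]
  rcases le_total 0 y with hy | hy
  · have h := Real.quadratic_le_exp_of_nonneg (x := y + y ^ 2) (by positivity)
    have h3 : 1 ≤ (1 + (y + y ^ 2) + (y + y ^ 2) ^ 2 / 2) * (1 - y) := by
      have : 0 ≤ y ^ 2 * ((1 + y) ^ 2 * (1 - y) / 2 - y) := by
        apply mul_nonneg (sq_nonneg y)
        nlinarith [mul_nonneg hy (by linarith : (0 : ℝ) ≤ 1 / 2 - y),
          mul_nonneg (mul_nonneg hy hy) (by linarith : (0 : ℝ) ≤ 1 / 2 - y)]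
      nlinarith
    calc (1 : ℝ) ≤ (1 + (y + y ^ 2) + (y + y ^ 2) ^ 2 / 2) * (1 - y) := h3
      _ ≤ _ := mul_le_mul_of_nonneg_right h (by linarith)
  · have h := Real.add_one_le_exp (y + y ^ 2)
    have h3 : 1 ≤ (y + y ^ 2 + 1) * (1 - y) := by nlinarith [mul_nonneg (sq_nonneg y) (neg_nonneg.2 hy)]
    calc (1 : ℝ) ≤ (y + y ^ 2 + 1) * (1 - y) := h3
      _ ≤ _ := mul_le_mul_of_nonneg_right h (by linarith)

variable {F : Type*} [MeasurableSpace F]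

theorem lintegral_exp_sum_sq {μ : Measure F} [IsProbabilityMeasure μ] {f : F → ℝ}
    (hf : Measurable f) (hmap : μ.map f = gaussianReal 0 1) (n : ℕ) {t : ℝ} (ht : 2 * t < 1) :
    ∫⁻ z, ENNReal.ofReal (Real.exp (t * ∑ i, f (z i) ^ 2)) ∂(Measure.pi fun _ : Fin n => μ)
      = ENNReal.ofReal ((√(1 - 2 * t))⁻¹) ^ n := by
  have h1 : ∀ z : Fin n → F, ENNReal.ofReal (Real.exp (t * ∑ i, f (z i) ^ 2))
      = ∏ i, ENNReal.ofReal (Real.exp (t * f (z i) ^ 2)) := by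
    intro z
    rw [Finset.mul_sum, Real.exp_sum, ENNReal.ofReal_prod_of_nonneg fun i _ => (Real.exp_pos _).le]
  simp_rw [h1]
  rw [lintegral_pi_prod μ (fun _ x => ENNReal.ofReal (Real.exp (t * f x ^ 2)))
    (fun _ => by fun_prop)]
  have h2 : ∫⁻ x, ENNReal.ofReal (Real.exp (t * f x ^ 2)) ∂μ
      = ENNReal.ofReal ((√(1 - 2 * t))⁻¹) := by
    have h3 := lintegral_map (μ := μ) (f := fun y => ENNReal.ofReal (Real.exp (t * y ^ 2)))
      (by fun_prop) hf
    rw [← h3, hmap]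
    have h4 := lintegral_exp_sq_gaussianReal 0 1 t (by linarith)
    simpa using h4
  simp [h2]

/-- The logarithm of the Laplace transform of a squared standard normal exceeds its linear part by
at most `2 t²`. This holds for both signs of `t`, so one computation serves both tails. -/
theorem inv_sqrt_le_exp {t : ℝ} (h2 : t ≤ 1 / 4) :
    (√(1 - 2 * t))⁻¹ ≤ Real.exp (t + 2 * t ^ 2) := by
  have h := exp_neg_add_sq_le (y := 2 * t) (by linarith)
  have h3 : Real.exp (-(t + 2 * t ^ 2)) ≤ √(1 - 2 * t) := by
    apply Real.le_sqrt_of_sq_le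
    rw [sq, ← Real.exp_add]
    convert h using 2
    ring
  rw [inv_le_comm₀ (Real.sqrt_pos.2 (by linarith)) (Real.exp_pos _), ← Real.exp_neg]
  exact h3

/-- Chernoff's bound with `t = ± ε / 4`, for which `2 t² - |t| ε = -ε² / 8`. -/
theorem measure_chiSq_dev {μ : Measure F} [IsProbabilityMeasure μ] {f : F → ℝ}
    (hf : Measurable f) (hmap : μ.map f = gaussianReal 0 1) {n : ℕ} (hn : 1 ≤ n) {ε : ℝ}
    (h0 : 0 < ε) (h1 : ε ≤ 1) :
    (Measure.pi fun _ : Fin n => μ) {z | ε < |(n : ℝ)⁻¹ * ∑ i, f (z i) ^ 2 - 1|}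
      ≤ ENNReal.ofReal (2 * Real.exp (-(n * ε ^ 2 / 8))) := by
  have hn' : (0 : ℝ) < n := by exact_mod_cast hn
  have key : ∀ t : ℝ, -(1 / 4) ≤ t → t ≤ 1 / 4 → ε = 4 * |t| →
      ∫⁻ z, ENNReal.ofReal (Real.exp (t * ∑ i, f (z i) ^ 2)) *
        ENNReal.ofReal (Real.exp (-(n * (t + |t| * ε)))) ∂(Measure.pi fun _ : Fin n => μ)
      ≤ ENNReal.ofReal (Real.exp (-(n * ε ^ 2 / 8))) := by
    intro t ht1 ht2 hte
    rw [lintegral_mul_const _ (by fun_prop), lintegral_exp_sum_sq hf hmap n (by linarith),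
      ← ENNReal.ofReal_pow (by positivity), ← ENNReal.ofReal_mul (by positivity)]
    apply ENNReal.ofReal_le_ofReal
    calc (√(1 - 2 * t))⁻¹ ^ n * Real.exp (-(n * (t + |t| * ε)))
        ≤ Real.exp (t + 2 * t ^ 2) ^ n * Real.exp (-(n * (t + |t| * ε))) := by
          gcongr
          exact inv_sqrt_le_exp ht2
      _ = Real.exp (-(n * ε ^ 2 / 8)) := by
          rw [← Real.exp_nat_mul, ← Real.exp_add]
          congr 1
          rw [hte, ← sq_abs t]
          ring
  have hp := key (ε / 4) (by linarith) (by linarith) (by rw [abs_of_pos (by positivity)]; ring)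
  have hm := key (-(ε / 4)) (by linarith) (by linarith)
    (by rw [abs_neg, abs_of_pos (by positivity)]; ring)
  rw [abs_of_pos (by positivity)] at hp
  rw [abs_neg, abs_of_pos (by positivity)] at hm
  have hsub : ∀ z : Fin n → F, Set.indicator {z | ε < |(n : ℝ)⁻¹ * ∑ i, f (z i) ^ 2 - 1|}
      (fun _ => (1 : ℝ≥0∞)) z ≤
      ENNReal.ofReal (Real.exp (ε / 4 * ∑ i, f (z i) ^ 2)) *
        ENNReal.ofReal (Real.exp (-(n * (ε / 4 + ε / 4 * ε)))) +
      ENNReal.ofReal (Real.exp (-(ε / 4) * ∑ i, f (z i) ^ 2)) *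
        ENNReal.ofReal (Real.exp (-(n * (-(ε / 4) + ε / 4 * ε)))) := by
    intro z
    by_cases hz : ε < |(n : ℝ)⁻¹ * ∑ i, f (z i) ^ 2 - 1|
    · rw [Set.indicator_of_mem (by exact hz)]
      set S := ∑ i, f (z i) ^ 2
      have hS : S = n * ((n : ℝ)⁻¹ * S) := by field_simp
      rw [← ENNReal.ofReal_mul (by positivity), ← ENNReal.ofReal_mul (by positivity),
        ← Real.exp_add, ← Real.exp_add]
      rcases lt_abs.1 hz with h | h
      · refine le_trans ?_ (le_self_add)
        rw [ENNReal.one_le_ofReal]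
        apply Real.one_le_exp
        have : (n : ℝ) * (1 + ε) ≤ S := by
          rw [hS]; gcongr; linarith
        nlinarith
      · refine le_trans ?_ (le_add_self)
        rw [ENNReal.one_le_ofReal]
        apply Real.one_le_exp
        have : S ≤ (n : ℝ) * (1 - ε) := by
          rw [hS]; gcongr; linarith
        nlinarith
    · rw [Set.indicator_of_notMem (by exact hz)]
      exact zero_le
  have hmeas : MeasurableSet {z : Fin n → F | ε < |(n : ℝ)⁻¹ * ∑ i, f (z i) ^ 2 - 1|} :=
    measurableSet_lt measurable_const (by fun_prop)
  calc (Measure.pi fun _ : Fin n => μ) {z | ε < |(n : ℝ)⁻¹ * ∑ i, f (z i) ^ 2 - 1|}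
      = ∫⁻ z, (Set.indicator {z | ε < |(n : ℝ)⁻¹ * ∑ i, f (z i) ^ 2 - 1|}
          (fun _ => (1 : ℝ≥0∞)) z) ∂(Measure.pi fun _ : Fin n => μ) := by
        rw [lintegral_indicator hmeas]; simp
    _ ≤ _ := lintegral_mono hsub
    _ ≤ ENNReal.ofReal (Real.exp (-(n * ε ^ 2 / 8))) + ENNReal.ofReal (Real.exp (-(n * ε ^ 2 / 8))) := by
        rw [lintegral_add_left (by fun_prop)]
        exact add_le_add hp hm
    _ = _ := by rw [← ENNReal.ofReal_add (by positivity) (by positivity)]; ring_nf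

/-- Only the order `n²` matters. By Cauchy–Schwarz it is enough to bound the fourth moment of one
variable, and `y⁴ ≤ 32 exp (y² / 4)` reduces that to the exponential integral, which equals `√2`. -/
theorem lintegral_sq_sum_sq_le {μ : Measure F} [IsProbabilityMeasure μ] {f : F → ℝ}
    (hf : Measurable f) (hmap : μ.map f = gaussianReal 0 1) (n : ℕ) :
    ∫⁻ z, ENNReal.ofReal ((∑ i, f (z i) ^ 2) ^ 2) ∂(Measure.pi fun _ : Fin n => μ)
      ≤ ENNReal.ofReal (64 * n ^ 2) := by
  have h1 : ∀ y : ℝ, (y ^ 2) ^ 2 ≤ 32 * Real.exp (1 / 4 * y ^ 2) := by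
    intro y
    have := Real.quadratic_le_exp_of_nonneg (x := 1 / 4 * y ^ 2) (by positivity)
    nlinarith [sq_nonneg y]
  have h2 : ∫⁻ x, ENNReal.ofReal (Real.exp (1 / 4 * f x ^ 2)) ∂μ ≤ ENNReal.ofReal 2 := by
    have h3 := lintegral_map (μ := μ) (f := fun y => ENNReal.ofReal (Real.exp (1 / 4 * y ^ 2)))
      (by fun_prop) hf
    rw [← h3, hmap]
    have h4 := lintegral_exp_sq_gaussianReal 0 1 (1 / 4) (by norm_num)
    simp only [zero_add, one_mul, one_pow, mul_one] at h4
    rw [h4]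
    apply ENNReal.ofReal_le_ofReal
    norm_num
  calc ∫⁻ z, ENNReal.ofReal ((∑ i, f (z i) ^ 2) ^ 2) ∂(Measure.pi fun _ : Fin n => μ)
      ≤ ∫⁻ z, ENNReal.ofReal (32 * n) * ∑ i, ENNReal.ofReal (Real.exp (1 / 4 * f (z i) ^ 2))
          ∂(Measure.pi fun _ : Fin n => μ) := by
        apply lintegral_mono
        intro z
        dsimp only
        rw [← ENNReal.ofReal_sum_of_nonneg (fun i _ => (Real.exp_pos _).le),
          ← ENNReal.ofReal_mul (by positivity)]
        apply ENNReal.ofReal_le_ofReal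
        have h5 := sq_sum_le_card_mul_sum_sq (s := Finset.univ) (f := fun i : Fin n => f (z i) ^ 2)
        rw [Finset.card_univ, Fintype.card_fin] at h5
        refine h5.trans ?_
        rw [mul_comm 32 (n : ℝ), mul_assoc]
        apply mul_le_mul_of_nonneg_left _ (by positivity)
        rw [Finset.mul_sum]
        exact Finset.sum_le_sum fun i _ => h1 _
    _ = ENNReal.ofReal (32 * n) * ∑ i : Fin n, ∫⁻ x, ENNReal.ofReal (Real.exp (1 / 4 * f x ^ 2)) ∂μ := by
        rw [lintegral_const_mul _ (by fun_prop), lintegral_finsetSum _ (by fun_prop)]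
        congr 1
        refine Finset.sum_congr rfl fun i _ => ?_
        exact (measurePreserving_eval (fun _ : Fin n => μ) i).lintegral_comp
          (f := fun x => ENNReal.ofReal (Real.exp (1 / 4 * f x ^ 2))) (by fun_prop)
    _ ≤ ENNReal.ofReal (32 * n) * ∑ i : Fin n, ENNReal.ofReal 2 := by
        gcongr
    _ = ENNReal.ofReal (64 * n ^ 2) := by
        rw [Finset.sum_const, Finset.card_univ, Fintype.card_fin, nsmul_eq_mul,
          ← ENNReal.ofReal_natCast, ← ENNReal.ofReal_mul (by positivity),
          ← ENNReal.ofReal_mul (by positivity)]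
        congr 1; ring

theorem lintegral_sum_sq_le {μ : Measure F} [IsProbabilityMeasure μ] {f : F → ℝ}
    (hf : Measurable f) (hmap : μ.map f = gaussianReal 0 1) (n : ℕ) :
    ∫⁻ z, ENNReal.ofReal (∑ i, f (z i) ^ 2) ∂(Measure.pi fun _ : Fin n => μ)
      ≤ ENNReal.ofReal (8 * n) := by
  rcases Nat.eq_zero_or_pos n with rfl | hn
  · simp
  have hn' : (0 : ℝ) < n := by exact_mod_cast hn
  calc ∫⁻ z, ENNReal.ofReal (∑ i, f (z i) ^ 2) ∂(Measure.pi fun _ : Fin n => μ)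
      ≤ ∫⁻ z, (ENNReal.ofReal (4 * n) + ENNReal.ofReal ((16 * n : ℝ)⁻¹) *
          ENNReal.ofReal ((∑ i, f (z i) ^ 2) ^ 2)) ∂(Measure.pi fun _ : Fin n => μ) := by
        apply lintegral_mono
        intro z
        dsimp only
        rw [← ENNReal.ofReal_mul (by positivity), ← ENNReal.ofReal_add (by positivity) (by positivity)]
        apply ENNReal.ofReal_le_ofReal
        set S := ∑ i, f (z i) ^ 2
        -- The first moment follows from the second through `S ≤ 4 n + S² / (16 n)`.
        have : 0 ≤ (16 * n : ℝ)⁻¹ * (S - 8 * n) ^ 2 := by positivity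
        have h2 : (16 * n : ℝ)⁻¹ * (S - 8 * n) ^ 2 = 4 * n + (16 * n : ℝ)⁻¹ * S ^ 2 - S := by
          field_simp; ring
        linarith
    _ ≤ ENNReal.ofReal (4 * n) + ENNReal.ofReal ((16 * n : ℝ)⁻¹) * ENNReal.ofReal (64 * n ^ 2) := by
        rw [lintegral_add_left (by fun_prop), lintegral_const_mul _ (by fun_prop)]
        gcongr
        · simp
        · exact lintegral_sq_sum_sq_le hf hmap n
    _ = ENNReal.ofReal (8 * n) := by
        rw [← ENNReal.ofReal_mul (by positivity), ← ENNReal.ofReal_add (by positivity) (by positivity)]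
        congr 1; field_simp; ring

end ChiSquare

/-! ### Concentration of empirical Gram matrices -/

section GramDeviation

/-- The set of samples for which some entry of the empirical Gram matrix of the functionals `L`
deviates from the identity by more than `1 / (2 p)`. -/
def gramDev {F : Type*} {p : ℕ} (n : ℕ) (L : Fin p → F → ℝ) : Set (Fin n → F) :=
  {z | ∃ i j, 1 / (2 * (p : ℝ)) <
    |(n : ℝ)⁻¹ * ∑ k, L i (z k) * L j (z k) - if i = j then 1 else 0|}

theorem measurableSet_gramDev {F : Type*} [MeasurableSpace F] {p : ℕ} (n : ℕ)
    {L : Fin p → F → ℝ} (hL : ∀ i, Measurable (L i)) : MeasurableSet (gramDev n L) := by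
  have : gramDev n L = ⋃ i, ⋃ j, {z : Fin n → F | 1 / (2 * (p : ℝ)) <
    |(n : ℝ)⁻¹ * ∑ k, L i (z k) * L j (z k) - if i = j then 1 else 0|} := by
    ext z; simp [gramDev]
  rw [this]
  refine MeasurableSet.iUnion fun i => MeasurableSet.iUnion fun j =>
    measurableSet_lt measurable_const ?_
  fun_prop

/-- Since `(∑ |x i|)² ≤ p ∑ x i²`, an entrywise error of `1 / (2 p)` changes the quadratic form by
at most half of the squared norm. -/
theorem abs_sum_sq_sub_le_of_notMem_gramDev {F : Type*} {p n : ℕ} {L : Fin p → F → ℝ}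
    {z : Fin n → F} (hz : z ∉ gramDev n L) (x : Fin p → ℝ) :
    |(n : ℝ)⁻¹ * ∑ k, (∑ j, x j * L j (z k)) ^ 2 - ∑ j, x j ^ 2| ≤ 1 / 2 * ∑ j, x j ^ 2 := by
  rcases Nat.eq_zero_or_pos p with rfl | hp
  · simp
  have hp' : (0 : ℝ) < p := by exact_mod_cast hp
  simp only [gramDev, Set.mem_ofPred_eq, not_exists, not_lt] at hz
  have h1 : (n : ℝ)⁻¹ * ∑ k, (∑ j, x j * L j (z k)) ^ 2 - ∑ j, x j ^ 2
      = ∑ i, ∑ j, x i * x j *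
        ((n : ℝ)⁻¹ * ∑ k, L i (z k) * L j (z k) - if i = j then 1 else 0) := by
    simp only [mul_sub, Finset.sum_sub_distrib]
    congr 1
    · have : ∀ k, (∑ j, x j * L j (z k)) ^ 2
          = ∑ i, ∑ j, x i * L i (z k) * (x j * L j (z k)) := fun k => by
        rw [sq, Finset.sum_mul_sum]
      simp_rw [this, Finset.mul_sum]
      rw [Finset.sum_comm]
      refine Finset.sum_congr rfl fun i _ => ?_
      rw [Finset.sum_comm]
      refine Finset.sum_congr rfl fun j _ => Finset.sum_congr rfl fun k _ => ?_
      ring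
    · simp [sq]
  rw [h1]
  calc |∑ i, ∑ j, x i * x j *
        ((n : ℝ)⁻¹ * ∑ k, L i (z k) * L j (z k) - if i = j then 1 else 0)|
      ≤ ∑ i, ∑ j, |x i| * |x j| * (1 / (2 * (p : ℝ))) := by
        refine (Finset.abs_sum_le_sum_abs _ _).trans (Finset.sum_le_sum fun i _ => ?_)
        refine (Finset.abs_sum_le_sum_abs _ _).trans (Finset.sum_le_sum fun j _ => ?_)
        rw [abs_mul, abs_mul]
        gcongr
        exact hz i j
    _ = (∑ i, |x i|) ^ 2 * (1 / (2 * (p : ℝ))) := by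
        simp only [← Finset.sum_mul, sq, Finset.sum_mul_sum]
    _ ≤ (p * ∑ i, x i ^ 2) * (1 / (2 * (p : ℝ))) := by
        gcongr
        have := sq_sum_le_card_mul_sum_sq (s := Finset.univ) (f := fun i : Fin p => |x i|)
        simpa using this
    _ = 1 / 2 * ∑ j, x j ^ 2 := by field_simp

/-- Polarization: for `i ≠ j`, the product `L i * L j` is half the difference of the squares of `(L
i ± L j) / √2`, which are again standard normal. Each entry thus reduces to chi-square deviations,
and a union bound covers the `p²` entries. -/
theorem measure_gramDev_le {F : Type*} [NormedAddCommGroup F] [NormedSpace ℝ F]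
    [MeasurableSpace F] [BorelSpace F] {μ : Measure F} [IsGaussian μ] {p : ℕ}
    (L : Fin p → F →L[ℝ] ℝ) (h0 : ∀ i, ∫ x, L i x ∂μ = 0)
    (h1 : ∀ i j, ∫ x, L i x * L j x ∂μ = if i = j then 1 else 0) {n : ℕ} (hn : 1 ≤ n) :
    (Measure.pi fun _ : Fin n => μ) (gramDev n fun i => L i)
      ≤ ENNReal.ofReal (p ^ 2 * (4 * Real.exp (-(n / (32 * p ^ 2))))) := by
  have hint : ∀ i, Integrable (L i) μ := fun i => IsGaussian.integrable_dual μ (L i)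
  have hint2 : ∀ i j, Integrable (fun x => L i x * L j x) μ := fun i j =>
    (IsGaussian.memLp_dual μ (L i) 2 (by simp)).integrable_mul
      (IsGaussian.memLp_dual μ (L j) 2 (by simp))
  have hone : ∀ T : F →L[ℝ] ℝ, ∫ x, T x ∂μ = 0 → ∫ x, T x * T x ∂μ = 1 →
      μ.map T = gaussianReal 0 1 := by
    intro T hT0 hT1
    rw [IsGaussian.map_eq_gaussianReal T, hT0]
    have : Var[T; μ] = 1 := by
      rw [variance_eq_sub (IsGaussian.memLp_dual μ T 2 (by simp)), hT0]
      simp only [Pi.pow_apply, sq, hT1]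
      simp
    rw [this]; simp
  have hpair : ∀ i j : Fin p, (Measure.pi fun _ : Fin n => μ) {z | 1 / (2 * (p : ℝ)) <
    |(n : ℝ)⁻¹ * ∑ k, L i (z k) * L j (z k) - if i = j then 1 else 0|}
      ≤ ENNReal.ofReal (4 * Real.exp (-(n / (32 * p ^ 2)))) := by
    intro i j
    have hp : 0 < p := i.pos
    have hp' : (1 : ℝ) ≤ p := by exact_mod_cast hp
    have he1 : 1 / (2 * (p : ℝ)) ≤ 1 := by
      rw [div_le_one (by positivity)]; linarith
    have hexp : Real.exp (-(n * (1 / (2 * (p : ℝ))) ^ 2 / 8)) = Real.exp (-(n / (32 * p ^ 2))) := by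
      congr 2; field_simp; norm_num
    by_cases hij : i = j
    · subst hij
      have hd := measure_chiSq_dev (f := L i) (L i).continuous.measurable
        (hone (L i) (h0 i) (by simpa using h1 i i)) hn (ε := 1 / (2 * (p : ℝ))) (by positivity) he1
      simp only [if_true, ← sq]
      refine hd.trans (ENNReal.ofReal_le_ofReal ?_)
      rw [hexp]
      linarith [Real.exp_pos (-(n / (32 * (p : ℝ) ^ 2)))]
    · have hs2 : (√2)⁻¹ * (√2)⁻¹ = (1 / 2 : ℝ) := by
        rw [← mul_inv, Real.mul_self_sqrt (by norm_num)]; norm_num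
      have hT : ∀ c : ℝ, c * c = 1 → (Measure.pi fun _ : Fin n => μ) {z | 1 / (2 * (p : ℝ)) <
          |(n : ℝ)⁻¹ * ∑ k, (((√2)⁻¹ • (L i + c • L j)) (z k)) ^ 2 - 1|} ≤
          ENNReal.ofReal (2 * Real.exp (-(n / (32 * p ^ 2)))) := by
        intro c hc
        rw [← hexp]
        refine measure_chiSq_dev (ContinuousLinearMap.measurable _) (hone _ ?_ ?_) hn
          (by positivity) he1
        · simp only [smul_apply, add_apply, smul_eq_mul]
          rw [integral_const_mul, integral_add (hint i) ((hint j).const_mul c),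
            integral_const_mul, h0, h0]
          simp
        · simp only [smul_apply, add_apply, smul_eq_mul]
          have : ∀ x, (√2)⁻¹ * (L i x + c * L j x) * ((√2)⁻¹ * (L i x + c * L j x))
              = (1 / 2) * (L i x * L i x) + (c * (L i x * L j x) + (1 / 2) * (L j x * L j x)) := by
            intro x
            linear_combination ((L i x + c * L j x) ^ 2) * hs2 + (1 / 2) * L j x ^ 2 * hc
          simp_rw [this]
          have hadd := integral_add ((hint2 i i).const_mul (1 / 2))
            (((hint2 i j).const_mul c).add ((hint2 j j).const_mul (1 / 2)))
          simp only [Pi.add_apply] at hadd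
          rw [hadd, integral_add ((hint2 i j).const_mul c) ((hint2 j j).const_mul _),
            integral_const_mul, integral_const_mul, integral_const_mul, h1, h1, h1]
          simp [hij]; norm_num
      have hp1 := hT 1 (by norm_num)
      have hm1 := hT (-1) (by norm_num)
      have hsub : {z : Fin n → F | 1 / (2 * (p : ℝ)) <
          |(n : ℝ)⁻¹ * ∑ k, L i (z k) * L j (z k) - if i = j then 1 else 0|} ⊆
          {z | 1 / (2 * (p : ℝ)) <
          |(n : ℝ)⁻¹ * ∑ k, (((√2)⁻¹ • (L i + (1 : ℝ) • L j)) (z k)) ^ 2 - 1|} ∪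
          {z | 1 / (2 * (p : ℝ)) <
          |(n : ℝ)⁻¹ * ∑ k, (((√2)⁻¹ • (L i + (-1 : ℝ) • L j)) (z k)) ^ 2 - 1|} := by
        intro z hz
        by_contra hcon
        simp only [Set.mem_union, Set.mem_ofPred_eq, not_or, not_lt] at hcon
        simp only [Set.mem_ofPred_eq, if_neg hij, sub_zero] at hz
        obtain ⟨ha, hb⟩ := hcon
        have hid : (n : ℝ)⁻¹ * ∑ k, L i (z k) * L j (z k) = (1 / 2) *
          (((n : ℝ)⁻¹ * ∑ k, (((√2)⁻¹ • (L i + (1 : ℝ) • L j)) (z k)) ^ 2 - 1) -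
          ((n : ℝ)⁻¹ * ∑ k, (((√2)⁻¹ • (L i + (-1 : ℝ) • L j)) (z k)) ^ 2 - 1)) := by
          rw [show ∀ a b c : ℝ, (a * b - 1) - (a * c - 1) = a * (b - c) by intros; ring,
            ← Finset.sum_sub_distrib, mul_left_comm]
          congr 1
          rw [Finset.mul_sum]
          refine Finset.sum_congr rfl fun k _ => ?_
          simp only [smul_apply, add_apply, smul_eq_mul]
          linear_combination (-2) * (L i (z k) * L j (z k)) * hs2
        rw [hid, abs_mul, abs_of_pos (by norm_num : (0 : ℝ) < 1 / 2)] at hz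
        have := abs_sub ((n : ℝ)⁻¹ * ∑ k, (((√2)⁻¹ • (L i + (1 : ℝ) • L j)) (z k)) ^ 2 - 1)
          ((n : ℝ)⁻¹ * ∑ k, (((√2)⁻¹ • (L i + (-1 : ℝ) • L j)) (z k)) ^ 2 - 1)
        linarith
      calc _ ≤ _ := measure_mono hsub
        _ ≤ _ := measure_union_le _ _
        _ ≤ _ := add_le_add hp1 hm1
        _ = _ := by
          rw [← ENNReal.ofReal_add (by positivity) (by positivity)]; ring_nf
  have hU : gramDev n (fun i => L i) = ⋃ ij : Fin p × Fin p, {z : Fin n → F | 1 / (2 * (p : ℝ)) <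
    |(n : ℝ)⁻¹ * ∑ k, L ij.1 (z k) * L ij.2 (z k) - if ij.1 = ij.2 then 1 else 0|} := by
    ext z; simp [gramDev]
  rw [hU]
  calc _ ≤ _ := measure_iUnion_fintype_le _ _
    _ ≤ ∑ ij : Fin p × Fin p, ENNReal.ofReal (4 * Real.exp (-(n / (32 * p ^ 2)))) :=
        Finset.sum_le_sum fun ij _ => hpair ij.1 ij.2
    _ = _ := by
      rw [Finset.sum_const, Finset.card_univ, Fintype.card_prod, Fintype.card_fin, nsmul_eq_mul,
        ← ENNReal.ofReal_natCast, ← ENNReal.ofReal_mul (by positivity)]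
      congr 1; push_cast; ring

end GramDeviation

/-! ### Gram–Schmidt for the form `⟨T x, y⟩` -/

section GramSchmidt

variable {H : Type*} [NormedAddCommGroup H] [InnerProductSpace ℝ H]

/-- The Gram–Schmidt process for the bilinear form `⟨T x, y⟩`, with normalization. -/
noncomputable def gramVec (T : H →L[ℝ] H) (f : ℕ → H) (j : ℕ) : H :=
  (√(inner ℝ (T (f j - ∑ i : Fin j, inner ℝ (T (f j)) (gramVec T f i) • gramVec T f i))
    (f j - ∑ i : Fin j, inner ℝ (T (f j)) (gramVec T f i) • gramVec T f i)))⁻¹ •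
    (f j - ∑ i : Fin j, inner ℝ (T (f j)) (gramVec T f i) • gramVec T f i)
termination_by j
decreasing_by all_goals exact i.2

/-- The component of `x` along the Gram–Schmidt vectors with index in `s`. -/
noncomputable def gramPart (T : H →L[ℝ] H) (f : ℕ → H) (s : Finset ℕ) (x : H) : H :=
  ∑ i ∈ s, inner ℝ (T x) (gramVec T f i) • gramVec T f i

/-- The projection, orthogonal for `⟨T x, y⟩`, onto the span of `f 0, …, f (k - 1)`. -/
noncomputable def gramProj (T : H →L[ℝ] H) (f : ℕ → H) (k : ℕ) (x : H) : H :=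
  gramPart T f (Finset.range k) x

theorem gramVec_eq (T : H →L[ℝ] H) (f : ℕ → H) (j : ℕ) :
    gramVec T f j = (√(inner ℝ (T (f j - gramProj T f j (f j))) (f j - gramProj T f j (f j))))⁻¹ •
      (f j - gramProj T f j (f j)) := by
  rw [gramVec, gramProj, gramPart, Finset.sum_range]

/-- This causality is what allows a further column to be integrated out while the projection onto
the earlier ones stays fixed. -/
theorem gramVec_congr (T : H →L[ℝ] H) {f g : ℕ → H} {p : ℕ} (h : ∀ j < p, f j = g j) :
    ∀ j < p, gramVec T f j = gramVec T g j := by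
  intro j
  induction j using Nat.strong_induction_on with
  | _ j ih =>
    intro hj
    have : gramProj T f j (f j) = gramProj T g j (g j) := by
      unfold gramProj gramPart
      refine Finset.sum_congr rfl fun i hi => ?_
      have hi' := Finset.mem_range.1 hi
      rw [ih i hi' (hi'.trans hj), h j hj]
    rw [gramVec_eq, gramVec_eq, this, h j hj]

@[simp] theorem gramPart_add (T : H →L[ℝ] H) (f : ℕ → H) (s : Finset ℕ) (x y : H) :
    gramPart T f s (x + y) = gramPart T f s x + gramPart T f s y := by
  simp [gramPart, inner_add_left, add_smul, Finset.sum_add_distrib]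

@[simp] theorem gramPart_smul (T : H →L[ℝ] H) (f : ℕ → H) (s : Finset ℕ) (c : ℝ) (x : H) :
    gramPart T f s (c • x) = c • gramPart T f s x := by
  simp [gramPart, real_inner_smul_left, mul_smul, Finset.smul_sum]

@[simp] theorem gramPart_zero (T : H →L[ℝ] H) (f : ℕ → H) (s : Finset ℕ) :
    gramPart T f s 0 = 0 := by
  simp [gramPart]

theorem gramPart_sub (T : H →L[ℝ] H) (f : ℕ → H) (s : Finset ℕ) (x y : H) :
    gramPart T f s (x - y) = gramPart T f s x - gramPart T f s y := by
  simp [gramPart, inner_sub_left, sub_smul]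

theorem gramPart_sum (T : H →L[ℝ] H) (f : ℕ → H) (s : Finset ℕ) {ι : Type*} (t : Finset ι)
    (x : ι → H) : gramPart T f s (∑ i ∈ t, x i) = ∑ i ∈ t, gramPart T f s (x i) := by
  classical
  induction t using Finset.induction_on with
  | empty => simp
  | insert a t ha ih => simp [Finset.sum_insert ha, ih]

theorem gramProj_sub_gramProj (T : H →L[ℝ] H) (f : ℕ → H) {m k : ℕ} (h : m ≤ k) (x : H) :
    gramProj T f k x - gramProj T f m x = gramPart T f (Finset.Ico m k) x := by
  unfold gramProj gramPart
  rw [Finset.sum_Ico_eq_sub _ h]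

variable {T : H →L[ℝ] H} (hsym : ∀ x y, inner ℝ (T x) y = inner ℝ x (T y))
  (hpos : ∀ x, x ≠ 0 → 0 < inner ℝ (T x) x) (f : ℕ → H)
include hsym hpos

omit hsym in
theorem gram_nonneg (x : H) : 0 ≤ inner ℝ (T x) x := by
  by_cases h : x = 0
  · simp [h]
  · exact (hpos x h).le

-- A vanishing residual is normalized to zero because `0⁻¹ = 0`. The whole construction therefore
-- needs no linear independence, which random sample columns may lack.
omit hsym in
theorem gramVec_self (j : ℕ) :
    inner ℝ (T (gramVec T f j)) (gramVec T f j) = 1 ∨ gramVec T f j = 0 := by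
  rw [gramVec_eq]
  set u := f j - gramProj T f j (f j)
  by_cases hu : u = 0
  · right; simp [hu]
  · left
    have h := hpos u hu
    rw [map_smul, real_inner_smul_left, real_inner_smul_right]
    have h2 : √(inner ℝ (T u) u) * √(inner ℝ (T u) u) = inner ℝ (T u) u :=
      Real.mul_self_sqrt h.le
    have h3 : √(inner ℝ (T u) u) ≠ 0 := (Real.sqrt_pos.2 h).ne'
    field_simp
    rw [sq, h2]

theorem gramVec_orthogonal_of_lt (j : ℕ) :
    ∀ i < j, inner ℝ (T (gramVec T f i)) (gramVec T f j) = 0 := by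
  induction j using Nat.strong_induction_on with
  | _ j ih =>
    intro i hi
    have key : inner ℝ (T (gramVec T f i)) (f j - gramProj T f j (f j)) = 0 := by
      unfold gramProj gramPart
      rw [inner_sub_right, inner_sum, Finset.sum_eq_single_of_mem i (Finset.mem_range.2 hi)]
      · rw [real_inner_smul_right]
        rcases gramVec_self hpos f i with h | h
        · rw [h, mul_one, hsym (f j), real_inner_comm, sub_self]
        · simp [h]
      · intro l hl hne
        rw [real_inner_smul_right]
        rcases lt_or_gt_of_ne hne with h | h
        · rw [hsym (gramVec T f i), real_inner_comm (T (gramVec T f l)), ih i hi l h, mul_zero]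
        · rw [ih l (Finset.mem_range.1 hl) i h, mul_zero]
    rw [gramVec_eq T f j, real_inner_smul_right, key, mul_zero]

theorem gramVec_orthogonal {i j : ℕ} (h : i ≠ j) :
    inner ℝ (T (gramVec T f i)) (gramVec T f j) = 0 := by
  rcases lt_or_gt_of_ne h with h | h
  · exact gramVec_orthogonal_of_lt hsym hpos f j i h
  · rw [hsym, real_inner_comm, gramVec_orthogonal_of_lt hsym hpos f i j h]

theorem inner_gramVec_gramPart {s : Finset ℕ} {i : ℕ} (hi : i ∈ s) (x : H) :
    inner ℝ (T (gramVec T f i)) (gramPart T f s x) = inner ℝ (T x) (gramVec T f i) := by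
  unfold gramPart
  rw [inner_sum, Finset.sum_eq_single_of_mem i hi]
  · rw [real_inner_smul_right]
    rcases gramVec_self hpos f i with h | h
    · rw [h, mul_one]
    · simp [h]
  · intro l _ hne
    rw [real_inner_smul_right, gramVec_orthogonal hsym hpos f hne.symm, mul_zero]

theorem inner_gramPart_gramVec {s : Finset ℕ} {i : ℕ} (hi : i ∈ s) (x : H) :
    inner ℝ (T (gramPart T f s x)) (gramVec T f i) = inner ℝ (T x) (gramVec T f i) := by
  rw [hsym, real_inner_comm, inner_gramVec_gramPart hsym hpos f hi]

theorem eq_gramProj_self (j : ℕ) : gramProj T f (j + 1) (f j) = f j := by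
  have h1 : inner ℝ (T (f j)) (gramVec T f j) • gramVec T f j = f j - gramProj T f j (f j) := by
    set u := f j - gramProj T f j (f j) with hu
    have hperp : inner ℝ (T (gramProj T f j (f j))) (gramVec T f j) = 0 := by
      unfold gramProj gramPart
      rw [map_sum, sum_inner]
      refine Finset.sum_eq_zero fun i hi => ?_
      rw [map_smul, real_inner_smul_left,
        gramVec_orthogonal_of_lt hsym hpos f j i (Finset.mem_range.1 hi), mul_zero]
    have h2 : inner ℝ (T (f j)) (gramVec T f j) = inner ℝ (T u) (gramVec T f j) := by
      rw [hu, map_sub, inner_sub_left, hperp, sub_zero]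
    rw [h2, gramVec_eq, ← hu]
    by_cases h0 : u = 0
    · simp [h0]
    · have h := hpos u h0
      rw [real_inner_smul_right, smul_smul]
      have h4 : √(inner ℝ (T u) u) * √(inner ℝ (T u) u) = inner ℝ (T u) u :=
        Real.mul_self_sqrt h.le
      have h3 : √(inner ℝ (T u) u) ≠ 0 := (Real.sqrt_pos.2 h).ne'
      have : (√(inner ℝ (T u) u))⁻¹ * inner ℝ (T u) u * (√(inner ℝ (T u) u))⁻¹ = 1 := by
        field_simp
        rw [sq, h4]
      rw [this, one_smul]
  have h5 : gramProj T f (j + 1) (f j) = gramProj T f j (f j) +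
      inner ℝ (T (f j)) (gramVec T f j) • gramVec T f j := by
    unfold gramProj gramPart
    rw [Finset.sum_range_succ]
  rw [h5, h1]; abel

theorem inner_gramVec_of_lt {i j : ℕ} (h : i < j) : inner ℝ (T (f i)) (gramVec T f j) = 0 := by
  rw [← eq_gramProj_self hsym hpos f i]
  unfold gramProj gramPart
  rw [map_sum, sum_inner]
  refine Finset.sum_eq_zero fun l hl => ?_
  rw [map_smul, real_inner_smul_left, gramVec_orthogonal hsym hpos f, mul_zero]
  have := Finset.mem_range.1 hl
  omega

theorem gramProj_apply_of_lt {j k : ℕ} (h : j < k) : gramProj T f k (f j) = f j := by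
  have h1 := gramProj_sub_gramProj T f (Nat.succ_le_of_lt h) (f j)
  have h2 : gramPart T f (Finset.Ico j.succ k) (f j) = 0 := by
    unfold gramPart
    refine Finset.sum_eq_zero fun l hl => ?_
    rw [inner_gramVec_of_lt hsym hpos f (Finset.mem_Ico.1 hl).1, zero_smul]
  rw [h2, sub_eq_zero] at h1
  rw [h1]
  exact eq_gramProj_self hsym hpos f j

omit hsym hpos in
theorem gramVec_mem_span (j : ℕ) :
    gramVec T f j ∈ Submodule.span ℝ (f '' Set.Iio (j + 1)) := by
  induction j using Nat.strong_induction_on with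
  | _ j ih =>
    rw [gramVec_eq]
    refine Submodule.smul_mem _ _ (Submodule.sub_mem _ ?_ ?_)
    · exact Submodule.subset_span ⟨j, by simp, rfl⟩
    · unfold gramProj gramPart
      refine Submodule.sum_mem _ fun i hi => Submodule.smul_mem _ _ ?_
      have hi' := Finset.mem_range.1 hi
      refine Submodule.span_mono (Set.image_mono ?_) (ih i hi')
      exact Set.Iio_subset_Iio (by omega)

omit hsym hpos in
theorem gramProj_mem_span (k : ℕ) (x : H) :
    gramProj T f k x ∈ Submodule.span ℝ (f '' Set.Iio k) := by
  unfold gramProj gramPart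
  refine Submodule.sum_mem _ fun i hi => Submodule.smul_mem _ _ ?_
  refine Submodule.span_mono (Set.image_mono ?_) (gramVec_mem_span f i)
  have := Finset.mem_range.1 hi
  exact Set.Iio_subset_Iio (by omega)

theorem gramProj_of_mem_span {k : ℕ} {x : H} (hx : x ∈ Submodule.span ℝ (f '' Set.Iio k)) :
    gramProj T f k x = x := by
  induction hx using Submodule.span_induction with
  | mem x h =>
    obtain ⟨j, hj, rfl⟩ := h
    exact gramProj_apply_of_lt hsym hpos f hj
  | zero => simp [gramProj]
  | add x y _ _ hx hy => unfold gramProj at *; rw [gramPart_add, hx, hy]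
  | smul c x _ hx => unfold gramProj at *; rw [gramPart_smul, hx]

theorem inner_gramVec_of_mem_span {l j : ℕ} (h : l ≤ j) {x : H}
    (hx : x ∈ Submodule.span ℝ (f '' Set.Iio l)) : inner ℝ (T x) (gramVec T f j) = 0 := by
  rw [← gramProj_of_mem_span hsym hpos f hx]
  unfold gramProj gramPart
  rw [map_sum, sum_inner]
  refine Finset.sum_eq_zero fun i hi => ?_
  rw [map_smul, real_inner_smul_left, gramVec_orthogonal hsym hpos f, mul_zero]
  have := Finset.mem_range.1 hi
  omega

theorem gramProj_gramProj_of_le {k m : ℕ} (h : k ≤ m) (x : H) :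
    gramProj T f m (gramProj T f k x) = gramProj T f k x :=
  gramProj_of_mem_span hsym hpos f
    (Submodule.span_mono (Set.image_mono (Set.Iio_subset_Iio h)) (gramProj_mem_span f k x))

theorem gramPart_gramProj {k : ℕ} {s : Finset ℕ} (hs : ∀ i ∈ s, i < k) (x : H) :
    gramPart T f s (gramProj T f k x) = gramPart T f s x := by
  refine Finset.sum_congr rfl fun i hi => ?_
  unfold gramProj
  rw [inner_gramPart_gramVec hsym hpos f (Finset.mem_range.2 (hs i hi))]

theorem gram_gramPart (s : Finset ℕ) (x : H) :
    inner ℝ (T (gramPart T f s x)) (gramPart T f s x)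
      = ∑ i ∈ s, inner ℝ (T x) (gramVec T f i) ^ 2 := by
  have h : ∀ y, inner ℝ y (gramPart T f s x)
      = ∑ i ∈ s, inner ℝ (T x) (gramVec T f i) * inner ℝ y (gramVec T f i) := by
    intro y
    unfold gramPart
    rw [inner_sum]
    exact Finset.sum_congr rfl fun i _ => real_inner_smul_right _ _ _
  rw [h]
  refine Finset.sum_congr rfl fun i hi => ?_
  rw [inner_gramPart_gramVec hsym hpos f hi, sq]

theorem gram_bessel (s : Finset ℕ) (x : H) :
    ∑ i ∈ s, inner ℝ (T x) (gramVec T f i) ^ 2 ≤ inner ℝ (T x) x := by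
  have h := gram_nonneg hpos (x - gramPart T f s x)
  have h3 : inner ℝ (T (gramPart T f s x)) x = inner ℝ (T x) (gramPart T f s x) := by
    rw [hsym, real_inner_comm]
  rw [map_sub, inner_sub_left, inner_sub_right, inner_sub_right, gram_gramPart hsym hpos f,
    h3] at h
  have h2 : inner ℝ (T x) (gramPart T f s x) = ∑ i ∈ s, inner ℝ (T x) (gramVec T f i) ^ 2 := by
    unfold gramPart
    rw [inner_sum]
    refine Finset.sum_congr rfl fun i hi => ?_
    rw [real_inner_smul_right, sq]
  rw [h2] at h
  linarith

theorem gramVec_self_of_ne {j : ℕ} (h : f j ∉ Submodule.span ℝ (f '' Set.Iio j)) :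
    inner ℝ (T (gramVec T f j)) (gramVec T f j) = 1 := by
  rcases gramVec_self hpos f j with h1 | h1
  · exact h1
  · exfalso
    apply h
    have h2 := eq_gramProj_self hsym hpos f j
    have h3 : gramProj T f (j + 1) (f j) = gramProj T f j (f j) := by
      unfold gramProj gramPart
      rw [Finset.sum_range_succ, h1, smul_zero, add_zero]
    rw [← h2, h3]
    exact gramProj_mem_span f j _

end GramSchmidt

/-! ### Sums of Gaussian columns projected onto their predecessors -/

section ProjectedGaussian

/-- Extension of a finite family by zero to a sequence. -/
def extZero {α : Type*} [Zero α] {p : ℕ} (x : Fin p → α) (j : ℕ) : α :=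
  if h : j < p then x ⟨j, h⟩ else 0

theorem extZero_of_lt {α : Type*} [Zero α] {p : ℕ} (x : Fin p → α) {j : ℕ} (h : j < p) :
    extZero x j = x ⟨j, h⟩ := dif_pos h

theorem sum_range_extZero {α : Type*} [Zero α] {M : Type*} [AddCommMonoid M] {p : ℕ}
    (x : Fin p → α) (g : α → M) : ∑ j ∈ Finset.range p, g (extZero x j) = ∑ j, g (x j) := by
  rw [Finset.sum_range]
  exact Finset.sum_congr rfl fun j _ => by rw [extZero_of_lt x j.2]

variable {E : Type*} [NormedAddCommGroup E] [InnerProductSpace ℝ E]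

theorem id_symm (x y : E) : inner ℝ (ContinuousLinearMap.id ℝ E x) y
    = inner ℝ x (ContinuousLinearMap.id ℝ E y) := rfl

theorem id_posDef (x : E) (hx : x ≠ 0) : 0 < inner ℝ (ContinuousLinearMap.id ℝ E x) x :=
  real_inner_self_pos.2 hx

/-- The sum of the vectors `u j • f j`, `j < p`, each projected onto the span of the preceding
vectors of the sequence `f`. -/
noncomputable def projSum (f : ℕ → E) (p : ℕ) (u : ℕ → ℝ) : E :=
  ∑ j ∈ Finset.range p, u j • gramProj (ContinuousLinearMap.id ℝ E) f j (f j)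

-- Pythagoras for `y + u P x = (y - P y) + P (y + u x)`. Vanishing Gram vectors are left out of the
-- sum because only the others give standard normal coordinates of a Gaussian `x`.
open Classical in
theorem norm_sq_add_gramProj (f : ℕ → E) (r : ℕ) (y x : E) (u : ℝ) :
    ‖y + u • gramProj (ContinuousLinearMap.id ℝ E) f r x‖ ^ 2 =
      ‖y - gramProj (ContinuousLinearMap.id ℝ E) f r y‖ ^ 2 +
      ∑ l ∈ (Finset.range r).filter (fun l => gramVec (ContinuousLinearMap.id ℝ E) f l ≠ 0),
        (inner ℝ (gramVec (ContinuousLinearMap.id ℝ E) f l) y +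
          u * inner ℝ (gramVec (ContinuousLinearMap.id ℝ E) f l) x) ^ 2 := by
  set I := ContinuousLinearMap.id ℝ E
  have hI : ∀ x, I x = x := fun _ => rfl
  have h1 : y + u • gramProj I f r x = (y - gramProj I f r y) + gramProj I f r (y + u • x) := by
    unfold gramProj
    rw [gramPart_add, gramPart_smul]
    abel
  have h2 : inner ℝ (y - gramProj I f r y) (gramProj I f r (y + u • x)) = 0 := by
    have hexp : ∀ w v, inner ℝ w (gramProj I f r v)
        = ∑ i ∈ Finset.range r, inner ℝ v (gramVec I f i) * inner ℝ w (gramVec I f i) := by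
      intro w v
      unfold gramProj gramPart
      rw [inner_sum]
      exact Finset.sum_congr rfl fun i _ => real_inner_smul_right _ _ _
    rw [hexp]
    refine Finset.sum_eq_zero fun i hi => ?_
    have h3 : inner ℝ (gramProj I f r y) (gramVec I f i) = inner ℝ y (gramVec I f i) :=
      inner_gramPart_gramVec (T := I) id_symm id_posDef f hi y
    rw [inner_sub_left, h3, sub_self, mul_zero]
  rw [h1, norm_add_sq_real, h2, mul_zero, add_zero]
  congr 1
  have h3 := gram_gramPart id_symm id_posDef f (Finset.range r) (y + u • x)
  rw [← real_inner_self_eq_norm_sq]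
  refine Eq.trans h3 ?_
  rw [Finset.sum_filter]
  refine Finset.sum_congr rfl fun l _ => ?_
  split_ifs with h
  · rw [← real_inner_comm]
    change inner ℝ _ (y + u • x) ^ 2 = _
    rw [inner_add_right, real_inner_smul_right]
  · rw [not_not] at h
    change inner ℝ (I (y + u • x)) (gramVec I f l) ^ 2 = _
    rw [h]; simp

variable [FiniteDimensional ℝ E] [MeasurableSpace E] [BorelSpace E]

/-- The coordinates of `x` along the nonzero Gram vectors are independent standard normals, so the
integral factorizes into at most `r` one-dimensional ones. Each replaces the rate `s` by `s / (1 - 2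
s u²)`; the part of `y` orthogonal to the span keeps the smaller rate `s`. -/
theorem lintegral_exp_norm_sq_add_gramProj (f : ℕ → E) (r : ℕ) (y : E) {u s : ℝ} (hs : 0 ≤ s)
    (h : 2 * s * u ^ 2 < 1) :
    ∫⁻ x, ENNReal.ofReal (Real.exp (s *
        ‖y + u • gramProj (ContinuousLinearMap.id ℝ E) f r x‖ ^ 2)) ∂(stdGaussian E)
      ≤ ENNReal.ofReal ((√(1 - 2 * s * u ^ 2))⁻¹ ^ r *
          Real.exp (s / (1 - 2 * s * u ^ 2) * ‖y‖ ^ 2)) := by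
  classical
  set I := ContinuousLinearMap.id ℝ E
  set c := 1 - 2 * s * u ^ 2 with hc
  have hc0 : 0 < c := by linarith
  have hc1 : c ≤ 1 := by have : 0 ≤ s * u ^ 2 := by positivity
                         linarith
  set A := (Finset.range r).filter (fun l => gramVec I f l ≠ 0) with hA
  set q : A → E := fun l => gramVec I f l with hq
  have hmap : (stdGaussian E).map (fun x (l : A) => innerSL ℝ (q l) x)
      = Measure.pi fun _ => gaussianReal 0 1 := by
    refine map_eq_pi_gaussianReal (fun l : A => innerSL ℝ (q l)) (fun i => ?_) (fun i j => ?_)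
    · exact integral_strongDual_stdGaussian (innerSL ℝ (q i))
    · have h1 : cov[fun x => inner ℝ (q i) x, fun x => inner ℝ (q j) x; stdGaussian E]
          = inner ℝ (q i) (q j) := by
        rw [← covarianceBilin_apply_eq_cov IsGaussian.memLp_two_id, covarianceBilin_stdGaussian,
          innerSL_apply_apply]
      have hL2 : ∀ i, MemLp (fun x => inner ℝ (q i) x) 2 (stdGaussian E) := fun i =>
        IsGaussian.memLp_dual (stdGaussian E) (innerSL ℝ (q i)) 2 (by simp)
      have h0 : ∀ i, ∫ x, inner ℝ (q i) x ∂(stdGaussian E) = 0 := fun i =>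
        integral_strongDual_stdGaussian (innerSL ℝ (q i))
      rw [covariance_eq_sub (hL2 i) (hL2 j)] at h1
      simp only [Pi.mul_apply, h0, zero_mul, sub_zero] at h1
      refine Eq.trans h1 ?_
      split_ifs with hij
      · subst hij
        rcases gramVec_self (T := I) id_posDef f i with h2 | h2
        · exact h2
        · exact absurd h2 (Finset.mem_filter.1 i.2).2
      · exact gramVec_orthogonal (T := I) id_symm id_posDef f (fun h => hij (Subtype.ext h))
  have hstep : ∀ x, ENNReal.ofReal (Real.exp (s * ‖y + u • gramProj I f r x‖ ^ 2))
      = (fun g : A → ℝ => ENNReal.ofReal (Real.exp (s * ‖y - gramProj I f r y‖ ^ 2)) *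
          ∏ l, ENNReal.ofReal (Real.exp (s * (inner ℝ (q l) y + u * g l) ^ 2)))
        (fun l : A => innerSL ℝ (q l) x) := by
    intro x
    rw [norm_sq_add_gramProj, mul_add, Real.exp_add, ENNReal.ofReal_mul (Real.exp_pos _).le]
    congr 1
    rw [← ENNReal.ofReal_prod_of_nonneg (fun i _ => (Real.exp_pos _).le), ← Real.exp_sum,
      Finset.mul_sum]
    congr 2
    rw [← Finset.sum_coe_sort]
    rfl
  simp_rw [hstep]
  have hmm := lintegral_map (μ := stdGaussian E)
    (f := fun g : A → ℝ => ENNReal.ofReal (Real.exp (s * ‖y - gramProj I f r y‖ ^ 2)) *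
          ∏ l, ENNReal.ofReal (Real.exp (s * (inner ℝ (q l) y + u * g l) ^ 2)))
    (g := fun x (l : A) => innerSL ℝ (q l) x) (by fun_prop) (by fun_prop)
  rw [← hmm, hmap, lintegral_const_mul _ (by fun_prop)]
  have hprod := lintegral_pi_prod (gaussianReal 0 1)
    (fun (l : A) g => ENNReal.ofReal (Real.exp (s * (inner ℝ (q l) y + u * g) ^ 2)))
    (fun l => by fun_prop)
  rw [hprod]
  simp_rw [lintegral_exp_sq_gaussianReal _ _ _ h, ← hc]
  rw [← ENNReal.ofReal_prod_of_nonneg (fun i _ => by positivity),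
    ← ENNReal.ofReal_mul (Real.exp_pos _).le]
  apply ENNReal.ofReal_le_ofReal
  rw [Finset.prod_mul_distrib, ← Real.exp_sum, Finset.prod_const, Finset.card_univ,
    Fintype.card_coe, mul_left_comm, ← Real.exp_add]
  have hn := norm_sq_add_gramProj f r y 0 0
  simp only [zero_smul, add_zero, zero_mul] at hn
  have hcard : A.card ≤ r := (Finset.card_filter_le _ _).trans (by simp)
  have hsq : 1 ≤ (√c)⁻¹ := by
    rw [one_le_inv₀ (Real.sqrt_pos.2 hc0)]
    exact Real.sqrt_le_one.2 hc1
  refine mul_le_mul (pow_le_pow_right₀ hsq hcard) (Real.exp_le_exp.2 ?_) (Real.exp_pos _).le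
    (by positivity)
  rw [hn, mul_add]
  refine add_le_add ?_ (le_of_eq ?_)
  · apply mul_le_mul_of_nonneg_right _ (sq_nonneg _)
    rw [le_div_iff₀ hc0]
    nlinarith
  · rw [Finset.mul_sum]
    have := Finset.sum_coe_sort A (fun l => s / c * inner ℝ (gramVec I f l) y ^ 2)
    rw [← hA, ← this]
    exact Finset.sum_congr rfl fun l _ => by simp only [hq]; ring

omit [FiniteDimensional ℝ E] in
theorem measurable_gramVec [SecondCountableTopology E] {Ω : Type*} [MeasurableSpace Ω]
    {f : Ω → ℕ → E}
    (hf : ∀ j, Measurable fun a => f a j) (j : ℕ) :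
    Measurable fun a => gramVec (ContinuousLinearMap.id ℝ E) (f a) j := by
  induction j using Nat.strong_induction_on with
  | _ j ih =>
    have h1 : Measurable fun a => gramProj (ContinuousLinearMap.id ℝ E) (f a) j (f a j) := by
      unfold gramProj gramPart
      refine Finset.measurable_sum _ fun i hi => ?_
      have := ih i (Finset.mem_range.1 hi)
      have h2 := hf j
      simp only [ContinuousLinearMap.id_apply]
      fun_prop
    have h2 := hf j
    simp_rw [gramVec_eq]
    simp only [ContinuousLinearMap.id_apply]
    fun_prop

omit [FiniteDimensional ℝ E] in
theorem measurable_projSum [SecondCountableTopology E] {Ω : Type*} [MeasurableSpace Ω]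
    {f : Ω → ℕ → E}
    (hf : ∀ j, Measurable fun a => f a j) {u : Ω → ℕ → ℝ} (hu : ∀ j, Measurable fun a => u a j)
    (p : ℕ) : Measurable fun a => projSum (f a) p (u a) := by
  unfold projSum
  refine Finset.measurable_sum _ fun j _ => ?_
  have h1 : Measurable fun a => gramProj (ContinuousLinearMap.id ℝ E) (f a) j (f a j) := by
    unfold gramProj gramPart
    refine Finset.measurable_sum _ fun i hi => ?_
    have := measurable_gramVec hf i
    have h2 := hf j
    simp only [ContinuousLinearMap.id_apply]
    fun_prop
  have := hu j
  fun_prop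

theorem measurable_extZero {Ω α : Type*} [MeasurableSpace Ω] [MeasurableSpace α] [Zero α] {p : ℕ}
    {x : Ω → Fin p → α} (hx : Measurable x) (j : ℕ) : Measurable fun a => extZero (x a) j := by
  unfold extZero
  split_ifs with h
  · exact (measurable_pi_apply _).comp hx
  · exact measurable_const

/-- Induction on the number of columns, integrating out the last one first. With `R = S + 2 u_p²`,
the rate `1 / R` becomes exactly `1 / S`, at the cost of a factor `√(R / S) ^ p`, and these factors
telescope. -/
theorem lintegral_exp_projSum (p : ℕ) (u : ℕ → ℝ) {A : ℝ} (hA : 0 < A) :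
    ∫⁻ ξ, ENNReal.ofReal (Real.exp ((A + 2 * ∑ j ∈ Finset.range p, u j ^ 2)⁻¹ *
        ‖projSum (extZero ξ) p u‖ ^ 2)) ∂(Measure.pi fun _ : Fin p => stdGaussian E)
      ≤ ENNReal.ofReal (√((A + 2 * ∑ j ∈ Finset.range p, u j ^ 2) / A) ^ p) := by
  have hfin : SecondCountableTopology E := by
    have := FiniteDimensional.proper ℝ E
    infer_instance
  induction p with
  | zero => simp [projSum]
  | succ p ih =>
    set S := A + 2 * ∑ j ∈ Finset.range p, u j ^ 2 with hS
    have hS0 : 0 < S := by positivity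
    have hS' : A + 2 * ∑ j ∈ Finset.range (p + 1), u j ^ 2 = S + 2 * u p ^ 2 := by
      rw [Finset.sum_range_succ, hS]; ring
    rw [hS']
    set R := S + 2 * u p ^ 2 with hR
    have hR0 : 0 < R := by positivity
    have hmp := measurePreserving_piFinSuccAbove (fun _ : Fin (p + 1) => stdGaussian E) (Fin.last p)
    have hmeas : ∀ (k : ℕ) (v : ℕ → ℝ) (c : ℝ), Measurable fun ξ : Fin k → E =>
        ENNReal.ofReal (Real.exp (c * ‖projSum (extZero ξ) k v‖ ^ 2)) := by
      intro k v c
      have := measurable_projSum (f := fun ξ : Fin k → E => extZero ξ)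
        (fun j => measurable_extZero measurable_id j) (u := fun _ => v)
        (fun _ => measurable_const) k
      fun_prop
    have h1 := hmp.symm.lintegral_comp (hmeas (p + 1) u R⁻¹)
    have h2 := lintegral_prod_symm' (μ := stdGaussian E)
      (ν := Measure.pi fun _ : Fin p => stdGaussian E) _ ((hmeas (p + 1) u R⁻¹).comp
      (MeasurableEquiv.piFinSuccAbove (fun _ => E) (Fin.last p)).symm.measurable)
    rw [← h1]
    refine (le_of_eq h2).trans ?_
    simp only [Function.comp_apply]
    have hval : ∀ (x : E) (ξ : Fin p → E),
        projSum (extZero ((MeasurableEquiv.piFinSuccAbove (fun _ => E) (Fin.last p)).symm (x, ξ)))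
          (p + 1) u = projSum (extZero ξ) p u +
          u p • gramProj (ContinuousLinearMap.id ℝ E) (extZero ξ) p x := by
      intro x ξ
      set ζ := (MeasurableEquiv.piFinSuccAbove (fun _ => E) (Fin.last p)).symm (x, ξ) with hζ
      have e1 : ∀ j < p, extZero ζ j = extZero ξ j := by
        intro j hj
        rw [extZero_of_lt ζ (Nat.lt_succ_of_lt hj), extZero_of_lt ξ hj]
        have : (⟨j, Nat.lt_succ_of_lt hj⟩ : Fin (p + 1)) = (Fin.last p).succAbove ⟨j, hj⟩ := by
          simp
        rw [this, hζ]
        simp [MeasurableEquiv.piFinSuccAbove, Fin.insertNthEquiv, Fin.snoc, hj]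
      have e2 : extZero ζ p = x := by
        rw [extZero_of_lt ζ (Nat.lt_succ_self p), hζ]
        have : (⟨p, Nat.lt_succ_self p⟩ : Fin (p + 1)) = Fin.last p := rfl
        rw [this]
        simp [MeasurableEquiv.piFinSuccAbove, Fin.insertNthEquiv]
      have e3 : ∀ j ≤ p, ∀ y, gramProj (ContinuousLinearMap.id ℝ E) (extZero ζ) j y
          = gramProj (ContinuousLinearMap.id ℝ E) (extZero ξ) j y := by
        intro j hj y
        unfold gramProj gramPart
        refine Finset.sum_congr rfl fun i hi => ?_
        rw [gramVec_congr _ e1 i ((Finset.mem_range.1 hi).trans_le hj)]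
      unfold projSum
      rw [Finset.sum_range_succ, e2, e3 p le_rfl]
      congr 1
      refine Finset.sum_congr rfl fun j hj => ?_
      have hj' := Finset.mem_range.1 hj
      rw [e3 j hj'.le, e1 j hj']
    simp only [hval]
    have hlt : 2 * R⁻¹ * u p ^ 2 < 1 := by
      rw [mul_comm 2, mul_assoc, inv_mul_lt_iff₀ hR0, hR]; linarith
    have h1c : 1 - 2 * R⁻¹ * u p ^ 2 = S / R := by
      field_simp; rw [hR]; ring
    calc _ ≤ ∫⁻ ξ, ENNReal.ofReal ((√(1 - 2 * R⁻¹ * u p ^ 2))⁻¹ ^ p *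
          Real.exp (R⁻¹ / (1 - 2 * R⁻¹ * u p ^ 2) * ‖projSum (extZero ξ) p u‖ ^ 2))
          ∂(Measure.pi fun _ : Fin p => stdGaussian E) :=
          lintegral_mono fun ξ => lintegral_exp_norm_sq_add_gramProj (extZero ξ) p
            (projSum (extZero ξ) p u) (by positivity) hlt
      _ = ENNReal.ofReal ((√(S / R))⁻¹ ^ p) *
          ∫⁻ ξ, ENNReal.ofReal (Real.exp (S⁻¹ * ‖projSum (extZero ξ) p u‖ ^ 2))
          ∂(Measure.pi fun _ : Fin p => stdGaussian E) := by
          rw [← lintegral_const_mul _ (hmeas p u S⁻¹)]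
          refine lintegral_congr fun ξ => ?_
          rw [← ENNReal.ofReal_mul (by positivity), h1c]
          congr 4
          field_simp
      _ ≤ ENNReal.ofReal ((√(S / R))⁻¹ ^ p) * ENNReal.ofReal (√(S / A) ^ p) := by
          gcongr
      _ = ENNReal.ofReal (√(R / A) ^ p) := by
          rw [← ENNReal.ofReal_mul (by positivity), ← mul_pow, ← Real.sqrt_inv,
            ← Real.sqrt_mul (by positivity)]
          congr 3
          field_simp
      _ ≤ ENNReal.ofReal (√(R / A) ^ (p + 1)) := by
          apply ENNReal.ofReal_le_ofReal
          apply pow_le_pow_right₀ _ (Nat.le_succ p)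
          rw [Real.one_le_sqrt, one_le_div hA, hR, hS]
          have : 0 ≤ ∑ j ∈ Finset.range p, u j ^ 2 := Finset.sum_nonneg fun _ _ => sq_nonneg _
          nlinarith [sq_nonneg (u p)]

end ProjectedGaussian

/-! ### Uniformity over coefficient vectors -/

section SmoothedMaximum

variable {E : Type*} [NormedAddCommGroup E] [InnerProductSpace ℝ E]

/-- An upper bound for `exp (‖projSum f p e‖² / 16)`, uniform over the unit vectors `e`: an average
over a ball. -/
noncomputable def smoothMax (f : ℕ → E) (p : ℕ) : ℝ≥0∞ :=
  (volume (Metric.ball (0 : EuclideanSpace ℝ (Fin p)) 1))⁻¹ *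
    ∫⁻ u in Metric.ball (0 : EuclideanSpace ℝ (Fin p)) 2,
      ENNReal.ofReal (Real.exp (16⁻¹ * ‖projSum f p (extZero u)‖ ^ 2))

theorem projSum_add (f : ℕ → E) (p : ℕ) (x y : ℕ → ℝ) :
    projSum f p (x + y) = projSum f p x + projSum f p y := by
  simp [projSum, add_smul, Finset.sum_add_distrib]

theorem projSum_smul (f : ℕ → E) (p : ℕ) (c : ℝ) (x : ℕ → ℝ) :
    projSum f p (c • x) = c • projSum f p x := by
  simp [projSum, mul_smul, Finset.smul_sum]

theorem projSum_congr (f : ℕ → E) {p : ℕ} {x y : ℕ → ℝ} (h : ∀ j < p, x j = y j) :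
    projSum f p x = projSum f p y := by
  refine Finset.sum_congr rfl fun j hj => ?_
  rw [h j (Finset.mem_range.1 hj)]

theorem extZero_add {p : ℕ} (u v : EuclideanSpace ℝ (Fin p)) :
    extZero (u + v) = (extZero u + extZero v : ℕ → ℝ) := by
  ext j
  by_cases h : j < p <;> simp [extZero, h]

theorem extZero_sub {p : ℕ} (u v : EuclideanSpace ℝ (Fin p)) :
    extZero (u - v) = (extZero u + (-1 : ℝ) • extZero v : ℕ → ℝ) := by
  ext j
  by_cases h : j < p <;> simp [extZero, h, sub_eq_add_neg]

theorem measurable_extZero_euclidean {p : ℕ} (j : ℕ) :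
    Measurable fun u : EuclideanSpace ℝ (Fin p) => extZero u j := by
  unfold extZero
  split_ifs with h
  · fun_prop
  · exact measurable_const

theorem measurable_exp_projSum [SecondCountableTopology E] [MeasurableSpace E] [BorelSpace E]
    (f : ℕ → E) (p : ℕ) :
    Measurable fun u : EuclideanSpace ℝ (Fin p) =>
      ENNReal.ofReal (Real.exp (16⁻¹ * ‖projSum f p (extZero u)‖ ^ 2)) := by
  have := measurable_projSum (f := fun _ : EuclideanSpace ℝ (Fin p) => f)
    (fun _ => measurable_const) (u := fun u => extZero u) measurable_extZero_euclidean p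
  fun_prop

/-- The function `u ↦ exp (‖projSum f p u‖² / 16)` is convex, so its value at `e` is at most the
mean of its values at `e + v` and `e - v`. Averaging over `v` in the unit ball keeps both points in
the ball of radius `2`. This replaces a discretization of the sphere. -/
theorem le_smoothMax [SecondCountableTopology E] (f : ℕ → E) (p : ℕ)
    {e : EuclideanSpace ℝ (Fin p)} (he : ‖e‖ ≤ 1) :
    ENNReal.ofReal (Real.exp (16⁻¹ * ‖projSum f p (extZero e)‖ ^ 2)) ≤ smoothMax f p := by
  borelize E
  set F : EuclideanSpace ℝ (Fin p) → ℝ≥0∞ := fun u =>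
    ENNReal.ofReal (Real.exp (16⁻¹ * ‖projSum f p (extZero u)‖ ^ 2)) with hF
  have hFm : Measurable F := measurable_exp_projSum f p
  set B := Metric.ball (0 : EuclideanSpace ℝ (Fin p)) 1 with hB
  have hBm : MeasurableSet B := Metric.isOpen_ball.measurableSet
  set B2 := Metric.ball (0 : EuclideanSpace ℝ (Fin p)) 2 with hB2
  have hB2m : MeasurableSet B2 := Metric.isOpen_ball.measurableSet
  have h1 : ∀ v ∈ B, e + v ∈ B2 ∧ e - v ∈ B2 := by
    intro v hv
    rw [hB, mem_ball_zero_iff] at hv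
    constructor <;> rw [hB2, mem_ball_zero_iff]
    · linarith [norm_add_le e v]
    · linarith [norm_sub_le e v]
  have hplus : ∫⁻ v in B, F (e + v) ≤ ∫⁻ u in B2, F u := by
    rw [← lintegral_indicator hBm, ← lintegral_indicator hB2m,
      ← lintegral_add_left_eq_self (B2.indicator F) e]
    refine lintegral_mono fun v => ?_
    by_cases hv : v ∈ B
    · rw [Set.indicator_of_mem hv, Set.indicator_of_mem (h1 v hv).1]
    · rw [Set.indicator_of_notMem hv]; exact zero_le
  have hminus : ∫⁻ v in B, F (e - v) ≤ ∫⁻ u in B2, F u := by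
    rw [← lintegral_indicator hBm, ← lintegral_indicator hB2m,
      ← lintegral_sub_left_eq_self (B2.indicator F) e]
    refine lintegral_mono fun v => ?_
    by_cases hv : v ∈ B
    · rw [Set.indicator_of_mem hv, Set.indicator_of_mem (h1 v hv).2]
    · rw [Set.indicator_of_notMem hv]; exact zero_le
  have hpt : ∀ v, 2 * F e ≤ F (e + v) + F (e - v) := by
    intro v
    simp only [hF]
    have htwo : ∀ c : ℝ, (2 : ℝ≥0∞) * ENNReal.ofReal c = ENNReal.ofReal (2 * c) := fun c => by
      rw [ENNReal.ofReal_mul (by norm_num)]; simp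
    rw [← ENNReal.ofReal_add (Real.exp_pos _).le (Real.exp_pos _).le, htwo]
    apply ENNReal.ofReal_le_ofReal
    rw [extZero_add, extZero_sub, projSum_add, projSum_add, projSum_smul]
    set a := projSum f p (extZero e)
    set b := projSum f p (extZero v)
    have hpar := parallelogram_law_with_norm ℝ a b
    rw [neg_one_smul, ← sub_eq_add_neg]
    set x := 16⁻¹ * ‖a + b‖ ^ 2
    set y := 16⁻¹ * ‖a - b‖ ^ 2
    have hxy : 16⁻¹ * ‖a‖ ^ 2 ≤ (x + y) / 2 := by
      simp only [x, y]
      nlinarith [sq_nonneg ‖b‖]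
    have h2 : Real.exp (16⁻¹ * ‖a‖ ^ 2) ≤ Real.exp (x / 2) * Real.exp (y / 2) := by
      rw [← Real.exp_add]
      exact Real.exp_le_exp.2 (by linarith)
    have h3 : Real.exp x = Real.exp (x / 2) ^ 2 := by rw [← Real.exp_nat_mul]; congr 1; push_cast; ring
    have h4 : Real.exp y = Real.exp (y / 2) ^ 2 := by rw [← Real.exp_nat_mul]; congr 1; push_cast; ring
    rw [h3, h4]
    nlinarith [sq_nonneg (Real.exp (x / 2) - Real.exp (y / 2))]
  have hvol0 : volume B ≠ 0 := (Metric.measure_ball_pos volume _ one_pos).ne'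
  have hvolt : volume B ≠ ⊤ := measure_ball_lt_top.ne
  have htot : 2 * (F e * volume B) ≤ 2 * ∫⁻ u in B2, F u := by
    calc 2 * (F e * volume B) = ∫⁻ _ in B, 2 * F e := by
          rw [setLIntegral_const, mul_assoc]
      _ ≤ ∫⁻ v in B, (F (e + v) + F (e - v)) := lintegral_mono fun v => hpt v
      _ = (∫⁻ v in B, F (e + v)) + ∫⁻ v in B, F (e - v) :=
          lintegral_add_left (hFm.comp (measurable_const_add e)) _
      _ ≤ (∫⁻ u in B2, F u) + ∫⁻ u in B2, F u := add_le_add hplus hminus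
      _ = _ := by rw [two_mul]
  have htot' : F e * volume B ≤ ∫⁻ u in B2, F u := by
    rwa [ENNReal.mul_le_mul_iff_right (by norm_num) (by norm_num)] at htot
  change F e ≤ (volume B)⁻¹ * ∫⁻ u in B2, F u
  rw [mul_comm, ← div_eq_mul_inv, ENNReal.le_div_iff_mul_le (Or.inl hvol0) (Or.inl hvolt)]
  exact htot'

theorem one_le_smoothMax [SecondCountableTopology E] (f : ℕ → E) (p : ℕ) :
    1 ≤ smoothMax f p := by
  refine le_trans ?_ (le_smoothMax f p (e := 0) (by simp))
  rw [ENNReal.one_le_ofReal]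
  exact Real.one_le_exp (by positivity)

/-- Normalization to a unit vector, then logarithms. The random factor is the same for all
coefficient vectors, hence the bound may be used with data-dependent ones. -/
theorem norm_projSum_sq_le [SecondCountableTopology E] (f : ℕ → E) (p : ℕ)
    (h : smoothMax f p ≠ ⊤) (x : ℕ → ℝ) :
    ‖projSum f p x‖ ^ 2
      ≤ 16 * Real.log (smoothMax f p).toReal * ∑ j ∈ Finset.range p, x j ^ 2 := by
  set N := ∑ j ∈ Finset.range p, x j ^ 2 with hN
  have hN0 : 0 ≤ N := Finset.sum_nonneg fun _ _ => sq_nonneg _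
  rcases hN0.eq_or_lt with h0 | h0
  · have hx : ∀ j < p, x j = 0 := by
      intro j hj
      have := (Finset.sum_eq_zero_iff_of_nonneg fun _ _ => sq_nonneg _).1 (hN.symm.trans h0.symm) j
        (Finset.mem_range.2 hj)
      exact pow_eq_zero_iff (two_ne_zero) |>.1 this
    have : projSum f p x = 0 := by
      unfold projSum
      exact Finset.sum_eq_zero fun j hj => by rw [hx j (Finset.mem_range.1 hj), zero_smul]
    rw [this, ← h0]; simp
  · set e : EuclideanSpace ℝ (Fin p) := WithLp.toLp 2 fun j => (√N)⁻¹ * x j with he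
    have hs : 0 < √N := Real.sqrt_pos.2 h0
    have hss : √N ^ 2 = N := Real.sq_sqrt hN0
    have hen : ‖e‖ ≤ 1 := by
      have : ‖e‖ ^ 2 = 1 := by
        rw [EuclideanSpace.real_norm_sq_eq]
        simp only [he, mul_pow]
        rw [← Finset.mul_sum, ← Finset.sum_range (fun j => x j ^ 2), ← hN, inv_pow, hss,
          inv_mul_cancel₀ h0.ne']
      nlinarith [norm_nonneg e]
    have h1 := le_smoothMax f p hen
    have h2 : projSum f p (extZero e) = (√N)⁻¹ • projSum f p x := by
      rw [← projSum_smul]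
      refine projSum_congr f fun j hj => ?_
      rw [extZero, dif_pos hj]
      rfl
    rw [h2, norm_smul, mul_pow, Real.norm_eq_abs, sq_abs, inv_pow, hss] at h1
    have h3 := (ENNReal.ofReal_le_iff_le_toReal h).1 h1
    have h4 := Real.log_le_log (Real.exp_pos _) h3
    rw [Real.log_exp] at h4
    have h5 : ‖projSum f p x‖ ^ 2 = 16 * (16⁻¹ * (N⁻¹ * ‖projSum f p x‖ ^ 2)) * N := by
      field_simp
    rw [h5]
    gcongr

variable [FiniteDimensional ℝ E] [MeasurableSpace E] [BorelSpace E]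

theorem measurable_smoothMax (p : ℕ) :
    Measurable fun ξ : Fin p → E => smoothMax (extZero ξ) p := by
  have hfin : SecondCountableTopology E := by
    have := FiniteDimensional.proper ℝ E
    infer_instance
  have h := measurable_projSum (f := fun a : (Fin p → E) × EuclideanSpace ℝ (Fin p) => extZero a.1)
    (fun j => measurable_extZero measurable_fst j) (u := fun a => extZero a.2)
    (fun j => (measurable_extZero_euclidean j).comp measurable_snd) p
  have h2 : Measurable fun a : (Fin p → E) × EuclideanSpace ℝ (Fin p) =>
      ENNReal.ofReal (Real.exp (16⁻¹ * ‖projSum (extZero a.1) p (extZero a.2)‖ ^ 2)) := by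
    fun_prop
  exact (h2.lintegral_prod_right').const_mul _

/-- By Tonelli it is enough to bound the mean at a fixed `u` with `‖u‖ ≤ 2`. The choice `A = 8`
gives `A + 2 ‖u‖² ≤ 16`, matching the rate `1 / 16`, and the ratio `16 / 8 = 2`. The remaining
factor `2 ^ p` is the ratio of the volumes of the balls. -/
theorem lintegral_smoothMax_le (p : ℕ) :
    ∫⁻ ξ, smoothMax (extZero ξ) p ∂(Measure.pi fun _ : Fin p => stdGaussian E)
      ≤ ENNReal.ofReal ((2 * √2) ^ p) := by
  have hfin : SecondCountableTopology E := by
    have := FiniteDimensional.proper ℝ E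
    infer_instance
  have h := measurable_projSum (f := fun a : (Fin p → E) × EuclideanSpace ℝ (Fin p) => extZero a.1)
    (fun j => measurable_extZero measurable_fst j) (u := fun a => extZero a.2)
    (fun j => (measurable_extZero_euclidean j).comp measurable_snd) p
  have h2 : Measurable fun a : (Fin p → E) × EuclideanSpace ℝ (Fin p) =>
      ENNReal.ofReal (Real.exp (16⁻¹ * ‖projSum (extZero a.1) p (extZero a.2)‖ ^ 2)) := by
    fun_prop
  set B := Metric.ball (0 : EuclideanSpace ℝ (Fin p)) 1 with hB
  set B2 := Metric.ball (0 : EuclideanSpace ℝ (Fin p)) 2 with hB2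
  have hvol0 : volume B ≠ 0 := (Metric.measure_ball_pos volume _ one_pos).ne'
  have hvolt : volume B ≠ ⊤ := measure_ball_lt_top.ne
  have hvol2 : volume B2 = ENNReal.ofReal (2 ^ p) * volume B := by
    have := Measure.addHaar_ball_of_pos (volume : Measure (EuclideanSpace ℝ (Fin p))) 0
      (r := 2) (by norm_num)
    rw [hB2, this]
    simp [hB]
  have hone : ∀ u ∈ B2, ∫⁻ ξ, ENNReal.ofReal (Real.exp (16⁻¹ *
      ‖projSum (extZero ξ) p (extZero u)‖ ^ 2)) ∂(Measure.pi fun _ : Fin p => stdGaussian E)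
      ≤ ENNReal.ofReal (√2 ^ p) := by
    intro u hu
    have hsum : ∑ j ∈ Finset.range p, (extZero u j) ^ 2 ≤ 4 := by
      rw [hB2, mem_ball_zero_iff] at hu
      have h3 : ‖u‖ ^ 2 = ∑ j ∈ Finset.range p, (extZero u j) ^ 2 := by
        rw [EuclideanSpace.real_norm_sq_eq]
        exact (sum_range_extZero (p := p) (fun j => u j) (fun x => x ^ 2)).symm
      rw [← h3]
      nlinarith [norm_nonneg u]
    have hsum0 : 0 ≤ ∑ j ∈ Finset.range p, (extZero u j) ^ 2 :=
      Finset.sum_nonneg fun _ _ => sq_nonneg _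
    refine le_trans ?_ ((lintegral_exp_projSum (E := E) p (extZero u) (A := 8)
      (by norm_num)).trans ?_)
    · refine lintegral_mono fun ξ => ENNReal.ofReal_le_ofReal (Real.exp_le_exp.2 ?_)
      gcongr
      linarith
    · apply ENNReal.ofReal_le_ofReal
      gcongr
      linarith
  unfold smoothMax
  rw [lintegral_const_mul _ h2.lintegral_prod_right', lintegral_lintegral_swap h2.aemeasurable]
  calc (volume B)⁻¹ * ∫⁻ u in B2, ∫⁻ ξ, ENNReal.ofReal (Real.exp (16⁻¹ *
      ‖projSum (extZero ξ) p (extZero u)‖ ^ 2)) ∂(Measure.pi fun _ : Fin p => stdGaussian E)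
      ≤ (volume B)⁻¹ * ∫⁻ _ in B2, ENNReal.ofReal (√2 ^ p) := by
        exact mul_le_mul' le_rfl (setLIntegral_mono measurable_const hone)
    _ = ENNReal.ofReal ((2 * √2) ^ p) := by
        rw [setLIntegral_const, hvol2, mul_pow, ENNReal.ofReal_mul (by positivity),
          mul_comm, mul_assoc, mul_assoc, ENNReal.mul_inv_cancel hvol0 hvolt, mul_one, mul_comm]

end SmoothedMaximum

/-! ### The law of whitened sample columns -/

section SampleColumns

variable {F : Type*} [NormedAddCommGroup F] [NormedSpace ℝ F]
    [MeasurableSpace F] [BorelSpace F] [SecondCountableTopology F] [CompleteSpace F]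

/-- The vectors `(L j (z i))_i` of the values of the functionals `L j` along the sample `z`. -/
noncomputable def sampleCols {p n : ℕ} (L : Fin p → F → ℝ) (z : Fin n → F) (j : Fin p) :
    EuclideanSpace ℝ (Fin n) :=
  WithLp.toLp 2 fun i => L j (z i)

/-- All `p n` values are jointly Gaussian and uncorrelated: across observations by independence,
within an observation by assumption. They are thus independent, and may be grouped by functional
instead of by observation. -/
theorem map_sampleCols {μ : Measure F} [IsGaussian μ] {p : ℕ}
    (L : Fin p → F →L[ℝ] ℝ) (h0 : ∀ i, ∫ x, L i x ∂μ = 0)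
    (h1 : ∀ i j, ∫ x, L i x * L j x ∂μ = if i = j then 1 else 0) (n : ℕ) :
    (Measure.pi fun _ : Fin n => μ).map (sampleCols fun j => L j)
      = Measure.pi fun _ : Fin p => stdGaussian (EuclideanSpace ℝ (Fin n)) := by
  have hG := isGaussian_pi μ n
  set T : Fin p × Fin n → (Fin n → F) →L[ℝ] ℝ := fun ji =>
    (L ji.1).comp (ContinuousLinearMap.proj ji.2) with hT
  have hTa : ∀ ji z, T ji z = L ji.1 (z ji.2) := fun _ _ => rfl
  have hm1 : ∀ ji, ∫ z, T ji z ∂(Measure.pi fun _ : Fin n => μ) = 0 := by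
    intro ji
    simp_rw [hTa]
    rw [integral_comp_eval (μ := fun _ : Fin n => μ)
      (L ji.1).continuous.measurable.aestronglyMeasurable, h0]
  have hmap := map_eq_pi_gaussianReal (μ := Measure.pi fun _ : Fin n => μ) T hm1 (by
    rintro ⟨j, i⟩ ⟨j', i'⟩
    simp_rw [hTa]
    by_cases hii : i = i'
    · subst hii
      rw [integral_comp_eval (μ := fun _ : Fin n => μ) (f := fun x => L j x * L j' x)
        (by fun_prop), h1]
      simp
    · have hind : iIndepFun (fun (i : Fin n) (z : Fin n → F) => z i) (Measure.pi fun _ => μ) :=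
        iIndepFun_pi (μ := fun _ : Fin n => μ) (X := fun _ => id) (fun _ => aemeasurable_id)
      have hind2 := (hind.indepFun hii).comp (φ := L j) (ψ := L j')
        (L j).continuous.measurable (L j').continuous.measurable
      have hmul := hind2.integral_mul_eq_mul_integral
        ((L j).continuous.measurable.comp (measurable_pi_apply i)).aestronglyMeasurable
        ((L j').continuous.measurable.comp (measurable_pi_apply i')).aestronglyMeasurable
      rw [if_neg (by simp [hii])]
      refine Eq.trans hmul ?_
      have : ∫ z, ((L j) ∘ fun z : Fin n → F => z i) z ∂(Measure.pi fun _ : Fin n => μ) = 0 :=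
        hm1 (j, i)
      rw [this, zero_mul])
  have hcurry := Measure.infinitePi_map_curry (fun (_ : Fin p) (_ : Fin n) => gaussianReal 0 1)
  simp only [Measure.infinitePi_eq_pi] at hcurry
  have hlast : (Measure.pi fun _ : Fin p => Measure.pi fun _ : Fin n => gaussianReal 0 1).map
      (fun x j => WithLp.toLp 2 (x j))
      = Measure.pi fun _ : Fin p => stdGaussian (EuclideanSpace ℝ (Fin n)) := by
    have hst := map_pi_eq_stdGaussian (ι := Fin n)
    have := Measure.pi_map_pi (ι := Fin p) (μ := fun _ => Measure.pi fun _ : Fin n => gaussianReal 0 1)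
      (f := fun _ => WithLp.toLp 2) (fun _ => by fun_prop)
    rw [this, hst]
  rw [← hlast, ← hcurry, ← hmap, Measure.map_map (by fun_prop) (by fun_prop),
    Measure.map_map (by fun_prop) (by fun_prop)]
  rfl

omit [NormedAddCommGroup F] [NormedSpace ℝ F] [BorelSpace F] [SecondCountableTopology F]
  [CompleteSpace F] in
theorem measurable_sampleCols {p n : ℕ} {L : Fin p → F → ℝ} (hL : ∀ j, Measurable (L j)) :
    Measurable (sampleCols L : (Fin n → F) → Fin p → EuclideanSpace ℝ (Fin n)) := by
  unfold sampleCols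
  refine measurable_pi_lambda _ fun j => ?_
  have := hL j
  fun_prop

theorem lintegral_smoothMax_sampleCols {μ : Measure F} [IsGaussian μ] {p : ℕ}
    (L : Fin p → F →L[ℝ] ℝ) (h0 : ∀ i, ∫ x, L i x ∂μ = 0)
    (h1 : ∀ i j, ∫ x, L i x * L j x ∂μ = if i = j then 1 else 0) (n : ℕ) :
    ∫⁻ z, smoothMax (extZero (sampleCols (fun j => L j) z)) p ∂(Measure.pi fun _ : Fin n => μ)
      ≤ ENNReal.ofReal ((2 * √2) ^ p) := by
  refine le_trans (le_of_eq ?_) (lintegral_smoothMax_le (E := EuclideanSpace ℝ (Fin n)) p)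
  rw [← map_sampleCols L h0 h1 n, lintegral_map (measurable_smoothMax p)
    (measurable_sampleCols fun j => (L j).continuous.measurable)]

end SampleColumns

/-! ### Operator monotonicity of the square root -/

section OperatorMonotone

variable {H : Type*} [NormedAddCommGroup H] [InnerProductSpace ℝ H]

/-- Positivity of the form at `x - ‖P‖⁻¹ P x`. -/
theorem norm_sq_apply_le_of_nonneg {P : H →L[ℝ] H} (hsym : ∀ x y, inner ℝ (P x) y = inner ℝ x (P y))
    (hpos : ∀ x, 0 ≤ inner ℝ (P x) x) (x : H) : ‖P x‖ ^ 2 ≤ ‖P‖ * inner ℝ (P x) x := by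
  rcases (norm_nonneg P).eq_or_lt with h0 | h0
  · have : P = 0 := norm_eq_zero.1 h0.symm
    simp [this]
  · have h1 := hpos (x - ‖P‖⁻¹ • P x)
    have h2 : inner ℝ (P (P x)) (P x) ≤ ‖P‖ * ‖P x‖ ^ 2 := by
      calc inner ℝ (P (P x)) (P x) ≤ ‖P (P x)‖ * ‖P x‖ := real_inner_le_norm _ _
        _ ≤ (‖P‖ * ‖P x‖) * ‖P x‖ := by gcongr; exact P.le_opNorm _
        _ = _ := by ring
    have h3 : inner ℝ (P (P x)) x = ‖P x‖ ^ 2 := by rw [hsym, real_inner_self_eq_norm_sq]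
    rw [map_sub, map_smul, inner_sub_left, inner_sub_right, inner_sub_right, real_inner_smul_left,
      real_inner_smul_right, real_inner_smul_left, real_inner_smul_right, h3,
      real_inner_self_eq_norm_sq] at h1
    have h4 : ‖P‖⁻¹ * (‖P‖⁻¹ * inner ℝ (P (P x)) (P x)) ≤ ‖P‖⁻¹ * ‖P x‖ ^ 2 := by
      have : ‖P‖⁻¹ * inner ℝ (P (P x)) (P x) ≤ ‖P x‖ ^ 2 := by
        rw [inv_mul_le_iff₀ h0]; exact h2
      gcongr
    have h5 : ‖P‖⁻¹ * ‖P x‖ ^ 2 ≤ inner ℝ (P x) x := by linarith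
    rwa [inv_mul_le_iff₀ h0] at h5

/-- Operator monotonicity of the square root. -/
theorem inner_le_inner_of_norm_le {A B : H →L[ℝ] H}
    (hA : ∀ x y, inner ℝ (A x) y = inner ℝ x (A y))
    (hB : ∀ x y, inner ℝ (B x) y = inner ℝ x (B y))
    (hB0 : ∀ x, 0 ≤ inner ℝ (B x) x) (h : ∀ x, ‖A x‖ ≤ ‖B x‖) (x : H) :
    inner ℝ (A x) x ≤ inner ℝ (B x) x := by
  by_contra hcon
  push Not at hcon
  -- Let `μ > 0` be the top of the numerical range of `D`. At a near-maximizer `y` the vector `P y =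
  -- μ y - D y` is small, so `⟨D y, (A + B) y⟩` is close to `μ ⟨y, (A + B) y⟩`, which is positive.
  -- But it equals `‖A y‖² - ‖B y‖² ≤ 0`. A maximizer need not exist, so the argument is
  -- quantitative.
  set D := A - B with hD
  have hDsym : ∀ x y, inner ℝ (D x) y = inner ℝ x (D y) := by
    intro x y
    simp only [hD, sub_apply, inner_sub_left, inner_sub_right, hA, hB]
  set R := (fun x => inner ℝ (D x) x) '' Metric.closedBall (0 : H) 1 with hR
  have hbdd : BddAbove R := by
    refine ⟨‖D‖, ?_⟩
    rintro _ ⟨y, hy, rfl⟩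
    rw [mem_closedBall_zero_iff] at hy
    calc inner ℝ (D y) y ≤ ‖D y‖ * ‖y‖ := real_inner_le_norm _ _
      _ ≤ (‖D‖ * ‖y‖) * ‖y‖ := by gcongr; exact D.le_opNorm _
      _ ≤ (‖D‖ * 1) * 1 := by gcongr
      _ = ‖D‖ := by ring
  have hne : R.Nonempty := ⟨_, 0, by simp, rfl⟩
  set μ := sSup R with hμ
  have hle : ∀ y, inner ℝ (D y) y ≤ μ * ‖y‖ ^ 2 := by
    intro y
    by_cases hy : y = 0
    · simp [hy]
    · have hy0 : 0 < ‖y‖ := norm_pos_iff.2 hy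
      have hmem : inner ℝ (D (‖y‖⁻¹ • y)) (‖y‖⁻¹ • y) ≤ μ := by
        refine le_csSup hbdd ⟨‖y‖⁻¹ • y, ?_, rfl⟩
        rw [mem_closedBall_zero_iff, norm_smul, norm_inv, norm_norm, inv_mul_cancel₀ hy0.ne']
      rw [map_smul, real_inner_smul_left, real_inner_smul_right, ← mul_assoc, ← sq] at hmem
      have : inner ℝ (D y) y = (‖y‖⁻¹ ^ 2 * inner ℝ (D y) y) * ‖y‖ ^ 2 := by field_simp
      rw [this]
      gcongr
  have hxpos : 0 < inner ℝ (D x) x := by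
    simp only [hD, sub_apply, inner_sub_left]; linarith
  have hμ0 : 0 < μ := by
    by_contra hneg
    push Not at hneg
    have := hle x
    have h2 : μ * ‖x‖ ^ 2 ≤ 0 := mul_nonpos_of_nonpos_of_nonneg hneg (sq_nonneg _)
    linarith
  set P : H →L[ℝ] H := μ • ContinuousLinearMap.id ℝ H - D with hP
  have hPx : ∀ y, P y = μ • y - D y := fun _ => rfl
  have hPsym : ∀ x y, inner ℝ (P x) y = inner ℝ x (P y) := by
    intro x y
    rw [hPx, hPx, inner_sub_left, inner_sub_right, hDsym, real_inner_smul_left,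
      real_inner_smul_right]
  have hPin : ∀ y, inner ℝ (P y) y = μ * ‖y‖ ^ 2 - inner ℝ (D y) y := by
    intro y
    rw [hPx, inner_sub_left, real_inner_smul_left, real_inner_self_eq_norm_sq]
  have hPpos : ∀ y, 0 ≤ inner ℝ (P y) y := fun y => by rw [hPin]; linarith [hle y]
  set C := ‖A + B‖ with hC
  -- The first entry keeps `μ (μ - ε) ≥ μ² / 2`; the second makes `‖P‖ ε C²` at most `μ⁴ / 8`, which
  -- contradicts the lower bound `μ⁴ / 4`. The `+ 1` keeps the denominator positive.
  set ε := min (μ / 2) (μ ^ 4 / (8 * (C ^ 2 * ‖P‖ + 1))) with hε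
  have hε0 : 0 < ε := by
    refine lt_min (by positivity) (by positivity)
  obtain ⟨_, ⟨y, hy, rfl⟩, hylt⟩ := exists_lt_of_lt_csSup hne (show μ - ε < μ by linarith)
  rw [mem_closedBall_zero_iff] at hy
  simp only at hylt
  have hPy : inner ℝ (P y) y ≤ ε := by
    rw [hPin]
    have : μ * ‖y‖ ^ 2 ≤ μ * 1 := by gcongr; exact pow_le_one₀ (norm_nonneg _) hy
    linarith
  have hPn : ‖P y‖ ^ 2 ≤ ‖P‖ * ε := (norm_sq_apply_le_of_nonneg hPsym hPpos y).trans (by gcongr)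
  have hdiff : inner ℝ (D y) ((A + B) y) ≤ 0 := by
    have h1 : inner ℝ (D y) ((A + B) y) = ‖A y‖ ^ 2 - ‖B y‖ ^ 2 := by
      simp only [hD, sub_apply, add_apply, inner_sub_left, inner_add_right,
        real_inner_self_eq_norm_sq]
      rw [real_inner_comm (B y) (A y)]; ring
    rw [h1]
    have := pow_le_pow_left₀ (norm_nonneg _) (h y) 2
    linarith
  have hAB : μ - ε ≤ inner ℝ y ((A + B) y) := by
    have h1 : inner ℝ y ((A + B) y) = inner ℝ (D y) y + 2 * inner ℝ (B y) y := by
      simp only [hD, sub_apply, add_apply, inner_sub_left, inner_add_right]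
      rw [hA, hB]; ring
    rw [h1]; linarith [hB0 y]
  have hPAB : inner ℝ (P y) ((A + B) y) ≤ ‖P y‖ * C := by
    calc inner ℝ (P y) ((A + B) y) ≤ ‖P y‖ * ‖(A + B) y‖ := real_inner_le_norm _ _
      _ ≤ ‖P y‖ * (C * 1) := by gcongr; exact (A + B).le_opNorm_of_le hy
      _ = _ := by ring
  have hDy : inner ℝ (D y) ((A + B) y) = μ * inner ℝ y ((A + B) y) - inner ℝ (P y) ((A + B) y) := by
    rw [hPx, inner_sub_left, real_inner_smul_left]; ring
  have hmain : μ ^ 2 / 2 ≤ ‖P y‖ * C := by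
    have h1 : μ * (μ - ε) ≤ ‖P y‖ * C := by
      have := mul_le_mul_of_nonneg_left hAB hμ0.le
      linarith
    have h2 : ε ≤ μ / 2 := min_le_left _ _
    nlinarith
  have hsq : (μ ^ 2 / 2) ^ 2 ≤ ‖P‖ * ε * C ^ 2 := by
    calc (μ ^ 2 / 2) ^ 2 ≤ (‖P y‖ * C) ^ 2 := by gcongr
      _ = ‖P y‖ ^ 2 * C ^ 2 := by ring
      _ ≤ _ := by gcongr
  have h8 : ε * (8 * (C ^ 2 * ‖P‖ + 1)) ≤ μ ^ 4 := by
    rw [← le_div_iff₀ (by positivity)]; exact min_le_right _ _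
  have hμ4 : 0 < μ ^ 4 := by positivity
  nlinarith

end OperatorMonotone

/-! ### The diagonal comparison operator -/

section DiagonalOperator

variable {H : Type*} [NormedAddCommGroup H] [InnerProductSpace ℝ H] [CompleteSpace H]
  (ψ : HilbertBasis ℕ ℝ H)

omit [CompleteSpace H] in
theorem orthonormal_inner (i j : ℕ) : inner ℝ (ψ i) (ψ j) = if i = j then (1 : ℝ) else 0 :=
  orthonormal_iff_ite.1 ψ.orthonormal i j

/-- The operator that is diagonal in the basis `ψ`, with eigenvalues `l`. -/
noncomputable def diagOp (l : ℕ → ℝ) : H →L[ℝ] H :=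
  ∑' j, l j • (innerSL ℝ (ψ j)).smulRight (ψ j)

variable {l : ℕ → ℝ} (hl : ∀ j, 0 ≤ l j) (hs : Summable l)
include hl hs

theorem inner_diagOp (k : ℕ) (f : H) : inner ℝ (ψ k) (diagOp ψ l f) = l k * inner ℝ (ψ k) f := by
  have hsum : Summable fun j => l j • (innerSL ℝ (ψ j)).smulRight (ψ j) := by
    refine Summable.of_norm_bounded hs fun j => ?_
    rw [norm_smul, Real.norm_of_nonneg (hl j), ContinuousLinearMap.norm_smulRight_apply,
      innerSL_apply_norm, ψ.orthonormal.norm_eq_one, mul_one, mul_one]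
  have h1 : HasSum (fun j => inner ℝ (ψ k) ((l j • (innerSL ℝ (ψ j)).smulRight (ψ j)) f))
      (inner ℝ (ψ k) (diagOp ψ l f)) := by
    have h2 := hsum.hasSum.mapL ((innerSL ℝ (ψ k)).comp (ContinuousLinearMap.apply ℝ H f))
    exact h2
  have h3 : HasSum (fun j => inner ℝ (ψ k) ((l j • (innerSL ℝ (ψ j)).smulRight (ψ j)) f))
      (l k * inner ℝ (ψ k) f) := by
    have h4 := hasSum_single (f := fun j => inner ℝ (ψ k)
      ((l j • (innerSL ℝ (ψ j)).smulRight (ψ j)) f)) k (by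
      intro j hj
      simp [real_inner_smul_right, orthonormal_inner, hj.symm])
    simpa [real_inner_smul_right, orthonormal_inner, ψ.orthonormal.norm_eq_one] using h4
  exact h1.unique h3

omit hl hs [CompleteSpace H] in
theorem ofReal_inner_self_of_coords {g f : H} {c : ℕ → ℝ} (hc : ∀ j, 0 ≤ c j)
    (hg : ∀ j, inner ℝ (ψ j) g = c j * inner ℝ (ψ j) f) :
    ENNReal.ofReal (inner ℝ g f) = wNormSq ψ c f := by
  have h := ψ.hasSum_inner_mul_inner g f
  have h2 : ∀ j, inner ℝ g (ψ j) * inner ℝ (ψ j) f = c j * inner ℝ (ψ j) f ^ 2 := by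
    intro j
    rw [real_inner_comm, hg]; ring
  simp_rw [h2] at h
  rw [← h.tsum_eq, ENNReal.ofReal_tsum_of_nonneg (fun j => mul_nonneg (hc j) (sq_nonneg _))
    h.summable]
  rfl

theorem ofReal_inner_diagOp (f : H) :
    ENNReal.ofReal (inner ℝ (diagOp ψ l f) f) = wNormSq ψ l f :=
  ofReal_inner_self_of_coords ψ hl fun j => inner_diagOp ψ hl hs j f

theorem ofReal_norm_sq_diagOp (f : H) :
    ENNReal.ofReal (‖diagOp ψ l f‖ ^ 2) = wNormSq ψ (fun j => l j ^ 2) f := by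
  have h := ψ.hasSum_inner_mul_inner (diagOp ψ l f) (diagOp ψ l f)
  have h2 : ∀ j, inner ℝ (diagOp ψ l f) (ψ j) * inner ℝ (ψ j) (diagOp ψ l f)
      = l j ^ 2 * inner ℝ (ψ j) f ^ 2 := by
    intro j
    rw [real_inner_comm, inner_diagOp ψ hl hs]; ring
  simp_rw [h2, real_inner_self_eq_norm_sq] at h
  rw [← h.tsum_eq, ENNReal.ofReal_tsum_of_nonneg (fun j => by positivity) h.summable]
  rfl

theorem diagOp_symm (x y : H) : inner ℝ (diagOp ψ l x) y = inner ℝ x (diagOp ψ l y) := by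
  rw [← (ψ.hasSum_inner_mul_inner (diagOp ψ l x) y).tsum_eq,
    ← (ψ.hasSum_inner_mul_inner x (diagOp ψ l y)).tsum_eq]
  refine tsum_congr fun j => ?_
  rw [inner_diagOp ψ hl hs, real_inner_comm, inner_diagOp ψ hl hs, real_inner_comm]
  ring

theorem diagOp_nonneg (x : H) : 0 ≤ inner ℝ (diagOp ψ l x) x := by
  rw [← (ψ.hasSum_inner_mul_inner (diagOp ψ l x) x).tsum_eq]
  refine tsum_nonneg fun j => ?_
  rw [real_inner_comm, inner_diagOp ψ hl hs, mul_assoc]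
  exact mul_nonneg (hl j) (mul_self_nonneg _)

/-- The class compares `T²` with the square of the diagonal operator up to `d²`; operator
monotonicity of the square root compares `T` with the diagonal operator up to `d`. -/
theorem opClass_inner_le {d : ℝ} (hd : 1 ≤ d) {T : H →L[ℝ] H} (hT : T ∈ opClass ψ l d) (f : H) :
    inner ℝ (T f) f ≤ d * inner ℝ (diagOp ψ l f) f ∧
      inner ℝ (diagOp ψ l f) f ≤ d * inner ℝ (T f) f := by
  have hd0 : 0 < d := by linarith
  obtain ⟨hpos, -, -, hb⟩ := hT
  have hTsym : ∀ x y, inner ℝ (T x) y = inner ℝ x (T y) := hpos.isSymmetric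
  have hTpos : ∀ x, 0 ≤ inner ℝ (T x) x := fun x => hpos.inner_nonneg_left x
  simp_rw [← ofReal_norm_sq_diagOp ψ hl hs] at hb
  constructor
  · have h1 := inner_le_inner_of_norm_le (A := T) (B := d • diagOp ψ l) hTsym
      (fun x y => by
        simp only [smul_apply, real_inner_smul_left, real_inner_smul_right,
          diagOp_symm ψ hl hs x y])
      (fun x => by
        simp only [smul_apply, real_inner_smul_left]
        exact mul_nonneg hd0.le (diagOp_nonneg ψ hl hs x))
      (fun x => by
        have h2 := (hb x).2
        rw [← ENNReal.ofReal_mul (by positivity), ENNReal.ofReal_le_ofReal_iff (by positivity),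
          ← mul_pow] at h2
        rw [smul_apply, norm_smul, Real.norm_of_nonneg hd0.le]
        exact le_of_sq_le_sq h2 (by positivity)) f
    simpa [real_inner_smul_left] using h1
  · have h1 := inner_le_inner_of_norm_le (A := diagOp ψ l) (B := d • T) (diagOp_symm ψ hl hs)
      (fun x y => by
        simp only [smul_apply, real_inner_smul_left, real_inner_smul_right, hTsym x y])
      (fun x => by
        simp only [smul_apply, real_inner_smul_left]
        exact mul_nonneg hd0.le (hTpos x))
      (fun x => by
        have h2 := (hb x).1
        rw [← ENNReal.ofReal_mul (by positivity), ENNReal.ofReal_le_ofReal_iff (by positivity),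
          inv_mul_le_iff₀ (by positivity), ← mul_pow] at h2
        rw [smul_apply, norm_smul, Real.norm_of_nonneg hd0.le]
        exact le_of_sq_le_sq h2 (by positivity)) f
    simpa [real_inner_smul_left] using h1

end DiagonalOperator

/-! ### Weighted norms and triangular maps -/

section WeightedNorms

variable {H : Type*} [NormedAddCommGroup H] [InnerProductSpace ℝ H]
  (ψ : HilbertBasis ℕ ℝ H)

theorem wNormSq_add_le {w : ℕ → ℝ} (hw : ∀ j, 0 ≤ w j) (f g : H) :
    wNormSq ψ w (f + g) ≤ 2 * wNormSq ψ w f + 2 * wNormSq ψ w g := by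
  unfold wNormSq
  rw [← ENNReal.tsum_mul_left, ← ENNReal.tsum_mul_left, ← ENNReal.tsum_add]
  refine ENNReal.tsum_le_tsum fun j => ?_
  have htwo : ∀ c : ℝ, (2 : ℝ≥0∞) * ENNReal.ofReal c = ENNReal.ofReal (2 * c) := fun c => by
    rw [ENNReal.ofReal_mul (by norm_num)]; simp
  have h1 := mul_nonneg (hw j) (sq_nonneg (inner ℝ (ψ j) f))
  have h2 := mul_nonneg (hw j) (sq_nonneg (inner ℝ (ψ j) g))
  rw [htwo, htwo, ← ENNReal.ofReal_add (by positivity) (by positivity), inner_add_right]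
  apply ENNReal.ofReal_le_ofReal
  nlinarith [mul_nonneg (hw j) (sq_nonneg (inner ℝ (ψ j) f - inner ℝ (ψ j) g))]

theorem wNormSq_neg (w : ℕ → ℝ) (f : H) : wNormSq ψ w (-f) = wNormSq ψ w f := by
  simp [wNormSq]

theorem wNormSq_sub_le {w : ℕ → ℝ} (hw : ∀ j, 0 ≤ w j) (f g : H) :
    wNormSq ψ w (f - g) ≤ 2 * wNormSq ψ w f + 2 * wNormSq ψ w g := by
  rw [sub_eq_add_neg, ← wNormSq_neg ψ w g]
  exact wNormSq_add_le ψ hw f (-g)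

/-- The part of `f` in the closed span of the basis vectors with index at least `a`. -/
noncomputable def tailPart (a : ℕ) (f : H) : H :=
  f - ∑ j ∈ Finset.range a, inner ℝ (ψ j) f • ψ j

theorem inner_tailPart (a k : ℕ) (f : H) :
    inner ℝ (ψ k) (tailPart ψ a f) = if a ≤ k then inner ℝ (ψ k) f else 0 := by
  unfold tailPart
  have h1 : ∀ j, inner ℝ (ψ k) (ψ j) = if k = j then (1 : ℝ) else 0 :=
    fun j => orthonormal_iff_ite.1 ψ.orthonormal k j
  rw [inner_sub_right, inner_sum]
  simp_rw [real_inner_smul_right, h1, mul_ite, mul_one, mul_zero]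
  rw [Finset.sum_ite_eq]
  split_ifs with h2 h3 h3
  · have := Finset.mem_range.1 h2; omega
  · simp
  · simp
  · exact absurd (Finset.mem_range.2 (not_le.1 h3)) h2

theorem wNormSq_tailPart (w : ℕ → ℝ) (a : ℕ) (f : H) :
    wNormSq ψ w (tailPart ψ a f)
      = ∑' k, if a ≤ k then ENNReal.ofReal (w k * inner ℝ (ψ k) f ^ 2) else 0 := by
  unfold wNormSq
  refine tsum_congr fun k => ?_
  rw [inner_tailPart]
  split_ifs <;> simp

/-- Abel summation: `u k` is the sum of the increments `δ a` over `a ≤ k`, and interchanging the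
sums leaves tails in the norm with weights `v`. Negative values of `u` do no harm, since both sides
truncate at zero. -/
theorem wNormSq_mul_eq_tsum {v u : ℕ → ℝ} (hv : ∀ j, 0 ≤ v j) (hu : Monotone u) :
    ∃ δ : ℕ → ℝ≥0∞, ∀ f : H, wNormSq ψ (fun j => v j * u j) f
      = ∑' a, δ a * wNormSq ψ v (tailPart ψ a f) := by
  set U : ℕ → ℝ≥0∞ := fun k => ENNReal.ofReal (u k) with hU
  have hUm : Monotone U := fun a b h => ENNReal.ofReal_le_ofReal (hu h)
  set δ : ℕ → ℝ≥0∞ := fun a => if a = 0 then U 0 else U a - U (a - 1) with hδ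
  have hsum : ∀ k, ∑ a ∈ Finset.range (k + 1), δ a = U k := by
    intro k
    induction k with
    | zero => simp [hδ]
    | succ k ih =>
      rw [Finset.sum_range_succ, ih, hδ]
      simp only [Nat.succ_ne_zero, if_false, Nat.add_sub_cancel]
      exact add_tsub_cancel_of_le (hUm (Nat.le_succ k))
  refine ⟨δ, fun f => ?_⟩
  simp_rw [wNormSq_tailPart, ← ENNReal.tsum_mul_left]
  rw [ENNReal.tsum_comm]
  unfold wNormSq
  refine tsum_congr fun k => ?_
  have h1 : ∑' a, δ a * (if a ≤ k then ENNReal.ofReal (v k * inner ℝ (ψ k) f ^ 2) else 0)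
      = ∑ a ∈ Finset.range (k + 1), δ a * ENNReal.ofReal (v k * inner ℝ (ψ k) f ^ 2) := by
    rw [tsum_eq_sum (s := Finset.range (k + 1))]
    · refine Finset.sum_congr rfl fun a ha => ?_
      rw [if_pos (Nat.lt_succ_iff.1 (Finset.mem_range.1 ha))]
    · intro a ha
      rw [if_neg, mul_zero]
      intro h; exact ha (Finset.mem_range.2 (Nat.lt_succ_of_le h))
  rw [h1, ← Finset.sum_mul, hsum, hU]
  simp only
  rw [mul_comm (v k) (u k), mul_assoc, mul_comm (ENNReal.ofReal _)]
  by_cases huk : 0 ≤ u k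
  · rw [ENNReal.ofReal_mul huk, mul_comm]
  · rw [ENNReal.ofReal_of_nonpos (not_le.1 huk).le, mul_zero]
    exact ENNReal.ofReal_of_nonpos (mul_nonpos_of_nonpos_of_nonneg (not_le.1 huk).le
      (mul_nonneg (hv k) (sq_nonneg _)))

/-- A bound for a triangular map in a weighted norm persists when the weights are multiplied by a
nondecreasing sequence. -/
theorem wNormSq_le_of_triangular {I J : Type*} [Fintype I] [Fintype J] (T : (I → H) → J → H)
    (hT : ∀ (a : ℕ) (x : I → H) (j : J) (k : ℕ), a ≤ k →
      inner ℝ (ψ k) (T x j) = inner ℝ (ψ k) (T (fun i => tailPart ψ a (x i)) j))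
    {v u : ℕ → ℝ} (hv : ∀ j, 0 ≤ v j) (hu : Monotone u) (C : ℝ≥0∞)
    (hC : ∀ x : I → H, ∑ j, wNormSq ψ v (T x j) ≤ C * ∑ i, wNormSq ψ v (x i)) (x : I → H) :
    ∑ j, wNormSq ψ (fun k => v k * u k) (T x j)
      ≤ C * ∑ i, wNormSq ψ (fun k => v k * u k) (x i) := by
  -- The new norm is a positive mixture of `v`-norms of tails. The tail of the image from index `a`
  -- on depends only on the same tail of the argument, so the assumed bound applies tail by tail.
  obtain ⟨δ, hδ⟩ := wNormSq_mul_eq_tsum ψ hv hu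
  simp_rw [hδ]
  rw [← Summable.tsum_finsetSum (fun _ _ => ENNReal.summable),
    ← Summable.tsum_finsetSum (fun _ _ => ENNReal.summable), ← ENNReal.tsum_mul_left]
  refine ENNReal.tsum_le_tsum fun a => ?_
  rw [← Finset.mul_sum, ← Finset.mul_sum, mul_left_comm]
  refine mul_le_mul' le_rfl ?_
  refine le_trans (Finset.sum_le_sum fun j _ => ?_) (hC fun i => tailPart ψ a (x i))
  rw [wNormSq_tailPart]
  refine ENNReal.tsum_le_tsum fun k => ?_
  split_ifs with h
  · rw [hT a x j k h]
  · exact zero_le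

end WeightedNorms

/-! ### Orthogonality of disjoint Gram–Schmidt blocks -/

section GramParts

variable {H : Type*} [NormedAddCommGroup H] [InnerProductSpace ℝ H]
  {T : H →L[ℝ] H} (hsym : ∀ x y, inner ℝ (T x) y = inner ℝ x (T y))
  (hpos : ∀ x, x ≠ 0 → 0 < inner ℝ (T x) x) (f : ℕ → H)
include hsym

theorem inner_gramPart_comm (s : Finset ℕ) (x y : H) :
    inner ℝ (T (gramPart T f s x)) y = inner ℝ (T x) (gramPart T f s y) := by
  unfold gramPart
  rw [map_sum, sum_inner, inner_sum]
  refine Finset.sum_congr rfl fun j _ => ?_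
  rw [map_smul, real_inner_smul_left, real_inner_smul_right, hsym (gramVec T f j) y,
    real_inner_comm (T y)]
  ring

include hpos

theorem inner_gramPart_gramPart_of_disjoint {s t : Finset ℕ} (h : Disjoint s t) (x y : H) :
    inner ℝ (T (gramPart T f s x)) (gramPart T f t y) = 0 := by
  unfold gramPart
  rw [map_sum, sum_inner]
  refine Finset.sum_eq_zero fun i hi => ?_
  rw [inner_sum]
  refine Finset.sum_eq_zero fun j hj => ?_
  rw [map_smul, real_inner_smul_left, real_inner_smul_right,
    gramVec_orthogonal hsym hpos f (Finset.disjoint_iff_ne.1 h i hi j hj)]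
  simp

theorem gram_sum_gramPart_le {ι : Type*} [Fintype ι] {s : ι → Finset ℕ}
    (hs : Pairwise fun i j => Disjoint (s i) (s j)) (x : ι → H) :
    inner ℝ (T (∑ i, gramPart T f (s i) (x i))) (∑ i, gramPart T f (s i) (x i))
      ≤ ∑ i, inner ℝ (T (x i)) (x i) := by
  rw [map_sum, sum_inner]
  refine Finset.sum_le_sum fun i hi => ?_
  rw [inner_sum, Finset.sum_eq_single_of_mem i hi, gram_gramPart hsym hpos f]
  · exact gram_bessel hsym hpos f (s i) (x i)
  · intro j _ hj
    exact inner_gramPart_gramPart_of_disjoint hsym hpos f (hs hj.symm) _ _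

end GramParts

/-! ### Bias of the population projections -/

section Bias

variable {H : Type*} [NormedAddCommGroup H] [InnerProductSpace ℝ H] (ψ : HilbertBasis ℕ ℝ H)

theorem inner_basis_of_mem_span {a k : ℕ} (h : a ≤ k) {x : H}
    (hx : x ∈ Submodule.span ℝ (ψ '' Set.Iio a)) : inner ℝ (ψ k) x = 0 := by
  induction hx using Submodule.span_induction with
  | mem x hx =>
    obtain ⟨j, hj, rfl⟩ := hx
    rw [orthonormal_inner, if_neg]
    have : j < a := hj
    omega
  | zero => simp
  | add x y _ _ hx hy => rw [inner_add_right, hx, hy, add_zero]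
  | smul c x _ hx => rw [real_inner_smul_right, hx, mul_zero]

theorem sub_tailPart_mem_span (a : ℕ) (x : H) :
    x - tailPart ψ a x ∈ Submodule.span ℝ (ψ '' Set.Iio a) := by
  unfold tailPart
  rw [sub_sub_cancel]
  exact Submodule.sum_mem _ fun j hj => Submodule.smul_mem _ _
    (Submodule.subset_span ⟨j, Finset.mem_range.1 hj, rfl⟩)

theorem wNormSq_one (x : H) : wNormSq ψ (fun _ => 1) x = ENNReal.ofReal (‖x‖ ^ 2) := by
  rw [← real_inner_self_eq_norm_sq]
  exact (ofReal_inner_self_of_coords ψ (fun _ => zero_le_one) fun j => (one_mul _).symm).symm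

theorem wNormSq_tailPart_le {w b : ℕ → ℝ} (hw : ∀ j, 0 < w j) (hb : ∀ j, 0 < b j)
    (hwb : Antitone fun j => w j / b j) {m : ℕ} (hm : 1 ≤ m) (x : H) :
    wNormSq ψ w (tailPart ψ m x)
      ≤ ENNReal.ofReal (w (m - 1) / b (m - 1)) * wNormSq ψ b x := by
  rw [wNormSq_tailPart, wNormSq, ← ENNReal.tsum_mul_left]
  refine ENNReal.tsum_le_tsum fun k => ?_
  split_ifs with h
  · rw [← ENNReal.ofReal_mul (div_nonneg (hw _).le (hb _).le)]
    refine ENNReal.ofReal_le_ofReal ?_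
    rw [← mul_assoc]
    refine mul_le_mul_of_nonneg_right ?_ (sq_nonneg _)
    rw [← div_le_iff₀ (hb k)]
    exact hwb (by omega)
  · exact zero_le

section

variable {T : H →L[ℝ] H} (hsym : ∀ x y, inner ℝ (T x) y = inner ℝ x (T y))
  (hpos : ∀ x, x ≠ 0 → 0 < inner ℝ (T x) x)
include hsym hpos

/-- Triangularity: the `i`-th Gram vector lies in the span of the basis vectors with index at most
`i` and is orthogonal, for the form, to those with smaller index. The head of `x` below `a` thus
enters only through vectors with `i < a`, which have no coordinates from `a` on. -/
theorem inner_gramPart_tailPart (s : Finset ℕ) (a : ℕ) (x : H) {k : ℕ} (hk : a ≤ k) :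
    inner ℝ (ψ k) (gramPart T ψ s x) = inner ℝ (ψ k) (gramPart T ψ s (tailPart ψ a x)) := by
  rw [← sub_eq_zero, ← inner_sub_right, ← gramPart_sub]
  have hx := sub_tailPart_mem_span ψ a x
  unfold gramPart
  rw [inner_sum]
  refine Finset.sum_eq_zero fun i _ => ?_
  rw [real_inner_smul_right]
  rcases le_or_gt a i with hi | hi
  · rw [inner_gramVec_of_mem_span hsym hpos ψ hi hx, zero_mul]
  · rw [inner_basis_of_mem_span ψ (show i + 1 ≤ k by omega) (gramVec_mem_span ψ i), mul_zero]

end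

variable [CompleteSpace H] {l : ℕ → ℝ} {d : ℝ} {T : H →L[ℝ] H}

omit [CompleteSpace H] in
theorem opClass_symm (hT : T ∈ opClass ψ l d) (x y : H) :
    inner ℝ (T x) y = inner ℝ x (T y) := hT.1.isSymmetric x y

variable (hl : ∀ j, 0 < l j) (hs : Summable l) (hla : Antitone l) (hd : 1 ≤ d)
  (hT : T ∈ opClass ψ l d)
include hl hs hla hd hT

/-- In the energy norm the constant is `1` by orthogonality and Bessel; comparison with the weights
`l` costs `d` twice. Since `1 / l` is nondecreasing, triangularity carries the bound from the
weights `l` to the weights `1`. -/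
theorem norm_sq_sum_gramPart_le {ι : Type*} [Fintype ι] {s : ι → Finset ℕ}
    (hdis : Pairwise fun i j => Disjoint (s i) (s j)) (x : ι → H) :
    ‖∑ i, gramPart T ψ (s i) (x i)‖ ^ 2 ≤ d ^ 2 * ∑ i, ‖x i‖ ^ 2 := by
  have hsym := opClass_symm ψ hT
  have hpos := hT.2.1
  have hl0 : ∀ j, 0 ≤ l j := fun j => (hl j).le
  have key := wNormSq_le_of_triangular ψ (I := ι) (J := Unit)
    (fun x _ => ∑ i, gramPart T ψ (s i) (x i))
    (by
      intro a x _ k hk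
      rw [inner_sum, inner_sum]
      exact Finset.sum_congr rfl fun i _ => inner_gramPart_tailPart ψ hsym hpos _ _ _ hk)
    (v := l) (u := fun j => (l j)⁻¹) hl0
    (fun i j h => inv_anti₀ (hl j) (hla h)) (ENNReal.ofReal (d ^ 2))
    (by
      intro x
      simp_rw [← ofReal_inner_diagOp ψ hl0 hs]
      rw [Finset.univ_unique, Finset.sum_singleton,
        ← ENNReal.ofReal_sum_of_nonneg (fun i _ => diagOp_nonneg ψ hl0 hs _),
        ← ENNReal.ofReal_mul (by positivity)]
      refine ENNReal.ofReal_le_ofReal ?_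
      refine (opClass_inner_le ψ hl0 hs hd hT _).2.trans ?_
      rw [sq, mul_assoc]
      refine mul_le_mul_of_nonneg_left ?_ (by linarith)
      refine (gram_sum_gramPart_le hsym hpos ψ hdis x).trans ?_
      rw [Finset.mul_sum]
      exact Finset.sum_le_sum fun i _ => (opClass_inner_le ψ hl0 hs hd hT _).1) x
  have h1 : (fun j => l j * (l j)⁻¹) = fun _ => (1 : ℝ) := by
    ext j; exact mul_inv_cancel₀ (hl j).ne'
  simp_rw [h1, wNormSq_one] at key
  rw [Finset.univ_unique, Finset.sum_singleton,
    ← ENNReal.ofReal_sum_of_nonneg (fun i _ => by positivity),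
    ← ENNReal.ofReal_mul (by positivity), ENNReal.ofReal_le_ofReal_iff (by positivity)] at key
  exact key

/-- Dual to `norm_sq_sum_gramPart_le`: the block projections are self-adjoint for the form, so the
sum is `⟨T f, y⟩` with `y` a sum of blocks, and `‖y‖²` is at most `d²` times the sum itself. -/
theorem sum_norm_sq_apply_gramPart_le {ι : Type*} [Fintype ι] {s : ι → Finset ℕ}
    (hdis : Pairwise fun i j => Disjoint (s i) (s j)) (f : H) :
    ∑ i, ‖T (gramPart T ψ (s i) f)‖ ^ 2 ≤ d ^ 2 * ‖T f‖ ^ 2 := by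
  have hsym := opClass_symm ψ hT
  set S := ∑ i, ‖T (gramPart T ψ (s i) f)‖ ^ 2 with hS
  have hS0 : 0 ≤ S := by positivity
  set y := ∑ i, gramPart T ψ (s i) (T (gramPart T ψ (s i) f))
  have h1 : S = inner ℝ (T f) y := by
    rw [hS, inner_sum]
    refine Finset.sum_congr rfl fun i _ => ?_
    rw [← inner_gramPart_comm hsym, real_inner_self_eq_norm_sq]
  have h2 : ‖y‖ ^ 2 ≤ d ^ 2 * S := norm_sq_sum_gramPart_le ψ hl hs hla hd hT hdis _
  have h3 : S ≤ ‖T f‖ * ‖y‖ := h1 ▸ real_inner_le_norm _ _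
  have h4 : S ^ 2 ≤ ‖T f‖ ^ 2 * (d ^ 2 * S) := by
    calc S ^ 2 ≤ (‖T f‖ * ‖y‖) ^ 2 := by gcongr
      _ = ‖T f‖ ^ 2 * ‖y‖ ^ 2 := by ring
      _ ≤ _ := by gcongr
  rcases hS0.eq_or_lt with h | h
  · rw [← h]; positivity
  · have : S * S ≤ (d ^ 2 * ‖T f‖ ^ 2) * S := by nlinarith
    exact le_of_mul_le_mul_right this h

/-- The bound for `‖T ·‖²` is one for the weights `l²`, with `d²` lost in the duality and in each of
the two comparisons. As `w / l²` is nondecreasing, triangularity carries it to the weights `w`. -/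
theorem sum_wNormSq_gramPart_le {ι : Type*} [Fintype ι] {s : ι → Finset ℕ}
    (hdis : Pairwise fun i j => Disjoint (s i) (s j)) {w : ℕ → ℝ}
    (hlw : Antitone fun j => l j ^ 2 / w j) (hw : ∀ j, 0 < w j) (f : H) :
    ∑ i, wNormSq ψ w (gramPart T ψ (s i) f) ≤ ENNReal.ofReal (d ^ 6) * wNormSq ψ w f := by
  have hsym := opClass_symm ψ hT
  have hpos := hT.2.1
  have hl0 : ∀ j, 0 ≤ l j := fun j => (hl j).le
  have hd0 : 0 < d := by linarith
  have hb := hT.2.2.2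
  simp_rw [← ofReal_norm_sq_diagOp ψ hl0 hs] at hb
  have hlo : ∀ x, ‖diagOp ψ l x‖ ^ 2 ≤ d ^ 2 * ‖T x‖ ^ 2 := fun x => by
    have h := (hb x).1
    rwa [← ENNReal.ofReal_mul (by positivity), ENNReal.ofReal_le_ofReal_iff (by positivity),
      inv_mul_le_iff₀ (by positivity)] at h
  have hup : ∀ x, ‖T x‖ ^ 2 ≤ d ^ 2 * ‖diagOp ψ l x‖ ^ 2 := fun x => by
    have h := (hb x).2
    rwa [← ENNReal.ofReal_mul (by positivity), ENNReal.ofReal_le_ofReal_iff (by positivity)] at h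
  have key := wNormSq_le_of_triangular ψ (I := Unit) (J := ι)
    (fun x i => gramPart T ψ (s i) (x ()))
    (by
      intro a x i k hk
      exact inner_gramPart_tailPart ψ hsym hpos _ _ _ hk)
    (v := fun j => l j ^ 2) (u := fun j => (l j ^ 2 / w j)⁻¹) (fun j => sq_nonneg _)
    (fun i j h => inv_anti₀ (div_pos (pow_pos (hl j) 2) (hw j)) (hlw h)) (ENNReal.ofReal (d ^ 6))
    (by
      intro x
      simp_rw [← ofReal_norm_sq_diagOp ψ hl0 hs]
      rw [Finset.univ_unique (α := Unit), Finset.sum_singleton, PUnit.default_eq_unit,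
        ← ENNReal.ofReal_sum_of_nonneg (fun i _ => by positivity),
        ← ENNReal.ofReal_mul (by positivity)]
      refine ENNReal.ofReal_le_ofReal ?_
      calc ∑ i, ‖diagOp ψ l (gramPart T ψ (s i) (x ()))‖ ^ 2
          ≤ ∑ i, d ^ 2 * ‖T (gramPart T ψ (s i) (x ()))‖ ^ 2 :=
            Finset.sum_le_sum fun i _ => hlo _
        _ = d ^ 2 * ∑ i, ‖T (gramPart T ψ (s i) (x ()))‖ ^ 2 := by rw [Finset.mul_sum]
        _ ≤ d ^ 2 * (d ^ 2 * (d ^ 2 * ‖diagOp ψ l (x ())‖ ^ 2)) := by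
            gcongr
            exact (sum_norm_sq_apply_gramPart_le ψ hl hs hla hd hT hdis _).trans (by
              gcongr; exact hup _)
        _ = d ^ 6 * ‖diagOp ψ l (x ())‖ ^ 2 := by ring) (fun _ => f)
  have h1 : (fun j => l j ^ 2 * (l j ^ 2 / w j)⁻¹) = w := by
    ext j
    have := (hl j).ne'
    have := (hw j).ne'
    field_simp
  simp_rw [h1] at key
  simpa using key

variable {w b : ℕ → ℝ} (hwt : WeightAssumption w b l)
include hwt

omit hl hs hla in
/-- The total squared length of the increments of the population projections beyond dimension `m`
is controlled by the bias at `m`. -/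
theorem sum_wNormSq_gramPart_le_bias {ι : Type*} [Fintype ι] {s : ι → Finset ℕ}
    (hdis : Pairwise fun i j => Disjoint (s i) (s j)) {m : ℕ} (hm : 1 ≤ m)
    (hsm : ∀ i, ∀ j ∈ s i, m ≤ j) (x : H) :
    ∑ i, wNormSq ψ w (gramPart T ψ (s i) x)
      ≤ ENNReal.ofReal (d ^ 6 * (w (m - 1) / b (m - 1))) * wNormSq ψ b x := by
  have h1 : ∀ i, gramPart T ψ (s i) x = gramPart T ψ (s i) (tailPart ψ m x) := by
    intro i
    rw [← sub_eq_zero, ← gramPart_sub]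
    unfold gramPart
    refine Finset.sum_eq_zero fun j hj => ?_
    rw [inner_gramVec_of_mem_span (opClass_symm ψ hT) hT.2.1 ψ (hsm i j hj)
      (sub_tailPart_mem_span ψ m x), zero_smul]
  simp_rw [h1]
  refine (sum_wNormSq_gramPart_le ψ hwt.l_pos hwt.l_summable hwt.l_antitone hd hT hdis
    hwt.l_sq_div_w_antitone hwt.w_pos _).trans ?_
  rw [ENNReal.ofReal_mul (by positivity), mul_assoc]
  exact mul_le_mul' le_rfl (wNormSq_tailPart_le ψ hwt.w_pos hwt.b_pos hwt.w_div_b_antitone hm x)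

-- The projection fixes the head of `x`, so the bias is that of the tail, to which the block bound
-- applies with a single block.
omit hl hs hla in
theorem wNormSq_sub_gramProj_le_bias {m : ℕ} (hm : 1 ≤ m) (x : H) :
    wNormSq ψ w (x - gramProj T ψ m x)
      ≤ ENNReal.ofReal (4 * d ^ 6 * (w (m - 1) / b (m - 1))) * wNormSq ψ b x := by
  have hwb : 0 ≤ w (m - 1) / b (m - 1) := div_nonneg (hwt.w_pos _).le (hwt.b_pos _).le
  have h1 : x - gramProj T ψ m x
      = tailPart ψ m x - gramPart T ψ (Finset.range m) (tailPart ψ m x) := by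
    have h2 := gramProj_of_mem_span (opClass_symm ψ hT) hT.2.1 ψ (sub_tailPart_mem_span ψ m x)
    unfold gramProj at h2 ⊢
    rw [gramPart_sub] at h2
    linear_combination (norm := module) -h2
  rw [h1]
  refine (wNormSq_sub_le ψ (fun j => (hwt.w_pos j).le) _ _).trans ?_
  have h3 := sum_wNormSq_gramPart_le ψ hwt.l_pos hwt.l_summable hwt.l_antitone hd hT (ι := Unit)
    (s := fun _ => Finset.range m) (fun i j h => absurd (Subsingleton.elim i j) h)
    hwt.l_sq_div_w_antitone hwt.w_pos (tailPart ψ m x)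
  simp only [Finset.univ_unique, Finset.sum_const, Finset.card_singleton, one_smul] at h3
  have h4 := wNormSq_tailPart_le ψ hwt.w_pos hwt.b_pos hwt.w_div_b_antitone hm x
  have hd6 : (1 : ℝ≥0∞) ≤ ENNReal.ofReal (d ^ 6) := by
    rw [ENNReal.one_le_ofReal]; exact one_le_pow₀ hd
  calc 2 * wNormSq ψ w (tailPart ψ m x)
        + 2 * wNormSq ψ w (gramPart T ψ (Finset.range m) (tailPart ψ m x))
      ≤ 2 * (ENNReal.ofReal (d ^ 6) * wNormSq ψ w (tailPart ψ m x))
        + 2 * (ENNReal.ofReal (d ^ 6) * wNormSq ψ w (tailPart ψ m x)) := by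
        refine add_le_add (mul_le_mul' le_rfl ?_) (mul_le_mul' le_rfl h3)
        exact le_mul_of_one_le_left' hd6
    _ = 4 * (ENNReal.ofReal (d ^ 6) * wNormSq ψ w (tailPart ψ m x)) := by ring
    _ ≤ 4 * (ENNReal.ofReal (d ^ 6) * (ENNReal.ofReal (w (m - 1) / b (m - 1)) * wNormSq ψ b x)) :=
        mul_le_mul' le_rfl (mul_le_mul' le_rfl h4)
    _ = _ := by
        rw [ENNReal.ofReal_mul (by positivity), ENNReal.ofReal_mul (by positivity)]
        simp only [ENNReal.ofReal_ofNat]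
        ring

end Bias

/-! ### Second moments of the design -/

section Design

variable {H : Type*} [NormedAddCommGroup H] [InnerProductSpace ℝ H]

/-- The functional `(x, e) ↦ ⟨h, x⟩ + c e`. -/
noncomputable def designFun (h : H) (c : ℝ) : H × ℝ →L[ℝ] ℝ :=
  (innerSL ℝ h).comp (ContinuousLinearMap.fst ℝ H ℝ) + c • ContinuousLinearMap.snd ℝ H ℝ

@[simp] theorem designFun_apply (h : H) (c : ℝ) (z : H × ℝ) :
    designFun h c z = inner ℝ h z.1 + c * z.2 := rfl

variable [CompleteSpace H] [SecondCountableTopology H] [MeasurableSpace H] [BorelSpace H]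
  {ρ : Measure (H × ℝ)} {T : H →L[ℝ] H}

omit [CompleteSpace H] [SecondCountableTopology H] in
theorem IsGaussianDesign.memLp (hρ : IsGaussianDesign ρ T) (h : H) (c : ℝ) :
    MemLp (designFun h c) 2 ρ := by
  have := hρ.gaussian
  exact IsGaussian.memLp_dual ρ (designFun h c) 2 (by simp)

omit [CompleteSpace H] [SecondCountableTopology H] in
theorem IsGaussianDesign.integral_designFun (hρ : IsGaussianDesign ρ T) (h : H) (c : ℝ) :
    ∫ z, designFun h c z ∂ρ = 0 := by
  have := hρ.gaussian
  have h1 : Integrable (fun z : H × ℝ => inner ℝ h z.1) ρ := by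
    refine ((hρ.memLp h 0).integrable (by norm_num)).congr ?_
    filter_upwards with z
    simp
  have h2 : Integrable (fun z : H × ℝ => z.2) ρ := by
    refine ((hρ.memLp 0 1).integrable (by norm_num)).congr ?_
    filter_upwards with z
    simp
  have h3 : ∫ z : H × ℝ, z.2 ∂ρ = 0 := by
    have h4 : ∫ y, y ∂(ρ.map Prod.snd) = ∫ z : H × ℝ, z.2 ∂ρ :=
      integral_map measurable_snd.aemeasurable (by fun_prop)
    rw [← h4, hρ.error, integral_id_gaussianReal]
  simp only [designFun_apply]
  rw [integral_add h1 (h2.const_mul c), hρ.centred, integral_const_mul, h3]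
  simp

omit [CompleteSpace H] in
theorem IsGaussianDesign.integral_designFun_mul (hρ : IsGaussianDesign ρ T) (h h' : H)
    (c c' : ℝ) :
    ∫ z, designFun h c z * designFun h' c' z ∂ρ = inner ℝ (T h) h' + c * c' := by
  have := hρ.gaussian
  have hX : ∀ h : H, MemLp (fun z : H × ℝ => inner ℝ h z.1) 2 ρ := fun h => by
    have := hρ.memLp h 0
    refine (memLp_congr_ae ?_).1 this
    filter_upwards with z
    simp
  have hε : MemLp (fun z : H × ℝ => z.2) 2 ρ := by
    refine (memLp_congr_ae ?_).1 (hρ.memLp 0 1)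
    filter_upwards with z
    simp
  have h3 : ∫ z : H × ℝ, z.2 ∂ρ = 0 := by
    have := hρ.integral_designFun 0 1
    simpa using this
  have h4 : ∫ z : H × ℝ, z.2 * z.2 ∂ρ = 1 := by
    have h5 : ∫ y : ℝ, y ^ 2 ∂(ρ.map Prod.snd) = ∫ z : H × ℝ, z.2 ^ 2 ∂ρ :=
      integral_map measurable_snd.aemeasurable (by fun_prop)
    have h6 : ∫ y : ℝ, y ^ 2 ∂(gaussianReal 0 1) = 1 := by
      have h7 := variance_id_gaussianReal (μ := 0) (v := 1)
      rw [variance_of_integral_eq_zero aemeasurable_id (by simp)] at h7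
      simpa using h7
    simp_rw [← sq]
    rw [← h5, hρ.error, h6]
  have h8 : ∀ h : H, ∫ z : H × ℝ, inner ℝ h z.1 * z.2 ∂ρ = 0 := fun h => by
    have h9 := hρ.indep.integral_fun_comp_mul_comp (f := fun x => inner ℝ h x) (g := fun y => y)
      measurable_fst.aemeasurable measurable_snd.aemeasurable (by fun_prop) (by fun_prop)
    rw [h9, h3, mul_zero]
  have e : ∀ z : H × ℝ, designFun h c z * designFun h' c' z
      = inner ℝ h z.1 * inner ℝ h' z.1 + (c' * (inner ℝ h z.1 * z.2)
        + (c * (inner ℝ h' z.1 * z.2) + c * c' * (z.2 * z.2))) := fun z => by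
    simp only [designFun_apply]; ring
  simp_rw [e]
  have i1 : Integrable (fun z : H × ℝ => inner ℝ h z.1 * inner ℝ h' z.1) ρ :=
    (hX h).integrable_mul (hX h')
  have i2 : ∀ h : H, Integrable (fun z : H × ℝ => inner ℝ h z.1 * z.2) ρ := fun h =>
    (hX h).integrable_mul hε
  have i3 : Integrable (fun z : H × ℝ => z.2 * z.2) ρ := hε.integrable_mul hε
  have j1 : Integrable (fun z : H × ℝ => c * c' * (z.2 * z.2)) ρ := i3.const_mul _
  have j2 : Integrable (fun z : H × ℝ => c * (inner ℝ h' z.1 * z.2) + c * c' * (z.2 * z.2)) ρ :=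
    ((i2 h').const_mul c).add j1
  have j3 : Integrable (fun z : H × ℝ => c' * (inner ℝ h z.1 * z.2)
      + (c * (inner ℝ h' z.1 * z.2) + c * c' * (z.2 * z.2))) ρ := ((i2 h).const_mul c').add j2
  rw [integral_add i1 j3, integral_add ((i2 h).const_mul c') j2,
    integral_add ((i2 h').const_mul c) j1, hρ.cov]
  simp only [integral_const_mul, h8, h4]
  ring

end Design

/-! ### Whitened regressors and response -/

section Decomposition

variable {H : Type*} [NormedAddCommGroup H] [InnerProductSpace ℝ H] (ψ : HilbertBasis ℕ ℝ H)
  (T : H →L[ℝ] H)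

/-- The standard deviation of the residual of the response after projection of the slope `β` onto
the first `K` dimensions. -/
noncomputable def residSd (σ : ℝ) (β : H) (K : ℕ) : ℝ :=
  √(σ ^ 2 + inner ℝ (T (β - gramProj T ψ K β)) (β - gramProj T ψ K β))

/-- The decorrelated regressors of dimension `K`, followed by the normalized residual of the
response. -/
noncomputable def whitened (σ : ℝ) (β : H) (K : ℕ) (j : Fin (K + 1)) : H × ℝ →L[ℝ] ℝ :=
  if (j : ℕ) < K then designFun (gramVec T ψ j) 0
  else designFun ((residSd ψ T σ β K)⁻¹ • (β - gramProj T ψ K β)) ((residSd ψ T σ β K)⁻¹ * σ)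

/-- The coefficients of the response with respect to `whitened`. -/
noncomputable def respCoef (σ : ℝ) (β : H) (K : ℕ) (j : ℕ) : ℝ :=
  if j < K then inner ℝ (T β) (gramVec T ψ j) else residSd ψ T σ β K

variable {ψ T} (hsym : ∀ x y, inner ℝ (T x) y = inner ℝ x (T y))
  (hpos : ∀ x, x ≠ 0 → 0 < inner ℝ (T x) x) {σ : ℝ} (hσ : 0 < σ) (β : H) (K : ℕ)

theorem basis_notMem_span (j : ℕ) : ψ j ∉ Submodule.span ℝ (ψ '' Set.Iio j) := fun h => by
  have := inner_basis_of_mem_span ψ le_rfl h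
  rw [orthonormal_inner, if_pos rfl] at this
  exact one_ne_zero this

include hpos hσ in
theorem residSd_pos : 0 < residSd ψ T σ β K := by
  refine Real.sqrt_pos.2 ?_
  have := gram_nonneg hpos (β - gramProj T ψ K β)
  positivity

include hpos hσ in
theorem sq_residSd : residSd ψ T σ β K ^ 2
    = σ ^ 2 + inner ℝ (T (β - gramProj T ψ K β)) (β - gramProj T ψ K β) := by
  refine Real.sq_sqrt ?_
  have := gram_nonneg hpos (β - gramProj T ψ K β)
  positivity

include hsym hpos in
theorem inner_gramVec_sub_gramProj {j : ℕ} (hj : j < K) :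
    inner ℝ (T (gramVec T ψ j)) (β - gramProj T ψ K β) = 0 := by
  unfold gramProj
  rw [inner_sub_right, inner_gramVec_gramPart hsym hpos ψ (Finset.mem_range.2 hj), hsym,
    real_inner_comm, sub_self]

-- The part of `β` beyond dimension `K` is uncorrelated with the first `K` regressors, and is merged
-- with the error into one further standardized column. The response is then exactly a combination
-- of `K + 1` whitened variables, although `β` is infinite-dimensional.
include hpos hσ in
theorem sum_respCoef_whitened (z : H × ℝ) :
    ∑ j : Fin (K + 1), respCoef ψ T σ β K j * whitened ψ T σ β K j z
      = inner ℝ β z.1 + σ * z.2 := by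
  have h0 := (residSd_pos hpos hσ β K (ψ := ψ)).ne'
  rw [Fin.sum_univ_castSucc]
  have h1 : ∀ j : Fin K, respCoef ψ T σ β K (j.castSucc : Fin (K + 1))
        * whitened ψ T σ β K j.castSucc z
      = inner ℝ (inner ℝ (T β) (gramVec T ψ j) • gramVec T ψ j) z.1 := fun j => by
    simp [respCoef, whitened, real_inner_smul_left]
  simp_rw [h1]
  rw [← sum_inner]
  have h2 : ∑ j : Fin K, inner ℝ (T β) (gramVec T ψ j) • gramVec T ψ j = gramProj T ψ K β := by
    unfold gramProj gramPart
    rw [Finset.sum_range]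
  rw [h2]
  simp only [respCoef, whitened, Fin.val_last, lt_irrefl, if_false, designFun_apply,
    real_inner_smul_left, inner_sub_left]
  field_simp
  ring

-- The total does not depend on `K`, so one normalization of the noise level serves all dimensions.
include hsym hpos hσ in
theorem sum_sq_respCoef :
    ∑ j ∈ Finset.range (K + 1), respCoef ψ T σ β K j ^ 2 = σ ^ 2 + inner ℝ (T β) β := by
  rw [Finset.sum_range_succ]
  have h1 : ∑ j ∈ Finset.range K, respCoef ψ T σ β K j ^ 2
      = inner ℝ (T (gramProj T ψ K β)) (gramProj T ψ K β) := by
    unfold gramProj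
    rw [gram_gramPart hsym hpos]
    refine Finset.sum_congr rfl fun j hj => ?_
    rw [respCoef, if_pos (Finset.mem_range.1 hj)]
  have h2 : inner ℝ (T (gramProj T ψ K β)) (β - gramProj T ψ K β) = 0 := by
    set y := β - gramProj T ψ K β with hy
    rw [gramProj, gramPart, map_sum, sum_inner]
    refine Finset.sum_eq_zero fun j hj => ?_
    rw [map_smul, real_inner_smul_left, hy,
      inner_gramVec_sub_gramProj hsym hpos β K (Finset.mem_range.1 hj), mul_zero]
  have h3 : inner ℝ (T (β - gramProj T ψ K β)) (gramProj T ψ K β) = 0 := by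
    rw [hsym, real_inner_comm, h2]
  rw [h1, respCoef, if_neg (lt_irrefl K), sq_residSd hpos hσ]
  have h4 : inner ℝ (T β) β = inner ℝ (T (gramProj T ψ K β)) (gramProj T ψ K β)
      + inner ℝ (T (β - gramProj T ψ K β)) (β - gramProj T ψ K β) := by
    conv_lhs => rw [show β = gramProj T ψ K β + (β - gramProj T ψ K β) by abel]
    rw [map_add, inner_add_left, inner_add_right, inner_add_right, h2, h3]
    ring
  rw [h4]; ring

variable [CompleteSpace H] [SecondCountableTopology H] [MeasurableSpace H] [BorelSpace H]
  {ρ : Measure (H × ℝ)} (hρ : IsGaussianDesign ρ T)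
include hρ

omit [CompleteSpace H] [SecondCountableTopology H] in
theorem integral_whitened (j : Fin (K + 1)) : ∫ z, whitened ψ T σ β K j z ∂ρ = 0 := by
  unfold whitened
  split_ifs <;> exact hρ.integral_designFun _ _

include hsym hpos hσ in
omit [CompleteSpace H] in
theorem integral_whitened_mul (i j : Fin (K + 1)) :
    ∫ z, whitened ψ T σ β K i z * whitened ψ T σ β K j z ∂ρ = if i = j then 1 else 0 := by
  have h0 := (residSd_pos hpos hσ β K (ψ := ψ)).ne'
  unfold whitened
  by_cases hi : (i : ℕ) < K <;> by_cases hj : (j : ℕ) < K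
  all_goals simp only [hi, hj, if_true, if_false]
  all_goals rw [hρ.integral_designFun_mul]
  · by_cases h : i = j
    · subst h
      rw [gramVec_self_of_ne hsym hpos ψ (basis_notMem_span _), if_pos rfl]; ring
    · rw [gramVec_orthogonal hsym hpos ψ (fun h' => h (Fin.ext h')), if_neg h]; ring
  · rw [real_inner_smul_right, inner_gramVec_sub_gramProj hsym hpos β K hi, if_neg]
    · ring
    · rintro rfl; exact hj hi
  · rw [map_smul, real_inner_smul_left, hsym, real_inner_comm,
      inner_gramVec_sub_gramProj hsym hpos β K hj, if_neg]
    · ring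
    · rintro rfl; exact hi hj
  · rw [map_smul, real_inner_smul_left, real_inner_smul_right, if_pos (Fin.ext (by omega))]
    have := sq_residSd hpos hσ β K (ψ := ψ)
    field_simp
    linarith

end Decomposition

/-! ### Fluctuation increments along a chain of dimensions -/

section Increments

theorem sum_range_sum_Ico {M : Type*} [AddCommMonoid M] {κ : ℕ → ℕ} (hκ : Monotone κ) (g : ℕ → M)
    (t : ℕ) : ∑ i ∈ Finset.range t, ∑ j ∈ Finset.Ico (κ i) (κ (i + 1)), g j
      = ∑ j ∈ Finset.Ico (κ 0) (κ t), g j := by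
  induction t with
  | zero => simp
  | succ t ih =>
    rw [Finset.sum_range_succ, ih, Finset.sum_Ico_consecutive _ (hκ (Nat.zero_le t))
      (hκ (Nat.le_succ t))]

variable {E : Type*} [NormedAddCommGroup E] [InnerProductSpace ℝ E]

/-- The error in the span of the first `k` columns, for responses `∑ j < p, τ j • ξ j`. -/
noncomputable def colError (ξ : ℕ → E) (p : ℕ) (τ : ℕ → ℝ) (k : ℕ) : E :=
  gramProj (ContinuousLinearMap.id ℝ E) ξ k (∑ j ∈ Finset.range p, τ j • ξ j)
    - ∑ j ∈ Finset.range k, τ j • ξ j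

/-- The projection `P_k` fixes `ξ j` and `P_j ξ j` for `j < k`, and `P_k P_j = P_k` for `j ≥ k`. The
errors of all dimensions are thus read off one vector, `projSum ξ p τ`, and the partial sums that
form it. -/
theorem colError_eq (ξ : ℕ → E) {p k : ℕ} (hk : k ≤ p) (τ : ℕ → ℝ) :
    colError ξ p τ k = gramProj (ContinuousLinearMap.id ℝ E) ξ k (projSum ξ p τ)
      - projSum ξ k τ := by
  set I := ContinuousLinearMap.id ℝ E
  have h1 : ∀ y : ℕ → E, gramProj I ξ k (∑ j ∈ Finset.range p, τ j • y j)
      = ∑ j ∈ Finset.range k, τ j • gramProj I ξ k (y j)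
        + ∑ j ∈ Finset.Ico k p, τ j • gramProj I ξ k (y j) := fun y => by
    unfold gramProj
    rw [gramPart_sum, Finset.sum_range_add_sum_Ico _ hk]
    simp_rw [gramPart_smul]
  have h2 : ∑ j ∈ Finset.range k, τ j • gramProj I ξ k (ξ j)
      = ∑ j ∈ Finset.range k, τ j • ξ j := Finset.sum_congr rfl fun j hj => by
    rw [gramProj_apply_of_lt id_symm id_posDef ξ (Finset.mem_range.1 hj)]
  have h3 : ∑ j ∈ Finset.range k, τ j • gramProj I ξ k (gramProj I ξ j (ξ j))
      = projSum ξ k τ := Finset.sum_congr rfl fun j hj => by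
    rw [gramProj_gramProj_of_le id_symm id_posDef ξ (Finset.mem_range.1 hj).le]
  have h4 : ∑ j ∈ Finset.Ico k p, τ j • gramProj I ξ k (gramProj I ξ j (ξ j))
      = ∑ j ∈ Finset.Ico k p, τ j • gramProj I ξ k (ξ j) := Finset.sum_congr rfl fun j hj => by
    congr 1
    exact gramPart_gramProj id_symm id_posDef ξ
      (fun i hi => (Finset.mem_range.1 hi).trans_le (Finset.mem_Ico.1 hj).1) _
  unfold colError
  rw [h1, h2]
  conv_rhs => rw [projSum, h1, h3, h4]
  abel

theorem norm_sq_gramPart_id (ξ : ℕ → E) (s : Finset ℕ) (x : E) :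
    ‖gramPart (ContinuousLinearMap.id ℝ E) ξ s x‖ ^ 2
      = ∑ i ∈ s, inner ℝ x (gramVec (ContinuousLinearMap.id ℝ E) ξ i) ^ 2 := by
  rw [← real_inner_self_eq_norm_sq]
  exact gram_gramPart id_symm id_posDef ξ s x

theorem projSum_sub_projSum (ξ : ℕ → E) {p m k : ℕ} (hm : m ≤ k) (hk : k ≤ p) (τ : ℕ → ℝ) :
    projSum ξ k τ - projSum ξ m τ
      = projSum ξ p (fun j => if j ∈ Finset.Ico m k then τ j else 0) := by
  unfold projSum
  rw [← Finset.sum_Ico_eq_sub _ hm]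
  simp_rw [ite_smul, zero_smul]
  rw [← Finset.sum_filter]
  refine Finset.sum_congr ?_ fun _ _ => rfl
  ext j
  simp only [Finset.mem_Ico, Finset.mem_filter, Finset.mem_range]
  omega

/-- An increment is a block of Gram coordinates of `D` minus the projected sum with `τ` restricted
to the block. The blocks are disjoint: the first terms add up to at most `‖D‖²` by Bessel, the
second are bounded by the squared coefficients in their blocks. Both totals are at most `16 Λ N`,
whence `64 = 2 · 16 + 2 · 16`. The chain is arbitrary and may depend on the sample. -/
theorem sum_norm_sq_colError_sub_le [SecondCountableTopology E] (ξ : ℕ → E) {p : ℕ}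
    (hfin : smoothMax ξ p ≠ ⊤) (τ : ℕ → ℝ) {κ : ℕ → ℕ} (hκ : Monotone κ) (hp : ∀ i, κ i ≤ p)
    (t : ℕ) :
    ∑ i ∈ Finset.range t, ‖colError ξ p τ (κ (i + 1)) - colError ξ p τ (κ i)‖ ^ 2
      ≤ 64 * Real.log (smoothMax ξ p).toReal * ∑ j ∈ Finset.range p, τ j ^ 2 := by
  set I := ContinuousLinearMap.id ℝ E
  set N := ∑ j ∈ Finset.range p, τ j ^ 2
  set Λ := Real.log (smoothMax ξ p).toReal
  have hΛ : 0 ≤ Λ := by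
    refine Real.log_nonneg ?_
    rw [← ENNReal.toReal_one]
    exact ENNReal.toReal_mono hfin (one_le_smoothMax ξ p)
  set D := projSum ξ p τ
  have h1 : ∀ i, ‖colError ξ p τ (κ (i + 1)) - colError ξ p τ (κ i)‖ ^ 2
      ≤ 2 * (∑ j ∈ Finset.Ico (κ i) (κ (i + 1)), inner ℝ D (gramVec I ξ j) ^ 2)
        + 2 * (16 * Λ * ∑ j ∈ Finset.Ico (κ i) (κ (i + 1)), τ j ^ 2) := by
    intro i
    have hi := hκ (Nat.le_succ i)
    rw [colError_eq ξ (hp _), colError_eq ξ (hp i), sub_sub_sub_comm,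
      gramProj_sub_gramProj I ξ hi, projSum_sub_projSum ξ hi (hp _)]
    have h2 := norm_projSum_sq_le ξ p hfin
      (fun j => if j ∈ Finset.Ico (κ i) (κ (i + 1)) then τ j else 0)
    have h3 : ∑ j ∈ Finset.range p, (if j ∈ Finset.Ico (κ i) (κ (i + 1)) then τ j else 0) ^ 2
        = ∑ j ∈ Finset.Ico (κ i) (κ (i + 1)), τ j ^ 2 := by
      simp_rw [ite_pow, zero_pow two_ne_zero]
      rw [← Finset.sum_filter]
      refine Finset.sum_congr ?_ fun _ _ => rfl
      ext j
      have := hp (i + 1)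
      simp only [Finset.mem_Ico, Finset.mem_filter, Finset.mem_range]
      omega
    rw [h3] at h2
    rw [← norm_sq_gramPart_id]
    set a := gramPart I ξ (Finset.Ico (κ i) (κ (i + 1))) D
    set c := projSum ξ p fun j => if j ∈ Finset.Ico (κ i) (κ (i + 1)) then τ j else 0
    have h4 := parallelogram_law_with_norm ℝ a c
    have : ‖a - c‖ ^ 2 ≤ 2 * ‖a‖ ^ 2 + 2 * ‖c‖ ^ 2 := by nlinarith [norm_nonneg (a + c)]
    linarith
  refine (Finset.sum_le_sum fun i _ => h1 i).trans ?_
  rw [Finset.sum_add_distrib, ← Finset.mul_sum, ← Finset.mul_sum, ← Finset.mul_sum,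
    sum_range_sum_Ico hκ, sum_range_sum_Ico hκ]
  have h5 : ∑ j ∈ Finset.Ico (κ 0) (κ t), inner ℝ D (gramVec I ξ j) ^ 2 ≤ ‖D‖ ^ 2 := by
    rw [← real_inner_self_eq_norm_sq]
    exact gram_bessel id_symm id_posDef ξ _ D
  have h6 : ∑ j ∈ Finset.Ico (κ 0) (κ t), τ j ^ 2 ≤ N := by
    refine Finset.sum_le_sum_of_subset_of_nonneg (fun j hj => ?_) fun _ _ _ => sq_nonneg _
    have := hp t
    have := (Finset.mem_Ico.1 hj).2
    exact Finset.mem_range.2 (by omega)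
  have h7 := norm_projSum_sq_le ξ p hfin τ
  have h8 : 16 * Λ * ∑ j ∈ Finset.Ico (κ 0) (κ t), τ j ^ 2 ≤ 16 * Λ * N := by gcongr
  have h9 : ‖D‖ ^ 2 ≤ 16 * Λ * N := h7
  linarith

theorem norm_sq_colError_le [SecondCountableTopology E] (ξ : ℕ → E) {p : ℕ}
    (hfin : smoothMax ξ p ≠ ⊤) (τ : ℕ → ℝ) {k : ℕ} (hk : k ≤ p) :
    ‖colError ξ p τ k‖ ^ 2
      ≤ 64 * Real.log (smoothMax ξ p).toReal * ∑ j ∈ Finset.range p, τ j ^ 2 := by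
  -- A chain with one step, from dimension `0`, where the error vanishes, to `k`.
  have h := sum_norm_sq_colError_sub_le ξ hfin τ (κ := fun i => if i = 0 then 0 else k)
    (by
      intro a c hac
      simp only
      split_ifs <;> omega)
    (by intro i; split_ifs <;> omega) 1
  have h0 : colError ξ p τ 0 = 0 := by simp [colError, gramProj, gramPart]
  simpa [h0] using h

end Increments

/-! ### Estimators as projections in the sample space -/

section Sample

variable {H : Type*} [NormedAddCommGroup H] [InnerProductSpace ℝ H] (ψ : HilbertBasis ℕ ℝ H)
  {n : ℕ}

/-- The map `h ↦ (⟨h, x i⟩)_i` into the sample space. -/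
noncomputable def sampleMap (x : Fin n → H) : H →ₗ[ℝ] EuclideanSpace ℝ (Fin n) where
  toFun h := WithLp.toLp 2 fun i => inner ℝ h (x i)
  map_add' h h' := by ext i; simp [inner_add_left]
  map_smul' c h := by ext i; simp [real_inner_smul_left]

@[simp] theorem sampleMap_apply (x : Fin n → H) (h : H) (i : Fin n) :
    sampleMap x h i = inner ℝ h (x i) := rfl

theorem inner_ofCoords {m : ℕ} (u : Fin m → ℝ) (h : H) :
    inner ℝ (ofCoords ψ u) h = dotProduct u (coords ψ m h) := by
  simp [ofCoords, sum_inner, real_inner_smul_left, dotProduct, coords]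

theorem ofCoords_mem_span {m : ℕ} (u : Fin m → ℝ) :
    ofCoords ψ u ∈ Submodule.span ℝ (ψ '' Set.Iio m) :=
  Submodule.sum_mem _ fun j _ => Submodule.smul_mem _ _ (Submodule.subset_span ⟨j, j.2, rfl⟩)

theorem coords_ofCoords {m : ℕ} (u : Fin m → ℝ) : coords ψ m (ofCoords ψ u) = u := by
  ext k
  rw [coords, real_inner_comm, inner_ofCoords, dotProduct]
  have : ∀ j : Fin m, coords ψ m (ψ k) j = if j = k then 1 else 0 := fun j => by
    rw [coords, orthonormal_inner]; simp [Fin.ext_iff]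
  simp [this]

theorem ofCoords_coords {m : ℕ} {h : H} (hh : h ∈ Submodule.span ℝ (ψ '' Set.Iio m)) :
    ofCoords ψ (coords ψ m h) = h := by
  induction hh using Submodule.span_induction with
  | mem x hx =>
    obtain ⟨j, hj, rfl⟩ := hx
    unfold ofCoords coords
    simp_rw [orthonormal_inner, ite_smul, one_smul, zero_smul]
    rw [Finset.sum_eq_single_of_mem (⟨j, hj⟩ : Fin m) (Finset.mem_univ _)]
    · simp
    · intro i _ hi
      rw [if_neg]
      intro h
      exact hi (Fin.ext h)
  | zero => simp [ofCoords, coords]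
  | add x y _ _ hx hy =>
    conv_rhs => rw [← hx, ← hy]
    simp [ofCoords, coords, inner_add_right, add_smul, Finset.sum_add_distrib]
  | smul c x _ hx =>
    conv_rhs => rw [← hx]
    simp [ofCoords, coords, real_inner_smul_right, mul_smul, Finset.smul_sum]

theorem dotProduct_covHat_mulVec (x : Fin n → H) {m : ℕ} (u c : Fin m → ℝ) :
    dotProduct u ((covHat ψ x m).mulVec c)
      = (n : ℝ)⁻¹ * inner ℝ (sampleMap x (ofCoords ψ u)) (sampleMap x (ofCoords ψ c)) := by
  unfold covHat
  rw [Matrix.smul_mulVec, dotProduct_smul, Matrix.sum_mulVec, dotProduct_sum, smul_eq_mul,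
    PiLp.inner_apply]
  congr 1
  refine Finset.sum_congr rfl fun i _ => ?_
  rw [Matrix.vecMulVec_mulVec, dotProduct_smul]
  simp [inner_ofCoords, dotProduct_comm, mul_comm]

theorem dotProduct_gHat (x : Fin n → H) (y : Fin n → ℝ) {m : ℕ} (u : Fin m → ℝ) :
    dotProduct u (gHat ψ x y m)
      = (n : ℝ)⁻¹ * inner ℝ (sampleMap x (ofCoords ψ u)) (WithLp.toLp 2 y) := by
  unfold gHat
  rw [dotProduct_smul, dotProduct_sum, smul_eq_mul, PiLp.inner_apply]
  congr 1
  refine Finset.sum_congr rfl fun i _ => ?_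
  rw [dotProduct_smul]
  simp [inner_ofCoords]

theorem isUnit_det_of_invNorm_le {m : ℕ} {A : Matrix (Fin m) (Fin m) ℝ} {c : ℝ≥0∞} (hc : c ≠ ⊤)
    (h : invNorm A ≤ c) : IsUnit A.det := by
  by_contra hA
  rw [invNorm, if_neg hA, top_le_iff] at h
  exact hc h

theorem betaHat_mem_span (x : Fin n → H) (y : Fin n → ℝ) (m : ℕ) :
    betaHat ψ x y m ∈ Submodule.span ℝ (ψ '' Set.Iio m) := by
  unfold betaHat
  split_ifs
  · exact ofCoords_mem_span ψ _
  · exact Submodule.zero_mem _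

/-- The normal equations. -/
theorem inner_sampleMap_sub_betaHat (x : Fin n → H) (y : Fin n → ℝ) (m : ℕ)
    (hm : invNorm (covHat ψ x m) ≤ n) {h : H} (hh : h ∈ Submodule.span ℝ (ψ '' Set.Iio m)) :
    inner ℝ (sampleMap x h) (WithLp.toLp 2 y - sampleMap x (betaHat ψ x y m)) = 0 := by
  rcases Nat.eq_zero_or_pos n with rfl | hn
  · simp [PiLp.inner_apply]
  have hn' : (n : ℝ)⁻¹ ≠ 0 := by positivity
  have hu := isUnit_det_of_invNorm_le (ENNReal.natCast_ne_top n) hm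
  rw [← ofCoords_coords ψ hh]
  unfold betaHat
  rw [if_pos hm, inner_sub_right, ← mul_right_inj' hn', mul_sub, mul_zero, ← dotProduct_gHat,
    ← dotProduct_covHat_mulVec, Matrix.mulVec_mulVec, Matrix.mul_nonsing_inv _ hu,
    Matrix.one_mulVec, sub_self]

theorem norm_sampleMap_betaHat_le (x : Fin n → H) (y : Fin n → ℝ) (m : ℕ) :
    ‖sampleMap x (betaHat ψ x y m)‖ ≤ ‖(WithLp.toLp 2 y : EuclideanSpace ℝ (Fin n))‖ := by
  by_cases hm : invNorm (covHat ψ x m) ≤ n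
  · have h := inner_sampleMap_sub_betaHat ψ x y m hm (betaHat_mem_span ψ x y m)
    rw [inner_sub_right, real_inner_self_eq_norm_sq] at h
    have h2 := real_inner_le_norm (sampleMap x (betaHat ψ x y m))
      (WithLp.toLp 2 y : EuclideanSpace ℝ (Fin n))
    by_contra h3
    nlinarith [norm_nonneg (WithLp.toLp 2 y : EuclideanSpace ℝ (Fin n))]
  · rw [betaHat, if_neg hm]
    simp

variable {T : H →L[ℝ] H} (hsym : ∀ x y, inner ℝ (T x) y = inner ℝ x (T y))
  (hpos : ∀ x, x ≠ 0 → 0 < inner ℝ (T x) x)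
include hsym hpos

theorem sampleMap_of_mem_span (x : Fin n → H) {K k : ℕ} (hk : k ≤ K)
    {ξ : ℕ → EuclideanSpace ℝ (Fin n)}
    (hξ : ∀ j < K, ξ j = sampleMap x (gramVec T ψ j)) {h : H}
    (hh : h ∈ Submodule.span ℝ (ψ '' Set.Iio k)) :
    sampleMap x h = ∑ j ∈ Finset.range k, inner ℝ (T h) (gramVec T ψ j) • ξ j := by
  conv_lhs => rw [← gramProj_of_mem_span hsym hpos ψ hh, gramProj, gramPart, map_sum]
  refine Finset.sum_congr rfl fun j hj => ?_
  rw [map_smul, hξ j ((Finset.mem_range.1 hj).trans_le hk)]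

/-- By the normal equations the fitted values are the orthogonal projection of the responses. The
whitened directions span the same spaces as the basis vectors, so the projection may be taken in the
independent columns `ξ`. -/
theorem sampleMap_betaHat (x : Fin n → H) (y : Fin n → ℝ) {K k : ℕ} (hk : k ≤ K)
    {ξ : ℕ → EuclideanSpace ℝ (Fin n)}
    (hξ : ∀ j < K, ξ j = sampleMap x (gramVec T ψ j)) (hm : invNorm (covHat ψ x k) ≤ n) :
    sampleMap x (betaHat ψ x y k)
      = gramProj (ContinuousLinearMap.id ℝ _) ξ k (WithLp.toLp 2 y) := by
  set I := ContinuousLinearMap.id ℝ (EuclideanSpace ℝ (Fin n))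
  have h1 : gramProj I ξ k (sampleMap x (betaHat ψ x y k)) = sampleMap x (betaHat ψ x y k) := by
    refine gramProj_of_mem_span id_symm id_posDef ξ ?_
    rw [sampleMap_of_mem_span ψ hsym hpos x hk hξ (betaHat_mem_span ψ x y k)]
    exact Submodule.sum_mem _ fun j hj => Submodule.smul_mem _ _
      (Submodule.subset_span ⟨j, Finset.mem_range.1 hj, rfl⟩)
  have h2 : gramProj I ξ k (WithLp.toLp 2 y - sampleMap x (betaHat ψ x y k)) = 0 := by
    unfold gramProj gramPart
    refine Finset.sum_eq_zero fun j hj => ?_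
    have hj' := Finset.mem_range.1 hj
    have h3 : ∀ u ∈ Submodule.span ℝ (ξ '' Set.Iio k),
        inner ℝ u (WithLp.toLp 2 y - sampleMap x (betaHat ψ x y k)) = 0 := by
      intro u hu
      induction hu using Submodule.span_induction with
      | mem u hu =>
        obtain ⟨i, hi, rfl⟩ := hu
        rw [hξ i (hi.trans_le hk)]
        exact inner_sampleMap_sub_betaHat ψ x y k hm
          (Submodule.span_mono (Set.image_mono (Set.Iio_subset_Iio (Nat.succ_le_of_lt hi)))
            (gramVec_mem_span ψ i))
      | zero => simp
      | add a c _ _ ha hc => rw [inner_add_left, ha, hc, add_zero]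
      | smul a u _ hu => rw [real_inner_smul_left, hu, mul_zero]
    have h4 := h3 _ (Submodule.span_mono (Set.image_mono (Set.Iio_subset_Iio
      (Nat.succ_le_of_lt hj'))) (gramVec_mem_span (T := I) ξ j))
    rw [real_inner_comm] at h4
    rw [show inner ℝ (I (WithLp.toLp 2 y - sampleMap x (betaHat ψ x y k))) (gramVec I ξ j)
      = inner ℝ (WithLp.toLp 2 y - sampleMap x (betaHat ψ x y k)) (gramVec I ξ j) from rfl, h4,
      zero_smul]
  unfold gramProj at h1 h2 ⊢
  rw [gramPart_sub, h1, sub_eq_zero] at h2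
  exact h2.symm

theorem sampleMap_betaHat_sub (x : Fin n → H) (y : Fin n → ℝ) {p k : ℕ} {K : ℕ} (hk : k ≤ K)
    {ξ : ℕ → EuclideanSpace ℝ (Fin n)}
    (hξ : ∀ j < K, ξ j = sampleMap x (gramVec T ψ j)) (hm : invNorm (covHat ψ x k) ≤ n)
    {τ : ℕ → ℝ} (hy : WithLp.toLp 2 y = ∑ j ∈ Finset.range p, τ j • ξ j) (β : H)
    (hτ : ∀ j < K, τ j = inner ℝ (T β) (gramVec T ψ j)) :
    sampleMap x (betaHat ψ x y k - gramProj T ψ k β) = colError ξ p τ k := by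
  rw [map_sub, sampleMap_betaHat ψ hsym hpos x y hk hξ hm,
    sampleMap_of_mem_span ψ hsym hpos x hk hξ (gramProj_mem_span ψ k β), colError, hy]
  congr 1
  refine Finset.sum_congr rfl fun j hj => ?_
  unfold gramProj
  rw [inner_gramPart_gramVec hsym hpos ψ hj, hτ j ((Finset.mem_range.1 hj).trans_le hk)]

end Sample

/-! ### Spectral norms and sandwiched matrices -/

section SpectralNorm

variable {m : ℕ}

theorem specNorm_nonneg (B : Matrix (Fin m) (Fin m) ℝ) : 0 ≤ specNorm B := norm_nonneg _

theorem norm_toLp_sq (y : Fin m → ℝ) :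
    ‖(WithLp.toLp 2 y : EuclideanSpace ℝ (Fin m))‖ ^ 2 = dotProduct y y := by
  rw [EuclideanSpace.real_norm_sq_eq]
  simp [dotProduct, sq]

theorem dotProduct_mulVec_le (B : Matrix (Fin m) (Fin m) ℝ) (y : Fin m → ℝ) :
    dotProduct y (B.mulVec y) ≤ specNorm B * dotProduct y y := by
  have h := Matrix.inner_toEuclideanCLM B (WithLp.toLp 2 y) (WithLp.toLp 2 y)
  have h2 := real_inner_le_norm (WithLp.toLp 2 y : EuclideanSpace ℝ (Fin m))
    (Matrix.toEuclideanCLM (n := Fin m) (𝕜 := ℝ) B (WithLp.toLp 2 y))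
  have h3 := (Matrix.toEuclideanCLM (n := Fin m) (𝕜 := ℝ) B).le_opNorm (WithLp.toLp 2 y)
  rw [← norm_toLp_sq, specNorm]
  rw [h] at h2
  refine h2.trans ?_
  nlinarith [norm_nonneg (WithLp.toLp 2 y : EuclideanSpace ℝ (Fin m))]

theorem specNorm_le {B : Matrix (Fin m) (Fin m) ℝ} {C : ℝ} (hC : 0 ≤ C)
    (h : ∀ y, dotProduct (B.mulVec y) (B.mulVec y) ≤ C * dotProduct (B.mulVec y) y) :
    specNorm B ≤ C := by
  refine ContinuousLinearMap.opNorm_le_bound _ hC fun y => ?_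
  have h1 := h y.ofLp
  have h2 : ‖Matrix.toEuclideanCLM (n := Fin m) (𝕜 := ℝ) B y‖ ^ 2
      = dotProduct (B.mulVec y.ofLp) (B.mulVec y.ofLp) := by
    rw [← norm_toLp_sq]; rfl
  have h3 := real_inner_le_norm (Matrix.toEuclideanCLM (n := Fin m) (𝕜 := ℝ) B y) y
  rw [real_inner_comm, Matrix.inner_toEuclideanCLM, dotProduct_comm] at h3
  rw [← h2] at h1
  by_contra hlt
  push Not at hlt
  have h4 := (mul_le_mul_of_nonneg_left h3 hC)
  have hy : 0 < ‖Matrix.toEuclideanCLM (n := Fin m) (𝕜 := ℝ) B y‖ := by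
    refine lt_of_le_of_lt ?_ hlt
    positivity
  nlinarith

theorem diagMat_mulVec (w : ℕ → ℝ) (y : Fin m → ℝ) :
    (diagMat w m).mulVec y = fun j : Fin m => w j * y j := by
  ext j
  simp [diagMat, Matrix.mulVec_diagonal]

/-- Cauchy–Schwarz for the form of `A` between `c` and `u = A⁻¹ D² c`, where `D = diagMat s m`. -/
theorem sum_scaled_sq_le_specNorm {A : Matrix (Fin m) (Fin m) ℝ}
    (hsym : ∀ u v, dotProduct u (A.mulVec v) = dotProduct v (A.mulVec u))
    (h0 : ∀ u, 0 ≤ dotProduct u (A.mulVec u)) (hu : IsUnit A.det) (s : ℕ → ℝ) (c : Fin m → ℝ) :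
    ∑ j : Fin m, (s j * c j) ^ 2
      ≤ specNorm (diagMat s m * A⁻¹ * diagMat s m) * dotProduct c (A.mulVec c) := by
  set y := (diagMat s m).mulVec c with hy
  set u := A⁻¹.mulVec ((diagMat s m).mulVec y) with hudef
  set B := diagMat s m * A⁻¹ * diagMat s m with hB
  have hyy : ∑ j : Fin m, (s j * c j) ^ 2 = dotProduct y y := by
    rw [hy, diagMat_mulVec]
    exact Finset.sum_congr rfl fun j _ => by ring
  have hAu : A.mulVec u = (diagMat s m).mulVec y := by
    rw [hudef, Matrix.mulVec_mulVec, Matrix.mul_nonsing_inv _ hu, Matrix.one_mulVec]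
  have hmove : ∀ a b : Fin m → ℝ, dotProduct a ((diagMat s m).mulVec b)
      = dotProduct ((diagMat s m).mulVec a) b := fun a b => by
    rw [diagMat_mulVec, diagMat_mulVec]
    exact Finset.sum_congr rfl fun j _ => by ring
  have h1 : dotProduct c (A.mulVec u) = dotProduct y y := by rw [hAu, hmove]
  have h2 : dotProduct u (A.mulVec u) = dotProduct y (B.mulVec y) := by
    rw [hAu, hmove, dotProduct_comm, hudef, hB]
    simp [Matrix.mulVec_mulVec, Matrix.mul_assoc]
  have h3 : dotProduct c (A.mulVec u) * dotProduct u (A.mulVec c)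
      ≤ dotProduct c (A.mulVec c) * dotProduct u (A.mulVec u) := by
    have := LinearMap.BilinForm.apply_mul_apply_le_of_forall_zero_le (Matrix.toBilin' A)
      (fun x => by rw [Matrix.toBilin'_apply']; exact h0 x) c u
    simpa only [Matrix.toBilin'_apply'] using this
  rw [hsym u c, h1, h2] at h3
  have h4 := dotProduct_mulVec_le B y
  have h5 := h0 c
  have h6 : 0 ≤ dotProduct y y := hyy ▸ Finset.sum_nonneg fun j _ => sq_nonneg _
  rw [hyy]
  rcases h6.eq_or_lt with h7 | h7
  · rw [← h7]; exact mul_nonneg (specNorm_nonneg _) h5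
  · have h8 : dotProduct y y * dotProduct y y
        ≤ (specNorm B * dotProduct c (A.mulVec c)) * dotProduct y y := by
      nlinarith [mul_le_mul_of_nonneg_left h4 h5]
    exact le_of_mul_le_mul_right h8 h7

/-- The quadratic form of `A` lies between `α` and `α'` times that of the diagonal matrix of `l`. -/
structure IsSandwiched (A : Matrix (Fin m) (Fin m) ℝ) (l : ℕ → ℝ) (α α' : ℝ) : Prop where
  symm : ∀ u v, dotProduct u (A.mulVec v) = dotProduct v (A.mulVec u)
  lower : ∀ u, α * ∑ j : Fin m, l j * u j ^ 2 ≤ dotProduct u (A.mulVec u)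
  upper : ∀ u, dotProduct u (A.mulVec u) ≤ α' * ∑ j : Fin m, l j * u j ^ 2

theorem isSandwiched_diagMat (l : ℕ → ℝ) (m : ℕ) : IsSandwiched (diagMat l m) l 1 1 := by
  have h : ∀ u v : Fin m → ℝ, dotProduct u ((diagMat l m).mulVec v)
      = ∑ j : Fin m, l j * (u j * v j) := fun u v => by
    rw [diagMat_mulVec, dotProduct]
    exact Finset.sum_congr rfl fun j _ => by ring
  refine ⟨fun u v => ?_, fun u => ?_, fun u => ?_⟩
  · rw [h, h]; exact Finset.sum_congr rfl fun j _ => by ring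
  · rw [h, one_mul]; exact (Finset.sum_congr rfl fun j _ => by ring).le
  · rw [h, one_mul]; exact (Finset.sum_congr rfl fun j _ => by ring).le

variable {A : Matrix (Fin m) (Fin m) ℝ} {l : ℕ → ℝ} {α α' : ℝ} (hA : IsSandwiched A l α α')
  (hl : ∀ j, 0 < l j) (hα : 0 < α)
include hA hl hα

theorem IsSandwiched.nonneg (u : Fin m → ℝ) : 0 ≤ dotProduct u (A.mulVec u) :=
  le_trans (mul_nonneg hα.le (Finset.sum_nonneg fun _ _ => mul_nonneg (hl _).le (sq_nonneg _)))
    (hA.lower u)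

theorem IsSandwiched.isUnit_det : IsUnit A.det := by
  rw [isUnit_iff_ne_zero]
  intro h
  obtain ⟨v, hv, hv0⟩ := Matrix.exists_mulVec_eq_zero_iff.2 h
  have h1 := hA.lower v
  rw [hv0, dotProduct_zero] at h1
  apply hv
  have h2 : ∑ j : Fin m, l j * v j ^ 2 = 0 := le_antisymm (by nlinarith)
    (Finset.sum_nonneg fun j _ => mul_nonneg (hl j).le (sq_nonneg _))
  ext j
  have h3 := (Finset.sum_eq_zero_iff_of_nonneg
    fun j _ => mul_nonneg (hl _).le (sq_nonneg _)).1 h2 j (Finset.mem_univ j)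
  have := (hl j).ne'
  simpa [this] using h3

theorem IsSandwiched.specNorm_scaled_inv_le {s : ℕ → ℝ} {C : ℝ} (hC : 0 ≤ C)
    (hs : ∀ j < m, s j ^ 2 ≤ C * l j) :
    specNorm (diagMat s m * A⁻¹ * diagMat s m) ≤ C / α := by
  have hu := hA.isUnit_det hl hα
  refine specNorm_le (by positivity) fun y => ?_
  set c := A⁻¹.mulVec ((diagMat s m).mulVec y) with hc
  have hz : (diagMat s m * A⁻¹ * diagMat s m).mulVec y = (diagMat s m).mulVec c := by
    simp [hc, Matrix.mulVec_mulVec, Matrix.mul_assoc]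
  have hAc : A.mulVec c = (diagMat s m).mulVec y := by
    rw [hc, Matrix.mulVec_mulVec, Matrix.mul_nonsing_inv _ hu, Matrix.one_mulVec]
  have h1 := hA.lower c
  rw [hAc] at h1
  rw [hz]
  have h2 : dotProduct c ((diagMat s m).mulVec y) = dotProduct ((diagMat s m).mulVec c) y := by
    rw [diagMat_mulVec, diagMat_mulVec]
    exact Finset.sum_congr rfl fun j _ => by ring
  rw [h2] at h1
  have h3 : dotProduct ((diagMat s m).mulVec c) ((diagMat s m).mulVec c)
      ≤ C * ∑ j : Fin m, l j * c j ^ 2 := by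
    rw [diagMat_mulVec, dotProduct, Finset.mul_sum]
    refine Finset.sum_le_sum fun j _ => ?_
    have := mul_le_mul_of_nonneg_right (hs j j.2) (sq_nonneg (c j))
    nlinarith
  rw [div_mul_eq_mul_div, le_div_iff₀ hα]
  nlinarith [mul_le_mul_of_nonneg_left h1 hC]

theorem IsSandwiched.sum_scaled_sq_le (s : ℕ → ℝ) (c : Fin m → ℝ) :
    ∑ j : Fin m, (s j * c j) ^ 2
      ≤ specNorm (diagMat s m * A⁻¹ * diagMat s m) * dotProduct c (A.mulVec c) :=
  sum_scaled_sq_le_specNorm hA.symm (hA.nonneg hl hα) (hA.isUnit_det hl hα) s c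

theorem IsSandwiched.invNorm_le (hla : Antitone l) (hm : 1 ≤ m) :
    invNorm A ≤ ENNReal.ofReal ((α * l (m - 1))⁻¹) := by
  rw [invNorm, if_pos (hA.isUnit_det hl hα)]
  refine ENNReal.ofReal_le_ofReal ?_
  have h := hA.specNorm_scaled_inv_le hl hα (s := fun _ => 1) (C := (l (m - 1))⁻¹)
    (inv_nonneg.2 (hl _).le) (fun j hj => by
      rw [one_pow, inv_mul_eq_div, one_le_div (hl _)]
      exact hla (by omega))
  have h1 : diagMat (fun _ => 1) m = 1 := Matrix.diagonal_one
  rw [h1, one_mul, mul_one] at h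
  refine h.trans (le_of_eq ?_)
  rw [mul_inv, div_eq_mul_inv, mul_comm]

end SpectralNorm

/-! ### Comparison of `Δ` for empirical and diagonal matrices -/

section Delta

variable {w l : ℕ → ℝ} {A : (k : ℕ) → Matrix (Fin k) (Fin k) ℝ}

theorem le_bigDelta (w : ℕ → ℝ) (A : (k : ℕ) → Matrix (Fin k) (Fin k) ℝ) {k m : ℕ} (hk : 1 ≤ k)
    (hkm : k ≤ m) :
    specNorm (diagMat (fun j => √(w j)) k * (A k)⁻¹ * diagMat (fun j => √(w j)) k)
      ≤ bigDelta w A m := by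
  obtain ⟨k, rfl⟩ : ∃ k', k = k' + 1 := ⟨k - 1, by omega⟩
  exact le_ciSup (f := fun k : Fin m => specNorm
    (diagMat (fun j => √(w j)) (k + 1) * (A (k + 1))⁻¹ * diagMat (fun j => √(w j)) (k + 1)))
    (Set.finite_range _).bddAbove ⟨k, by omega⟩

theorem bigDelta_nonneg (w : ℕ → ℝ) (A : (k : ℕ) → Matrix (Fin k) (Fin k) ℝ) (m : ℕ) :
    0 ≤ bigDelta w A m := Real.iSup_nonneg fun _ => specNorm_nonneg _

theorem bigDelta_le {m : ℕ} {C : ℝ} (hC : 0 ≤ C) (h : ∀ k, 1 ≤ k → k ≤ m →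
    specNorm (diagMat (fun j => √(w j)) k * (A k)⁻¹ * diagMat (fun j => √(w j)) k) ≤ C) :
    bigDelta w A m ≤ C :=
  Real.iSup_le (fun k => h (k + 1) (by omega) (by omega)) hC

variable (hl : ∀ j, 0 < l j) (hw : ∀ j, 0 < w j)
include hl hw

theorem sum_mul_sq_le_bigDelta {k m : ℕ} (hkm : k ≤ m) {α α' : ℝ} (hα : 0 < α)
    (hA : IsSandwiched (A k) l α α') (c : Fin k → ℝ) :
    ∑ j : Fin k, w j * c j ^ 2 ≤ bigDelta w A m * dotProduct c ((A k).mulVec c) := by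
  rcases Nat.eq_zero_or_pos k with rfl | hk
  · simp
  have h := hA.sum_scaled_sq_le hl hα (fun j => √(w j)) c
  simp_rw [mul_pow, Real.sq_sqrt (hw _).le] at h
  exact h.trans (mul_le_mul_of_nonneg_right (le_bigDelta w A hk hkm) (hA.nonneg hl hα c))

/-- The test vector is a coordinate vector. Both comparisons of `Δ` below reduce to this
coordinatewise domination of `w` by `l`. -/
theorem weight_le_bigDelta {j m : ℕ} (hj : j < m) {α α' : ℝ} (hα : 0 < α)
    (hA : IsSandwiched (A m) l α α') : w j ≤ bigDelta w A m * (α' * l j) := by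
  have h := sum_mul_sq_le_bigDelta hl hw le_rfl hα hA (Pi.single ⟨j, hj⟩ 1)
  have h2 := hA.upper (Pi.single ⟨j, hj⟩ 1)
  have e : ∀ v : ℕ → ℝ, ∑ i : Fin m, v i * (Pi.single (⟨j, hj⟩ : Fin m) (1 : ℝ) : Fin m → ℝ) i ^ 2
      = v j := fun v => by
    rw [Finset.sum_eq_single_of_mem (⟨j, hj⟩ : Fin m) (Finset.mem_univ _)]
    · simp
    · intro i _ hi
      simp [Pi.single_eq_of_ne hi]
  rw [e] at h h2
  exact h.trans (mul_le_mul_of_nonneg_left h2 (bigDelta_nonneg _ _ _))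

theorem weight_le_bigDeltaOf {j m : ℕ} (hj : j < m) : w j ≤ bigDeltaOf w l m * l j := by
  have := weight_le_bigDelta hl hw (A := diagMat l) hj one_pos (isSandwiched_diagMat l m)
  rwa [one_mul] at this

theorem bigDelta_le_bigDeltaOf {m : ℕ} {α α' : ℝ} (hα : 0 < α)
    (hA : ∀ k ≤ m, IsSandwiched (A k) l α α') : bigDelta w A m ≤ bigDeltaOf w l m / α := by
  have h0 : 0 ≤ bigDeltaOf w l m := bigDelta_nonneg _ _ _
  refine bigDelta_le (by positivity) fun k hk hkm => ?_
  refine (hA k hkm).specNorm_scaled_inv_le hl hα h0 fun j hj => ?_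
  rw [Real.sq_sqrt (hw j).le]
  exact weight_le_bigDeltaOf hl hw (hj.trans_le hkm)

theorem bigDeltaOf_le_bigDelta {m : ℕ} {α α' : ℝ} (hα : 0 < α) (hα' : 0 ≤ α')
    (hA : IsSandwiched (A m) l α α') : bigDeltaOf w l m ≤ α' * bigDelta w A m := by
  have h0 : 0 ≤ bigDelta w A m := bigDelta_nonneg _ _ _
  refine bigDelta_le (by positivity) fun k hk hkm => ?_
  have h := (isSandwiched_diagMat l k).specNorm_scaled_inv_le hl one_pos
    (s := fun j => √(w j)) (C := α' * bigDelta w A m) (by positivity) fun j hj => by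
      rw [Real.sq_sqrt (hw j).le]
      exact (weight_le_bigDelta hl hw (hj.trans_le hkm) hα hA).trans (le_of_eq (by ring))
  rwa [div_one] at h

end Delta

/-! ### The logarithmic factor of the penalty -/

section LogRatio

/-- The factor `log (D ∨ (m + 2)) / log (m + 2)`. -/
noncomputable def logRatio (D : ℝ) (m : ℕ) : ℝ := Real.log (max D (m + 2)) / Real.log (m + 2)

theorem one_le_log_add_two {m : ℕ} (hm : 1 ≤ m) : 1 ≤ Real.log (m + 2) := by
  have h : (1 : ℝ) ≤ m := by exact_mod_cast hm
  rw [Real.le_log_iff_exp_le (by linarith)]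
  linarith [Real.exp_one_lt_three]

theorem one_le_logRatio (D : ℝ) {m : ℕ} (hm : 1 ≤ m) : 1 ≤ logRatio D m := by
  have h := one_le_log_add_two hm
  rw [logRatio, one_le_div (by linarith)]
  exact Real.log_le_log (by positivity) (le_max_right _ _)

/-- A factor `c` in the argument adds `log c`, and this is at most `log c` times the original
logarithm, which is at least `1` because of the shift by `2`. -/
theorem logRatio_le_of_le {D D' c : ℝ} (hc : 1 ≤ c) (h : D' ≤ c * D) {m : ℕ} (hm : 1 ≤ m) :
    logRatio D' m ≤ (1 + Real.log c) * logRatio D m := by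
  have h1 := one_le_log_add_two hm
  have hm0 : (0 : ℝ) < m + 2 := by positivity
  have h2 : Real.log (m + 2) ≤ Real.log (max D (m + 2)) :=
    Real.log_le_log hm0 (le_max_right _ _)
  have hmax : 0 < max D (m + 2) := lt_max_of_lt_right hm0
  rw [logRatio, logRatio, ← mul_div_assoc, div_le_div_iff_of_pos_right (by linarith)]
  have h3 : max D' (m + 2) ≤ c * max D (m + 2) := by
    refine max_le (h.trans (mul_le_mul_of_nonneg_left (le_max_left _ _) (by linarith))) ?_
    calc (m : ℝ) + 2 ≤ max D (m + 2) := le_max_right _ _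
      _ ≤ c * max D (m + 2) := le_mul_of_one_le_left hmax.le hc
  have h4 := Real.log_le_log (lt_max_of_lt_right hm0) h3
  rw [Real.log_mul (by positivity) hmax.ne'] at h4
  nlinarith [Real.log_nonneg hc]

theorem smallDelta_eq (w : ℕ → ℝ) (A : (k : ℕ) → Matrix (Fin k) (Fin k) ℝ) (m : ℕ) :
    smallDelta w A m = m * bigDelta w A m * logRatio (bigDelta w A m) m := rfl

theorem smallDelta_nonneg (w : ℕ → ℝ) (A : (k : ℕ) → Matrix (Fin k) (Fin k) ℝ) {m : ℕ}
    (hm : 1 ≤ m) : 0 ≤ smallDelta w A m := by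
  have h1 := one_le_logRatio (bigDelta w A m) hm
  have h2 := bigDelta_nonneg w A m
  rw [smallDelta_eq]
  positivity

end LogRatio

/-! ### Ranges of dimensions and minimizers -/

section Dimensions

variable {w : ℕ → ℝ} {n : ℕ}

theorem le_wMax (w : ℕ → ℝ) {j m : ℕ} (hj : j < m) : w j ≤ wMax w m :=
  le_ciSup (f := fun k : Fin m => w k) (Set.finite_range _).bddAbove ⟨j, hj⟩

theorem dimCap_mem (h0 : w 0 = 1) (hn : 1 ≤ n) :
    1 ≤ dimCap w n ∧ dimCap w n ≤ ⌊(n : ℝ) ^ (1 / 4 : ℝ)⌋₊ ∧ wMax w (dimCap w n) ≤ n := by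
  have hn' : (1 : ℝ) ≤ n := by exact_mod_cast hn
  refine Nat.sSup_mem (s := {m : ℕ | 1 ≤ m ∧ m ≤ ⌊(n : ℝ) ^ (1 / 4 : ℝ)⌋₊ ∧ wMax w m ≤ n})
    ⟨1, le_rfl, ?_, ?_⟩ ⟨⌊(n : ℝ) ^ (1 / 4 : ℝ)⌋₊, fun m hm => hm.2.1⟩
  · exact Nat.le_floor (by simpa using Real.one_le_rpow hn' (by norm_num : (0 : ℝ) ≤ 1 / 4))
  · refine ciSup_le fun k => ?_
    rw [show (k : ℕ) = 0 by omega, h0]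
    exact hn'

theorem one_le_dimCap (h0 : w 0 = 1) (hn : 1 ≤ n) : 1 ≤ dimCap w n := (dimCap_mem h0 hn).1

theorem dimCap_pow_le (h0 : w 0 = 1) (hn : 1 ≤ n) : (dimCap w n : ℝ) ^ 4 ≤ n := by
  have h := (dimCap_mem h0 hn).2.1
  have h1 : (dimCap w n : ℝ) ≤ (n : ℝ) ^ (1 / 4 : ℝ) :=
    (Nat.cast_le.2 h).trans (Nat.floor_le (by positivity))
  refine (pow_le_pow_left₀ (Nat.cast_nonneg _) h1 4).trans (le_of_eq ?_)
  rw [← Real.rpow_natCast, ← Real.rpow_mul (by positivity)]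
  norm_num

theorem weight_le_of_lt_dimCap (h0 : w 0 = 1) (hn : 1 ≤ n) {j : ℕ} (hj : j < dimCap w n) :
    w j ≤ n := (le_wMax w hj).trans (dimCap_mem h0 hn).2.2

theorem dimBound_mem (h0 : w 0 = 1) (hn : 1 ≤ n) (a : ℕ → ℝ≥0∞) :
    1 ≤ dimBound w n a ∧ dimBound w n a ≤ dimCap w n := by
  unfold dimBound
  split_ifs with h
  · have := Nat.sInf_mem h
    have h1 := this.1
    have h2 := this.2.1
    omega
  · exact ⟨one_le_dimCap h0 hn, le_rfl⟩

theorem dimBound_le_dimBound (h0 : w 0 = 1) (hn : 1 ≤ n) {a a' : ℕ → ℝ≥0∞}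
    (h : ∀ m, 1 ≤ m → m ≤ dimCap w n → a' m ≤ a m) : dimBound w n a ≤ dimBound w n a' := by
  by_cases hne : (exceedSet w n a').Nonempty
  · have hmem := Nat.sInf_mem hne
    have h2 : sInf (exceedSet w n a') ∈ exceedSet w n a := by
      refine ⟨hmem.1, hmem.2.1, hmem.2.2.trans_le ?_⟩
      exact mul_le_mul' le_rfl (h _ (by linarith [hmem.1]) hmem.2.1)
    have h3 := Nat.sInf_le h2
    rw [dimBound, dimBound, if_pos hne, if_pos ⟨_, h2⟩]
    omega
  · conv_rhs => rw [dimBound, if_neg hne]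
    exact (dimBound_mem h0 hn a).2

/-- An `m` in the range is not exceptional, and `m w_(m) ≥ 1` may be dropped. Dimension `1` is never
tested, so nothing can be concluded for `m = 1`. -/
theorem le_of_le_dimBound (h0 : w 0 = 1) (hn : 1 ≤ n) {a : ℕ → ℝ≥0∞} {m : ℕ} (hm : 2 ≤ m)
    (hmb : m ≤ dimBound w n a) : a m ≤ n := by
  have hcap := hmb.trans (dimBound_mem h0 hn a).2
  have hnot : m ∉ exceedSet w n a := by
    intro h
    have h1 := Nat.sInf_le h
    rw [dimBound, if_pos ⟨m, h⟩] at hmb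
    have := (Nat.sInf_mem ⟨m, h⟩).1
    omega
  have h1 : (m : ℝ≥0∞) * ENNReal.ofReal (wMax w m) * a m
      ≤ ENNReal.ofReal (n / (1 + Real.log n)) := by
    by_contra hlt
    exact hnot ⟨hm, hcap, not_le.1 hlt⟩
  have hn' : (1 : ℝ) ≤ n := by exact_mod_cast hn
  have h2 : (1 : ℝ≥0∞) ≤ m := by exact_mod_cast (by omega : 1 ≤ m)
  have h3 : (1 : ℝ≥0∞) ≤ ENNReal.ofReal (wMax w m) := by
    rw [ENNReal.one_le_ofReal, ← h0]
    exact le_wMax w (by omega)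
  calc a m = 1 * 1 * a m := by ring
    _ ≤ (m : ℝ≥0∞) * ENNReal.ofReal (wMax w m) * a m := by gcongr
    _ ≤ ENNReal.ofReal (n / (1 + Real.log n)) := h1
    _ ≤ ENNReal.ofReal n := ENNReal.ofReal_le_ofReal
        (div_le_self (by positivity) (by linarith [Real.log_nonneg hn']))
    _ = n := ENNReal.ofReal_natCast n

theorem argminUpTo_mem {M : ℕ} (hM : 1 ≤ M) (c : ℕ → ℝ) :
    1 ≤ argminUpTo M c ∧ argminUpTo M c ≤ M ∧
      ∀ k, 1 ≤ k → k ≤ M → c (argminUpTo M c) ≤ c k := by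
  obtain ⟨m, hm, hmin⟩ := Finset.exists_min_image (Finset.Icc 1 M) c
    ⟨1, Finset.mem_Icc.2 ⟨le_rfl, hM⟩⟩
  have hm' := Finset.mem_Icc.1 hm
  exact Nat.sInf_mem (s := {m : ℕ | 1 ≤ m ∧ m ≤ M ∧ ∀ k, 1 ≤ k → k ≤ M → c m ≤ c k})
    ⟨m, hm'.1, hm'.2, fun k h1 h2 => hmin k (Finset.mem_Icc.2 ⟨h1, h2⟩)⟩

theorem exists_lt_of_lt_argminUpTo {M : ℕ} {c : ℕ → ℝ} {m : ℕ} (hm : 1 ≤ m) (hmM : m ≤ M)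
    (h : m < argminUpTo M c) : ∃ k, 1 ≤ k ∧ k ≤ M ∧ c k < c m := by
  by_contra hcon
  push Not at hcon
  exact absurd (Nat.sInf_le (s := {m : ℕ | 1 ≤ m ∧ m ≤ M ∧ ∀ k, 1 ≤ k → k ≤ M → c m ≤ c k})
    ⟨hm, hmM, hcon⟩) (not_le.2 h)

end Dimensions

/-! ### The selected dimension and chains of dimensions -/

section Selection

/-- Increasing sequences of dimensions along which the penalty grows slower than `q`. -/
theorem exists_chain {q : ℕ → ℕ → ℝ} {pen : ℕ → ℝ} {a t M : ℕ} (hq : ∀ m, 0 ≤ q m m)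
    (ha : a ≤ M) (hstep : ∀ m, a ≤ m → m < t → ∃ k, m < k ∧ k ≤ M ∧ pen k ≤ q m k + pen m) :
    ∃ κ : ℕ → ℕ, Monotone κ ∧ κ 0 = a ∧ t ≤ κ t ∧ κ t ≤ M ∧ (∀ i, κ i ≤ κ t) ∧
      pen (κ t) ≤ pen a + ∑ i ∈ Finset.range t, q (κ i) (κ (i + 1)) := by
  choose! f hf1 hf2 hf3 using hstep
  -- The sequence freezes once it reaches `t`. Before that it gains at least one per step, so `t`
  -- iterations suffice.
  set g : ℕ → ℕ := fun m => if m < t then f m else m with hg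
  set κ : ℕ → ℕ := fun i => g^[i] a with hκ
  have hsucc : ∀ i, κ (i + 1) = g (κ i) := fun i => Function.iterate_succ_apply' g i a
  have hinv : ∀ i, a ≤ κ i ∧ κ i ≤ M ∧ (t ≤ κ i ∨ a + i ≤ κ i) := by
    intro i
    induction i with
    | zero => exact ⟨le_rfl, ha, Or.inr le_rfl⟩
    | succ i ih =>
      rw [hsucc, hg]
      by_cases h : κ i < t
      · have h1 := hf1 _ ih.1 h
        have h2 := hf2 _ ih.1 h
        simp only [h, if_true]
        omega
      · simp only [h, if_false]
        omega
  have hle : ∀ i, κ i ≤ κ (i + 1) := by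
    intro i
    rw [hsucc, hg]
    by_cases h : κ i < t
    · simp only [h, if_true]
      exact (hf1 _ (hinv i).1 h).le
    · simp only [h, if_false, le_refl]
  have hmono : Monotone κ := monotone_nat_of_le_succ hle
  have ht : t ≤ κ t := by have := hinv t; omega
  refine ⟨κ, hmono, rfl, ht, (hinv t).2.1, fun i => ?_, ?_⟩
  · rcases le_total i t with h | h
    · exact hmono h
    · obtain ⟨j, rfl⟩ := Nat.exists_eq_add_of_le h
      clear h
      induction j with
      | zero => exact le_rfl
      | succ j ih =>
        have h1 : t ≤ κ (t + j) := ht.trans (hmono (Nat.le_add_right t j))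
        rw [← add_assoc, hsucc, hg]
        simp only [not_lt.2 h1, if_false]
        exact ih
  · have key : ∀ i, pen (κ i) ≤ pen a + ∑ i ∈ Finset.range i, q (κ i) (κ (i + 1)) := by
      intro i
      induction i with
      | zero => simp [hκ]
      | succ i ih =>
        rw [Finset.sum_range_succ]
        have : pen (κ (i + 1)) ≤ q (κ i) (κ (i + 1)) + pen (κ i) := by
          by_cases h : κ i < t
          · have h1 : κ (i + 1) = f (κ i) := by rw [hsucc, hg]; simp only [h, if_true]
            rw [h1]
            exact hf3 _ (hinv i).1 h
          · have h1 : κ (i + 1) = κ i := by rw [hsucc, hg]; simp only [h, if_false]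
            rw [h1]
            linarith [hq (κ i)]
        linarith
    exact key t

variable {H : Type*} [NormedAddCommGroup H] [InnerProductSpace ℝ H] (ψ : HilbertBasis ℕ ℝ H)

/-- Taking `k = m` in the contrast shows that the criterion is nonnegative; at the last dimension it
vanishes. Its minimum is therefore `0`, and any `m` before the smallest minimizer has a positive
value, witnessed by some `k`, which cannot be `m`. -/
theorem mHat_spec {w : ℕ → ℝ} (κ : ℝ) {n : ℕ} (x : Fin n → H) (y : Fin n → ℝ)
    (hM : 1 ≤ dimHat ψ w x) :
    1 ≤ mHat ψ w κ x y ∧ mHat ψ w κ x y ≤ dimHat ψ w x ∧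
    (∀ k, mHat ψ w κ x y ≤ k → k ≤ dimHat ψ w x →
      (wNormSq ψ w (betaHat ψ x y k - betaHat ψ x y (mHat ψ w κ x y))).toReal
        + penHat ψ w κ x y (mHat ψ w κ x y) ≤ penHat ψ w κ x y k) ∧
    (∀ m, 1 ≤ m → m < mHat ψ w κ x y → ∃ k, m < k ∧ k ≤ dimHat ψ w x ∧
      penHat ψ w κ x y k ≤ (wNormSq ψ w (betaHat ψ x y k - betaHat ψ x y m)).toReal
        + penHat ψ w κ x y m) := by
  set M := dimHat ψ w x
  set q : ℕ → ℕ → ℝ := fun m k => (wNormSq ψ w (betaHat ψ x y k - betaHat ψ x y m)).toReal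
  set pen := penHat ψ w κ x y
  have hqq : ∀ m, q m m = 0 := fun m => by simp [q, wNormSq]
  have hcon : ∀ m, contrast ψ w κ x y m = ⨆ k : Set.Icc m M, (q m k - pen k) := fun m => rfl
  have hbdd : ∀ m, BddAbove (Set.range fun k : Set.Icc m M => q m k - pen k) := fun m =>
    (Set.finite_range _).bddAbove
  have hge : ∀ m k, m ≤ k → k ≤ M → q m k - pen k ≤ contrast ψ w κ x y m := fun m k h1 h2 => by
    rw [hcon]
    exact le_ciSup (hbdd m) ⟨k, h1, h2⟩
  have hnonneg : ∀ m, m ≤ M → 0 ≤ contrast ψ w κ x y m + pen m := fun m hm => by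
    have := hge m m le_rfl hm
    rw [hqq] at this
    linarith
  have hlast : contrast ψ w κ x y M + pen M = 0 := by
    have : Nonempty (Set.Icc M M) := ⟨⟨M, le_rfl, le_rfl⟩⟩
    have h1 : contrast ψ w κ x y M ≤ -pen M := by
      rw [hcon]
      refine ciSup_le fun k => ?_
      rw [show (k : ℕ) = M from le_antisymm k.2.2 k.2.1, hqq, zero_sub]
    linarith [hnonneg M le_rfl]
  obtain ⟨h1, h2, h3⟩ := argminUpTo_mem hM fun m => contrast ψ w κ x y m + pen m
  change 1 ≤ mHat ψ w κ x y at h1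
  change mHat ψ w κ x y ≤ M at h2
  refine ⟨h1, h2, fun k hk hkM => ?_, fun m hm hmlt => ?_⟩
  · have h4 := h3 M hM le_rfl
    rw [hlast] at h4
    have h5 := hge _ k hk hkM
    change contrast ψ w κ x y (mHat ψ w κ x y) + pen (mHat ψ w κ x y) ≤ 0 at h4
    change q (mHat ψ w κ x y) k + pen (mHat ψ w κ x y) ≤ pen k
    linarith
  · have hmM : m ≤ M := hmlt.le.trans h2
    obtain ⟨k, hk1, hkM, hk⟩ := exists_lt_of_lt_argminUpTo hm hmM hmlt
    have h4 := hnonneg k hkM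
    have h5 : -pen m < contrast ψ w κ x y m := by linarith
    have : Nonempty (Set.Icc m M) := ⟨⟨m, le_rfl, hmM⟩⟩
    rw [hcon] at h5
    obtain ⟨j, hj⟩ := exists_lt_of_lt_ciSup h5
    refine ⟨j, lt_of_le_of_ne j.2.1 fun h => ?_, j.2.2, ?_⟩
    · rw [← h, hqq] at hj
      linarith
    · change pen j ≤ q m j + pen m
      linarith

end Selection

/-! ### Finiteness of weighted norms -/

section FiniteNorms

variable {H : Type*} [NormedAddCommGroup H] [InnerProductSpace ℝ H] (ψ : HilbertBasis ℕ ℝ H)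
  {w : ℕ → ℝ}

theorem wNormSq_ofCoords (hw : ∀ j, 0 < w j) {m : ℕ} (c : Fin m → ℝ) :
    wNormSq ψ w (ofCoords ψ c) = ENNReal.ofReal (∑ j : Fin m, w j * c j ^ 2) := by
  rw [ENNReal.ofReal_sum_of_nonneg fun _ _ => mul_nonneg (hw _).le (sq_nonneg _), wNormSq,
    tsum_eq_sum (s := Finset.range m), Finset.sum_range]
  · refine Finset.sum_congr rfl fun j _ => ?_
    have := congrFun (coords_ofCoords ψ c) j
    rw [coords] at this
    rw [this]
  · intro j hj
    rw [inner_basis_of_mem_span ψ (not_lt.1 fun h => hj (Finset.mem_range.2 h))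
      (ofCoords_mem_span ψ c)]
    simp

theorem wNormSq_ne_top_of_mem_span (hw : ∀ j, 0 < w j) {m : ℕ} {h : H}
    (hh : h ∈ Submodule.span ℝ (ψ '' Set.Iio m)) : wNormSq ψ w h ≠ ⊤ := by
  rw [← ofCoords_coords ψ hh, wNormSq_ofCoords ψ hw]
  exact ENNReal.ofReal_ne_top

theorem wNormSq_sub_ne_top (hw : ∀ j, 0 < w j) {f g : H} (hf : wNormSq ψ w f ≠ ⊤)
    (hg : wNormSq ψ w g ≠ ⊤) : wNormSq ψ w (f - g) ≠ ⊤ :=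
  ne_top_of_le_ne_top (ENNReal.add_ne_top.2 ⟨ENNReal.mul_ne_top (by norm_num) hf,
    ENNReal.mul_ne_top (by norm_num) hg⟩) (wNormSq_sub_le ψ (fun j => (hw j).le) f g)

theorem toReal_wNormSq_add_le (hw : ∀ j, 0 < w j) {f g : H} (hf : wNormSq ψ w f ≠ ⊤)
    (hg : wNormSq ψ w g ≠ ⊤) :
    (wNormSq ψ w (f + g)).toReal ≤ 2 * (wNormSq ψ w f).toReal + 2 * (wNormSq ψ w g).toReal := by
  have hf2 : 2 * wNormSq ψ w f ≠ ⊤ := ENNReal.mul_ne_top (by norm_num) hf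
  have hg2 : 2 * wNormSq ψ w g ≠ ⊤ := ENNReal.mul_ne_top (by norm_num) hg
  have h := ENNReal.toReal_mono (ENNReal.add_ne_top.2 ⟨hf2, hg2⟩)
    (wNormSq_add_le ψ (fun j => (hw j).le) f g)
  rw [ENNReal.toReal_add hf2 hg2, ENNReal.toReal_mul, ENNReal.toReal_mul] at h
  simpa using h

end FiniteNorms

/-! ### Deterministic consequences of a good sample -/

section EmpiricalBounds

variable {H : Type*} [NormedAddCommGroup H] [InnerProductSpace ℝ H] (ψ : HilbertBasis ℕ ℝ H)
  {n : ℕ} {w : ℕ → ℝ}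

theorem covHat_symm (x : Fin n → H) {m : ℕ} (u v : Fin m → ℝ) :
    dotProduct u ((covHat ψ x m).mulVec v) = dotProduct v ((covHat ψ x m).mulVec u) := by
  rw [dotProduct_covHat_mulVec, dotProduct_covHat_mulVec, real_inner_comm]

theorem dotProduct_covHat_mulVec_self (x : Fin n → H) {m : ℕ} (u : Fin m → ℝ) :
    dotProduct u ((covHat ψ x m).mulVec u) = (n : ℝ)⁻¹ * ‖sampleMap x (ofCoords ψ u)‖ ^ 2 := by
  rw [dotProduct_covHat_mulVec, real_inner_self_eq_norm_sq]

/-- The deterministic bound for the thresholded estimator. -/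
theorem wNormSq_betaHat_le (hw : ∀ j, 0 < w j) (x : Fin n → H) (y : Fin n → ℝ) {m : ℕ}
    (hwn : ∀ j < m, w j ≤ n) :
    wNormSq ψ w (betaHat ψ x y m) ≤ ENNReal.ofReal (n * ∑ i, y i ^ 2) := by
  by_cases hm : invNorm (covHat ψ x m) ≤ n
  · have hu := isUnit_det_of_invNorm_le (ENNReal.natCast_ne_top n) hm
    rw [← ofCoords_coords ψ (betaHat_mem_span ψ x y m), wNormSq_ofCoords ψ hw]
    set c := coords ψ m (betaHat ψ x y m) with hc
    refine ENNReal.ofReal_le_ofReal ?_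
    have h1 : ∑ j : Fin m, w j * c j ^ 2 ≤ n * ∑ j : Fin m, c j ^ 2 := by
      rw [Finset.mul_sum]
      exact Finset.sum_le_sum fun j _ => mul_le_mul_of_nonneg_right (hwn j j.2) (sq_nonneg _)
    refine h1.trans (mul_le_mul_of_nonneg_left ?_ (Nat.cast_nonneg n))
    have h2 := sum_scaled_sq_le_specNorm (covHat_symm ψ x) (fun u => by
      rw [dotProduct_covHat_mulVec_self]; positivity) hu (fun _ => 1) c
    have h3 : diagMat (fun _ => 1) m = 1 := Matrix.diagonal_one
    simp only [h3, one_mul, mul_one] at h2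
    have h4 : specNorm (covHat ψ x m)⁻¹ ≤ n := by
      rw [invNorm, if_pos hu] at hm
      rw [← ENNReal.ofReal_natCast, ENNReal.ofReal_le_ofReal_iff (Nat.cast_nonneg n)] at hm
      exact hm
    have h5 := norm_sampleMap_betaHat_le ψ x y m
    have h6 : ∑ i, y i ^ 2 = ‖(WithLp.toLp 2 y : EuclideanSpace ℝ (Fin n))‖ ^ 2 := by
      rw [EuclideanSpace.real_norm_sq_eq]
    rw [dotProduct_covHat_mulVec_self, hc, ofCoords_coords ψ (betaHat_mem_span ψ x y m)] at h2
    rw [h6]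
    refine h2.trans ?_
    have h7 : ‖sampleMap x (betaHat ψ x y m)‖ ^ 2
        ≤ ‖(WithLp.toLp 2 y : EuclideanSpace ℝ (Fin n))‖ ^ 2 := by gcongr
    calc specNorm (covHat ψ x m)⁻¹ * ((n : ℝ)⁻¹ * ‖sampleMap x (betaHat ψ x y m)‖ ^ 2)
        ≤ n * ((n : ℝ)⁻¹ * ‖sampleMap x (betaHat ψ x y m)‖ ^ 2) := by gcongr
      _ ≤ ‖sampleMap x (betaHat ψ x y m)‖ ^ 2 := by
          rw [← mul_assoc]
          exact mul_le_of_le_one_left (by positivity) mul_inv_le_one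
      _ ≤ _ := h7
  · rw [betaHat, if_neg hm]
    simp [wNormSq]

/-- The quadratic form in the variance estimator is the mean square of the fitted values, which lies
between zero and the mean square of the responses. -/
theorem sigmaHatSq_mem (x : Fin n → H) (y : Fin n → ℝ) {m : ℕ}
    (hm : invNorm (covHat ψ x m) ≤ n) :
    2 * ((n : ℝ)⁻¹ * ∑ i, y i ^ 2) ≤ sigmaHatSq ψ x y m ∧
      sigmaHatSq ψ x y m ≤ 4 * ((n : ℝ)⁻¹ * ∑ i, y i ^ 2) := by
  have hu := isUnit_det_of_invNorm_le (ENNReal.natCast_ne_top n) hm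
  set c := (covHat ψ x m)⁻¹.mulVec (gHat ψ x y m) with hc
  have h1 : (covHat ψ x m).mulVec c = gHat ψ x y m := by
    rw [hc, Matrix.mulVec_mulVec, Matrix.mul_nonsing_inv _ hu, Matrix.one_mulVec]
  have h2 : dotProduct (gHat ψ x y m) c = (n : ℝ)⁻¹ * ‖sampleMap x (betaHat ψ x y m)‖ ^ 2 := by
    rw [betaHat, if_pos hm, ← dotProduct_covHat_mulVec_self, h1, dotProduct_comm]
  have h5 := norm_sampleMap_betaHat_le ψ x y m
  have h6 : ∑ i, y i ^ 2 = ‖(WithLp.toLp 2 y : EuclideanSpace ℝ (Fin n))‖ ^ 2 := by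
    rw [EuclideanSpace.real_norm_sq_eq]
  have h7 : (n : ℝ)⁻¹ * ‖sampleMap x (betaHat ψ x y m)‖ ^ 2 ≤ (n : ℝ)⁻¹ * ∑ i, y i ^ 2 := by
    rw [h6]; gcongr
  have h8 : 0 ≤ (n : ℝ)⁻¹ * ‖sampleMap x (betaHat ψ x y m)‖ ^ 2 := by positivity
  unfold sigmaHatSq
  rw [← hc, h2]
  constructor <;> linarith

variable {T : H →L[ℝ] H} {l : ℕ → ℝ} {d : ℝ}

/-- The empirical second moments are close to the population ones, on the span of the first `M`
basis vectors and for the response, whose second moment is `E`. -/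
structure IsGoodSample (T : H →L[ℝ] H) (M : ℕ) (E : ℝ) (x : Fin n → H) (y : Fin n → ℝ) :
    Prop where
  lower : ∀ h ∈ Submodule.span ℝ (ψ '' Set.Iio M),
    1 / 2 * inner ℝ (T h) h ≤ (n : ℝ)⁻¹ * ‖sampleMap x h‖ ^ 2
  upper : ∀ h ∈ Submodule.span ℝ (ψ '' Set.Iio M),
    (n : ℝ)⁻¹ * ‖sampleMap x h‖ ^ 2 ≤ 3 / 2 * inner ℝ (T h) h
  resp_lower : 1 / 2 * E ≤ (n : ℝ)⁻¹ * ∑ i, y i ^ 2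
  resp_upper : (n : ℝ)⁻¹ * ∑ i, y i ^ 2 ≤ 3 / 2 * E

variable [CompleteSpace H] {M : ℕ} {E : ℝ} {x : Fin n → H} {y : Fin n → ℝ}

theorem inner_diagOp_ofCoords (hl : ∀ j, 0 < l j) (hs : Summable l) {m : ℕ} (u : Fin m → ℝ) :
    inner ℝ (diagOp ψ l (ofCoords ψ u)) (ofCoords ψ u) = ∑ j : Fin m, l j * u j ^ 2 := by
  have h := ofReal_inner_diagOp ψ (fun j => (hl j).le) hs (ofCoords ψ u)
  rw [wNormSq_ofCoords ψ hl, ENNReal.ofReal_eq_ofReal_iff (diagOp_nonneg ψ (fun j => (hl j).le) hs _)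
    (Finset.sum_nonneg fun j _ => mul_nonneg (hl _).le (sq_nonneg _))] at h
  exact h

variable {ψ}

theorem IsGoodSample.isSandwiched (hG : IsGoodSample ψ T M E x y) (hl : ∀ j, 0 < l j)
    (hs : Summable l) (hd : 1 ≤ d) (hT : T ∈ opClass ψ l d) {m : ℕ} (hm : m ≤ M) :
    IsSandwiched (covHat ψ x m) l (1 / (2 * d)) (3 / 2 * d) := by
  have hspan : ∀ u : Fin m → ℝ, ofCoords ψ u ∈ Submodule.span ℝ (ψ '' Set.Iio M) := fun u =>
    Submodule.span_mono (Set.image_mono (Set.Iio_subset_Iio hm)) (ofCoords_mem_span ψ u)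
  refine ⟨covHat_symm ψ x, fun u => ?_, fun u => ?_⟩
  · rw [dotProduct_covHat_mulVec_self, ← inner_diagOp_ofCoords ψ hl hs]
    refine le_trans ?_ (hG.lower _ (hspan u))
    have h := (opClass_inner_le ψ (fun j => (hl j).le) hs hd hT (ofCoords ψ u)).2
    rw [one_div_mul_eq_div, div_le_iff₀ (by linarith)]
    linarith
  · rw [dotProduct_covHat_mulVec_self, ← inner_diagOp_ofCoords ψ hl hs]
    refine (hG.upper _ (hspan u)).trans ?_
    have h := (opClass_inner_le ψ (fun j => (hl j).le) hs hd hT (ofCoords ψ u)).1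
    linarith

omit [CompleteSpace H] in
theorem toReal_wNormSq_le_bigDelta (hl : ∀ j, 0 < l j) (hw : ∀ j, 0 < w j) {α α' : ℝ}
    (hα : 0 < α) {k m : ℕ} (hkm : k ≤ m) (hA : IsSandwiched (covHat ψ x k) l α α') {h : H}
    (hh : h ∈ Submodule.span ℝ (ψ '' Set.Iio k)) :
    (wNormSq ψ w h).toReal ≤ bigDelta w (covHat ψ x) m * ((n : ℝ)⁻¹ * ‖sampleMap x h‖ ^ 2) := by
  have h1 := sum_mul_sq_le_bigDelta hl hw hkm hα hA (coords ψ k h)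
  rw [dotProduct_covHat_mulVec_self, ofCoords_coords ψ hh] at h1
  conv_lhs => rw [← ofCoords_coords ψ hh, wNormSq_ofCoords ψ hw]
  rwa [ENNReal.toReal_ofReal (Finset.sum_nonneg fun j _ => mul_nonneg (hw _).le (sq_nonneg _))]

variable {b : ℕ → ℝ} (hG : IsGoodSample ψ T (dimCap w n) E x y) (hd : 1 ≤ d)
  (hT : T ∈ opClass ψ l d) (hwt : WeightAssumption w b l) (hn : 1 ≤ n)
include hG hd hT hwt hn

omit hn in
theorem IsGoodSample.invNorm_le {m : ℕ} (hm : 1 ≤ m) (hmM : m ≤ dimCap w n) :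
    invNorm (covHat ψ x m) ≤ ENNReal.ofReal (2 * d * (l (m - 1))⁻¹) := by
  have h := (hG.isSandwiched hwt.l_pos hwt.l_summable hd hT hmM).invNorm_le hwt.l_pos
    (by positivity) hwt.l_antitone hm
  convert h using 2
  rw [one_div, mul_inv, inv_inv]

/-- On a good sample the inverse norm is at most `2 d / l`, below the level `16 d³ / l` that defines
the deterministic range. The oracle dimension is thus available to the selection. -/
theorem IsGoodSample.dimLower_le : dimLower w l d n ≤ dimHat ψ w x := by
  refine dimBound_le_dimBound hwt.w_first hn fun m hm hmM => ?_
  refine (hG.invNorm_le hd hT hwt hm hmM).trans (ENNReal.ofReal_le_ofReal ?_)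
  have h1 := inv_nonneg.2 (hwt.l_pos (m - 1)).le
  refine mul_le_mul_of_nonneg_right ?_ h1
  nlinarith [one_le_pow₀ hd (n := 2)]

theorem IsGoodSample.invNorm_le_of_le_dimHat (hn2 : 2 * d ≤ n) {m : ℕ} (hm : 1 ≤ m)
    (hmM : m ≤ dimHat ψ w x) : invNorm (covHat ψ x m) ≤ n := by
  -- Dimension `1` escapes the test defining the random range; there `l 0 = 1` bounds the inverse
  -- norm by `2 d`. This is the reason for assuming `2 d ≤ n`.
  rcases hm.eq_or_lt with rfl | h2
  · refine (hG.invNorm_le hd hT hwt le_rfl (one_le_dimCap hwt.w_first hn)).trans ?_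
    rw [Nat.sub_self, hwt.l_first, inv_one, mul_one, ← ENNReal.ofReal_natCast]
    exact ENNReal.ofReal_le_ofReal hn2
  · exact le_of_le_dimBound hwt.w_first hn h2 hmM

theorem IsGoodSample.sigmaHatSq_mem (hn2 : 2 * d ≤ n) {m : ℕ} (hm : 1 ≤ m)
    (hmM : m ≤ dimHat ψ w x) : E ≤ sigmaHatSq ψ x y m ∧ sigmaHatSq ψ x y m ≤ 6 * E := by
  have h := FunctionalRegression.sigmaHatSq_mem ψ x y
    (hG.invNorm_le_of_le_dimHat hd hT hwt hn hn2 hm hmM)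
  have h1 := hG.resp_lower
  have h2 := hG.resp_upper
  constructor <;> linarith

omit hn in
theorem IsGoodSample.smallDelta_le {m : ℕ} (hm : 1 ≤ m) (hmM : m ≤ dimCap w n) :
    smallDelta w (covHat ψ x) m ≤ 2 * d * (1 + Real.log (2 * d)) * smallDeltaOf w l m := by
  have h1 : bigDelta w (covHat ψ x) m ≤ 2 * d * bigDeltaOf w l m := by
    have := bigDelta_le_bigDeltaOf hwt.l_pos hwt.w_pos (α := 1 / (2 * d)) (by positivity)
      (fun k hk => hG.isSandwiched hwt.l_pos hwt.l_summable hd hT (hk.trans hmM))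
    rwa [one_div, div_inv_eq_mul, mul_comm] at this
  have h2 := logRatio_le_of_le (by linarith : (1 : ℝ) ≤ 2 * d) h1 hm
  have h3 : smallDeltaOf w l m = m * bigDeltaOf w l m * logRatio (bigDeltaOf w l m) m := rfl
  have h4 : 0 ≤ bigDeltaOf w l m := bigDelta_nonneg _ _ _
  have h5 := bigDelta_nonneg w (covHat ψ x) m
  have h6 := one_le_logRatio (bigDelta w (covHat ψ x) m) hm
  rw [smallDelta_eq, h3]
  generalize logRatio (bigDelta w (covHat ψ x) m) m = L at h2 h6 ⊢
  generalize bigDelta w (covHat ψ x) m = D at h1 h5 ⊢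
  generalize logRatio (bigDeltaOf w l m) m = L' at h2 ⊢
  generalize bigDeltaOf w l m = D' at h1 h4 ⊢
  calc (m : ℝ) * D * L ≤ (m : ℝ) * (2 * d * D') * ((1 + Real.log (2 * d)) * L') := by
        refine mul_le_mul (mul_le_mul_of_nonneg_left h1 (Nat.cast_nonneg m)) h2 (by linarith) ?_
        exact mul_nonneg (Nat.cast_nonneg m) (mul_nonneg (by linarith) h4)
    _ = 2 * d * (1 + Real.log (2 * d)) * (m * D' * L') := by ring

-- The constant `1 + log (3 d / 2)` is at most `2 (1 + log d)`; together with the `16` in the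
-- condition on `Σ` it leaves the factor `1 / 8` used in `noiseExcess_le`.
omit hn in
theorem IsGoodSample.logRatio_ge {m : ℕ} (hm : 1 ≤ m) (hmM : m ≤ dimCap w n) :
    logRatio (bigDeltaOf w l m) m
      ≤ 2 * (1 + Real.log d) * logRatio (bigDelta w (covHat ψ x) m) m := by
  have h1 := bigDeltaOf_le_bigDelta hwt.l_pos hwt.w_pos (A := covHat ψ x)
    (α := 1 / (2 * d)) (α' := 3 / 2 * d) (by positivity) (by positivity)
    (hG.isSandwiched hwt.l_pos hwt.l_summable hd hT hmM)
  refine (logRatio_le_of_le (by linarith) h1 hm).trans ?_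
  have h6 := one_le_logRatio (bigDelta w (covHat ψ x) m) hm
  refine mul_le_mul_of_nonneg_right ?_ (by linarith)
  rw [Real.log_mul (by norm_num) (by positivity)]
  have h7 : Real.log (3 / 2) ≤ 1 := by
    have := Real.log_le_sub_one_of_pos (show (0 : ℝ) < 3 / 2 by norm_num)
    linarith
  linarith [Real.log_nonneg hd]

theorem IsGoodSample.penHat_nonneg (hE : 0 ≤ E) (hn2 : 2 * d ≤ n) {m : ℕ} (hm : 1 ≤ m)
    (hmM : m ≤ dimHat ψ w x) : 0 ≤ penHat ψ w 96 x y m := by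
  have h1 := (hG.sigmaHatSq_mem hd hT hwt hn hn2 hm hmM).1
  have h2 := smallDelta_nonneg w (covHat ψ x) hm
  have h3 : 0 ≤ sigmaHatSq ψ x y m := hE.trans h1
  unfold penHat
  positivity

/-- The constant is `1344 = 14 · 96`. -/
theorem IsGoodSample.le_penHat (hn2 : 2 * d ≤ n) {m : ℕ} (hm : 1 ≤ m)
    (hmM : m ≤ dimHat ψ w x) :
    1344 * (E * smallDelta w (covHat ψ x) m * (n : ℝ)⁻¹) ≤ penHat ψ w 96 x y m := by
  have h1 := (hG.sigmaHatSq_mem hd hT hwt hn hn2 hm hmM).1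
  have h2 := smallDelta_nonneg w (covHat ψ x) hm
  unfold penHat
  have : E * smallDelta w (covHat ψ x) m * (n : ℝ)⁻¹
      ≤ sigmaHatSq ψ x y m * smallDelta w (covHat ψ x) m * (n : ℝ)⁻¹ := by gcongr
  linarith

theorem IsGoodSample.penHat_le (hE : 0 ≤ E) (hn2 : 2 * d ≤ n) {m : ℕ} (hm : 1 ≤ m)
    (hmM : m ≤ dimHat ψ w x) :
    penHat ψ w 96 x y m
      ≤ 16128 * d * (1 + Real.log (2 * d)) * E * (smallDeltaOf w l m / n) := by
  have h1 := (hG.sigmaHatSq_mem hd hT hwt hn hn2 hm hmM).2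
  have h2 := smallDelta_nonneg w (covHat ψ x) hm
  have h3 := hG.smallDelta_le hd hT hwt hm (hmM.trans (dimBound_mem hwt.w_first hn _).2)
  unfold penHat
  have : sigmaHatSq ψ x y m * smallDelta w (covHat ψ x) m * (n : ℝ)⁻¹
      ≤ (6 * E) * (2 * d * (1 + Real.log (2 * d)) * smallDeltaOf w l m) * (n : ℝ)⁻¹ := by gcongr
  rw [div_eq_mul_inv]
  nlinarith

end EmpiricalBounds

/-! ### The error of the adaptive estimator on a good sample -/

section ErrorBound

variable {H : Type*} [NormedAddCommGroup H] [InnerProductSpace ℝ H] [CompleteSpace H]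
  {ψ : HilbertBasis ℕ ℝ H} {n : ℕ} {w b l : ℕ → ℝ} {T : H →L[ℝ] H} {d E : ℝ}
  {x : Fin n → H} {y : Fin n → ℝ} {β : H}

/-- The stochastic errors of the estimators of dimension at most `K` derive from an array of
`K + 1` columns, whose fluctuations are controlled by `Θ`. -/
def HasColumns (ψ : HilbertBasis ℕ ℝ H) (T : H →L[ℝ] H) (β : H) (x : Fin n → H) (y : Fin n → ℝ)
    (E : ℝ) (K : ℕ) (Θ : ℝ≥0∞) : Prop :=
  ∃ (ξ : ℕ → EuclideanSpace ℝ (Fin n)) (τ : ℕ → ℝ), smoothMax ξ (K + 1) = Θ ∧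
    ∑ j ∈ Finset.range (K + 1), τ j ^ 2 = E ∧
    ∀ k ≤ K, invNorm (covHat ψ x k) ≤ n →
      sampleMap x (betaHat ψ x y k - gramProj T ψ k β) = colError ξ (K + 1) τ k

omit [CompleteSpace H] in
theorem wNormSq_le_of_weight_le (ψ : HilbertBasis ℕ ℝ H) {u v : ℕ → ℝ} (h : ∀ j, u j ≤ v j)
    (f : H) : wNormSq ψ u f ≤ wNormSq ψ v f :=
  ENNReal.tsum_le_tsum fun j =>
    ENNReal.ofReal_le_ofReal (mul_le_mul_of_nonneg_right (h j) (sq_nonneg _))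

theorem WeightAssumption.w_le_b (hwt : WeightAssumption w b l) (j : ℕ) : w j ≤ b j := by
  have := hwt.w_div_b_antitone (Nat.zero_le j)
  simp only [hwt.w_first, hwt.b_first, div_one] at this
  rwa [div_le_one (hwt.b_pos j)] at this

variable (hG : IsGoodSample ψ T (dimCap w n) E x y) (hd : 1 ≤ d)
  (hT : T ∈ opClass ψ l d) (hwt : WeightAssumption w b l)

omit [CompleteSpace H] in
include hwt in
theorem wNormSq_gramProj_ne_top (k : ℕ) (f : H) : wNormSq ψ w (gramProj T ψ k f) ≠ ⊤ :=
  wNormSq_ne_top_of_mem_span ψ hwt.w_pos (gramProj_mem_span ψ k f)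

omit [CompleteSpace H] in
include hwt in
theorem wNormSq_betaHat_ne_top (k : ℕ) : wNormSq ψ w (betaHat ψ x y k) ≠ ⊤ :=
  wNormSq_ne_top_of_mem_span ψ hwt.w_pos (betaHat_mem_span ψ x y k)

include hd hT hwt in
theorem sum_toReal_wNormSq_gramProj_sub_le {r : ℝ} (hr : 0 ≤ r)
    (hβ : wNormSq ψ b β ≤ ENNReal.ofReal r) {κ : ℕ → ℕ} (hκ : Monotone κ) (h0 : 1 ≤ κ 0) (t : ℕ) :
    ∑ i ∈ Finset.range t, (wNormSq ψ w (gramProj T ψ (κ (i + 1)) β - gramProj T ψ (κ i) β)).toReal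
      ≤ d ^ 6 * (w (κ 0 - 1) / b (κ 0 - 1)) * r := by
  have hρ : 0 ≤ w (κ 0 - 1) / b (κ 0 - 1) := div_nonneg (hwt.w_pos _).le (hwt.b_pos _).le
  rw [← ENNReal.toReal_sum fun i _ => wNormSq_sub_ne_top ψ hwt.w_pos
    (wNormSq_gramProj_ne_top hwt _ _) (wNormSq_gramProj_ne_top hwt _ _)]
  refine ENNReal.toReal_le_of_le_ofReal (by positivity) ?_
  have h := sum_wNormSq_gramPart_le_bias ψ hd hT hwt
    (s := fun i : Fin t => Finset.Ico (κ i) (κ (i + 1)))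
    (by
      intro i j hij
      rw [Finset.disjoint_left]
      intro a ha ha'
      rw [Finset.mem_Ico] at ha ha'
      rcases lt_or_gt_of_ne (fun h => hij (Fin.ext h)) with h | h
      · have := hκ (Nat.succ_le_of_lt h)
        simp only [Nat.succ_eq_add_one] at this
        omega
      · have := hκ (Nat.succ_le_of_lt h)
        simp only [Nat.succ_eq_add_one] at this
        omega) h0
    (fun i j hj => (hκ (Nat.zero_le _)).trans (Finset.mem_Ico.1 hj).1) β
  rw [Finset.sum_range]
  simp_rw [gramProj_sub_gramProj T ψ (hκ (Nat.le_succ _)) β]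
  refine h.trans ?_
  rw [ENNReal.ofReal_mul (q := r) (by positivity)]
  exact mul_le_mul' le_rfl hβ

include hd hT hwt in
theorem toReal_wNormSq_sub_gramProj_le {r : ℝ} (hr : 0 ≤ r)
    (hβ : wNormSq ψ b β ≤ ENNReal.ofReal r) {a m : ℕ} (ha : 1 ≤ a) (ham : a ≤ m) :
    (wNormSq ψ w (β - gramProj T ψ m β)).toReal
      ≤ 4 * (d ^ 6 * (w (a - 1) / b (a - 1)) * r) := by
  have hρ : 0 ≤ w (a - 1) / b (a - 1) := div_nonneg (hwt.w_pos _).le (hwt.b_pos _).le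
  refine ENNReal.toReal_le_of_le_ofReal (by positivity) ?_
  refine (wNormSq_sub_gramProj_le_bias ψ hd hT hwt (ha.trans ham) β).trans ?_
  rw [show 4 * (d ^ 6 * (w (a - 1) / b (a - 1)) * r)
    = (4 * d ^ 6 * (w (a - 1) / b (a - 1))) * r by ring,
    ENNReal.ofReal_mul (q := r) (by positivity)]
  refine mul_le_mul' (ENNReal.ofReal_le_ofReal ?_) hβ
  have := hwt.w_div_b_antitone (show a - 1 ≤ m - 1 by omega)
  simp only at this
  gcongr

/-- The excess of the fluctuations over the penalty. -/
noncomputable def noiseExcess (ψ : HilbertBasis ℕ ℝ H) (w : ℕ → ℝ) (x : Fin n → H) (E : ℝ) (K : ℕ)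
    (Θ : ℝ≥0∞) : ℝ :=
  128 * (bigDelta w (covHat ψ x) K * E * (n : ℝ)⁻¹) *
    max 0 (Real.log Θ.toReal - 21 / 4 * (K * logRatio (bigDelta w (covHat ψ x) K) K))

variable (hn : 1 ≤ n) (hn2 : 2 * d ≤ n) (hE : 0 ≤ E)

-- Splitting `log Θ` at `21 / 4 · K L`, with `L` the logarithmic factor at `K`: since `64 · 21 / 4 =
-- 336 = 1344 / 4`, the part below is a quarter of the penalty, and the part above is the excess.
include hG hd hT hwt hn hn2 hE in
theorem fluctuation_le_penHat {K : ℕ} (hK : 1 ≤ K) (hKM : K ≤ dimHat ψ w x) (Θ : ℝ≥0∞) :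
    bigDelta w (covHat ψ x) K * ((n : ℝ)⁻¹ * (64 * Real.log Θ.toReal * E))
      ≤ 1 / 4 * penHat ψ w 96 x y K + 1 / 2 * noiseExcess ψ w x E K Θ := by
  have h1 := hG.le_penHat hd hT hwt hn hn2 hK hKM
  rw [smallDelta_eq] at h1
  have h2 : 0 ≤ bigDelta w (covHat ψ x) K * E * (n : ℝ)⁻¹ := by
    have := bigDelta_nonneg w (covHat ψ x) K
    positivity
  unfold noiseExcess
  set L := logRatio (bigDelta w (covHat ψ x) K) K
  have h3 := mul_le_mul_of_nonneg_left
    (le_max_right 0 (Real.log Θ.toReal - 21 / 4 * (K * L))) h2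
  nlinarith

-- The factor `Δ` at the final dimension `K` converts every increment of the chain to the weighted
-- norm, so the joint bound for the columns applies.
include hG hd hT hwt in
theorem sum_wNormSq_fluctuation_le {K : ℕ} (hKM : K ≤ dimCap w n) {Θ : ℝ≥0∞} (hΘ : Θ ≠ ⊤)
    (hcol : HasColumns ψ T β x y E K Θ) {κ : ℕ → ℕ} (hκ : Monotone κ) (hκK : ∀ i, κ i ≤ K)
    (hinv : ∀ i, invNorm (covHat ψ x (κ i)) ≤ n) (t : ℕ) :
    ∑ i ∈ Finset.range t, (wNormSq ψ w ((betaHat ψ x y (κ (i + 1)) - gramProj T ψ (κ (i + 1)) β)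
        - (betaHat ψ x y (κ i) - gramProj T ψ (κ i) β))).toReal
      ≤ bigDelta w (covHat ψ x) K * ((n : ℝ)⁻¹ * (64 * Real.log Θ.toReal * E)) := by
  obtain ⟨ξ, τ, rfl, hτ, hcol⟩ := hcol
  have hspan : ∀ k, betaHat ψ x y k - gramProj T ψ k β ∈ Submodule.span ℝ (ψ '' Set.Iio k) :=
    fun k => Submodule.sub_mem _ (betaHat_mem_span ψ x y k) (gramProj_mem_span ψ k β)
  have h1 : ∀ i, (wNormSq ψ w ((betaHat ψ x y (κ (i + 1)) - gramProj T ψ (κ (i + 1)) β)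
        - (betaHat ψ x y (κ i) - gramProj T ψ (κ i) β))).toReal
      ≤ bigDelta w (covHat ψ x) K * ((n : ℝ)⁻¹ *
        ‖colError ξ (K + 1) τ (κ (i + 1)) - colError ξ (K + 1) τ (κ i)‖ ^ 2) := fun i => by
    rw [← hcol _ (hκK _) (hinv _), ← hcol _ (hκK _) (hinv _), ← map_sub]
    exact toReal_wNormSq_le_bigDelta hwt.l_pos hwt.w_pos (by positivity) (hκK (i + 1))
      (hG.isSandwiched hwt.l_pos hwt.l_summable hd hT ((hκK _).trans hKM))
      (Submodule.sub_mem _ (hspan _)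
        (Submodule.span_mono (Set.image_mono (Set.Iio_subset_Iio (hκ (Nat.le_succ i)))) (hspan _)))
  refine (Finset.sum_le_sum fun i _ => h1 i).trans ?_
  rw [← Finset.mul_sum, ← Finset.mul_sum]
  have h2 := sum_norm_sq_colError_sub_le ξ hΘ τ hκ (fun i => (hκK i).trans (Nat.le_succ K)) t
  rw [hτ] at h2
  have := bigDelta_nonneg w (covHat ψ x) K
  gcongr

include hG hd hT hwt in
theorem wNormSq_fluctuation_le {K : ℕ} (hKM : K ≤ dimCap w n) {Θ : ℝ≥0∞} (hΘ : Θ ≠ ⊤)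
    (hcol : HasColumns ψ T β x y E K Θ) {k : ℕ} (hkK : k ≤ K)
    (hinv : invNorm (covHat ψ x k) ≤ n) :
    (wNormSq ψ w (betaHat ψ x y k - gramProj T ψ k β)).toReal
      ≤ bigDelta w (covHat ψ x) K * ((n : ℝ)⁻¹ * (64 * Real.log Θ.toReal * E)) := by
  obtain ⟨ξ, τ, rfl, hτ, hcol⟩ := hcol
  have h1 := toReal_wNormSq_le_bigDelta hwt.l_pos hwt.w_pos (by positivity) hkK
      (hG.isSandwiched hwt.l_pos hwt.l_summable hd hT (hkK.trans hKM))
      (Submodule.sub_mem _ (betaHat_mem_span ψ x y k) (gramProj_mem_span (T := T) ψ k β))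
  rw [hcol _ hkK hinv] at h1
  refine h1.trans ?_
  have h2 := norm_sq_colError_le ξ hΘ τ (hkK.trans (Nat.le_succ K))
  rw [hτ] at h2
  have := bigDelta_nonneg w (covHat ψ x) K
  gcongr

include hG hd hT hwt hn hn2 hE in
/-- The error of the adaptive estimator on a good sample. -/
theorem exists_wNormSq_adaptiveEstimator_sub_le {r : ℝ} (hr : 0 ≤ r)
    (hβ : wNormSq ψ b β ≤ ENNReal.ofReal r) {Θ : ℕ → ℝ≥0∞}
    (hΘ : ∀ K, 1 ≤ K → K ≤ dimCap w n → Θ K ≠ ⊤)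
    (hcol : ∀ K, 1 ≤ K → K ≤ dimCap w n → HasColumns ψ T β x y E K (Θ K)) {a : ℕ} (ha : 1 ≤ a)
    (haM : a ≤ dimHat ψ w x) :
    ∃ K, 1 ≤ K ∧ K ≤ dimCap w n ∧
      (wNormSq ψ w (adaptiveEstimator ψ w 96 x y - β)).toReal
        ≤ 3 * penHat ψ w 96 x y a + 16 * (d ^ 6 * (w (a - 1) / b (a - 1)) * r)
          + 2 * noiseExcess ψ w x E K (Θ K) := by
  set N : H → ℝ := fun h => (wNormSq ψ w h).toReal with hN
  set bh := betaHat ψ x y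
  set bp := fun k => gramProj T ψ k β
  set pen := penHat ψ w 96 x y
  set B := d ^ 6 * (w (a - 1) / b (a - 1)) * r with hB
  have hB0 : 0 ≤ B := by
    have : 0 ≤ w (a - 1) / b (a - 1) := div_nonneg (hwt.w_pos _).le (hwt.b_pos _).le
    positivity
  have hcap : dimHat ψ w x ≤ dimCap w n := (dimBound_mem hwt.w_first hn _).2
  have fbh : ∀ k, wNormSq ψ w (bh k) ≠ ⊤ := wNormSq_betaHat_ne_top hwt
  have fbp : ∀ k, wNormSq ψ w (bp k) ≠ ⊤ := fun k => wNormSq_gramProj_ne_top hwt k β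
  have fβ : wNormSq ψ w β ≠ ⊤ := ne_top_of_le_ne_top ENNReal.ofReal_ne_top
    ((wNormSq_le_of_weight_le ψ hwt.w_le_b β).trans hβ)
  have fsub : ∀ {f g : H}, wNormSq ψ w f ≠ ⊤ → wNormSq ψ w g ≠ ⊤ → wNormSq ψ w (f - g) ≠ ⊤ :=
    fun hf hg => wNormSq_sub_ne_top ψ hwt.w_pos hf hg
  have tri : ∀ {f g : H}, wNormSq ψ w f ≠ ⊤ → wNormSq ψ w g ≠ ⊤ →
      N (f + g) ≤ 2 * N f + 2 * N g := fun hf hg => toReal_wNormSq_add_le ψ hwt.w_pos hf hg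
  have Nneg : ∀ f g : H, N (f - g) = N (g - f) := fun f g => by
    simp only [hN]
    rw [← wNormSq_neg, neg_sub]
  obtain ⟨hm1, hmM, hle, hstep⟩ := mHat_spec ψ (w := w) 96 x y (ha.trans haM)
  set m := mHat ψ w 96 x y
  change ∃ K, 1 ≤ K ∧ K ≤ dimCap w n ∧ N (bh m - β) ≤ _
  have hinv : ∀ k, 1 ≤ k → k ≤ dimHat ψ w x → invNorm (covHat ψ x k) ≤ n := fun k h1 h2 =>
    hG.invNorm_le_of_le_dimHat hd hT hwt hn hn2 h1 h2
  have hbias : ∀ k, a ≤ k → N (bp k - β) ≤ 4 * B := fun k hk => by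
    rw [Nneg]
    exact toReal_wNormSq_sub_gramProj_le hd hT hwt hr hβ ha hk
  have hexc0 : ∀ K, 0 ≤ noiseExcess ψ w x E K (Θ K) := fun K => by
    have := bigDelta_nonneg w (covHat ψ x) K
    unfold noiseExcess
    have h2 := le_max_left 0
      (Real.log (Θ K).toReal - 21 / 4 * (K * logRatio (bigDelta w (covHat ψ x) K) K))
    positivity
  have hpen0 : ∀ k, 1 ≤ k → k ≤ dimHat ψ w x → 0 ≤ pen k := fun k h1 h2 =>
    hG.penHat_nonneg hd hT hwt hn hE hn2 h1 h2
  -- If `m̂ ≤ a`, the path from `β̂_m̂` to `β` goes through `β̂_a`.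
  rcases le_or_gt m a with hma | hma
  · refine ⟨a, ha, haM.trans hcap, ?_⟩
    have h1 := hle a hma haM
    change N (bh a - bh m) + pen m ≤ pen a at h1
    have h2 := wNormSq_fluctuation_le hG hd hT hwt (haM.trans hcap) (hΘ a ha (haM.trans hcap))
      (hcol a ha (haM.trans hcap)) le_rfl (hinv a ha haM)
    have h3 := fluctuation_le_penHat hG hd hT hwt hn hn2 hE ha haM (Θ a)
    have h4 := tri (fsub (fbh m) (fbh a)) (fsub (fbh a) fβ)
    have h5 := tri (fsub (fbh a) (fbp a)) (fsub (fbp a) fβ)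
    rw [sub_add_sub_cancel] at h4 h5
    have h6 := hbias a le_rfl
    have h7 := hpen0 m hm1 hmM
    rw [Nneg (bh m) (bh a)] at h4
    change N (bh a - bp a) ≤ _ at h2
    have h8 := hpen0 a ha haM
    change _ ≤ 1 / 4 * pen a + _ at h3
    have h9 := hexc0 a
    linarith
  -- If `m̂ > a`, splitting the increments of the chain into fluctuation and bias bounds its penalty
  -- at `K` by the one at `a`, plus half of itself, plus the excess and twice the bias. The half is
  -- absorbed. The penalty at `K` then controls the fluctuation at `m̂ ≤ K`.
  · obtain ⟨κ, hκ, hκ0, htK, hKM, hκK, hchain⟩ := exists_chain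
      (q := fun m k => N (bh k - bh m)) (pen := pen) (a := a) (t := m) (M := dimHat ψ w x)
      (fun _ => ENNReal.toReal_nonneg) haM (fun k hk hkm => hstep k (ha.trans hk) hkm)
    set K := κ m
    have hκa : ∀ i, a ≤ κ i := fun i => hκ0 ▸ hκ (Nat.zero_le i)
    have hK1 : 1 ≤ K := ha.trans (hκa m)
    refine ⟨K, hK1, hKM.trans hcap, ?_⟩
    have h1 := sum_wNormSq_fluctuation_le hG hd hT hwt (hKM.trans hcap)
      (hΘ K hK1 (hKM.trans hcap)) (hcol K hK1 (hKM.trans hcap)) hκ hκK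
      (fun i => hinv _ (ha.trans (hκa i)) ((hκK i).trans hKM)) m
    have h2 := sum_toReal_wNormSq_gramProj_sub_le hd hT hwt hr hβ hκ (by omega) m
    rw [hκ0] at h2
    have h3 := fluctuation_le_penHat hG hd hT hwt hn hn2 hE hK1 hKM (Θ K)
    have h4 : ∑ i ∈ Finset.range m, N (bh (κ (i + 1)) - bh (κ i))
        ≤ 2 * ∑ i ∈ Finset.range m, N ((bh (κ (i + 1)) - bp (κ (i + 1))) - (bh (κ i) - bp (κ i)))
          + 2 * ∑ i ∈ Finset.range m, N (bp (κ (i + 1)) - bp (κ i)) := by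
      rw [Finset.mul_sum, Finset.mul_sum, ← Finset.sum_add_distrib]
      refine Finset.sum_le_sum fun i _ => ?_
      have h5 := tri (fsub (fsub (fbh (κ (i + 1))) (fbp (κ (i + 1)))) (fsub (fbh (κ i)) (fbp (κ i))))
        (fsub (fbp (κ (i + 1))) (fbp (κ i)))
      rw [show bh (κ (i + 1)) - bp (κ (i + 1)) - (bh (κ i) - bp (κ i))
        + (bp (κ (i + 1)) - bp (κ i)) = bh (κ (i + 1)) - bh (κ i) by abel] at h5
      exact h5
    have h5 := wNormSq_fluctuation_le hG hd hT hwt (hKM.trans hcap)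
      (hΘ K hK1 (hKM.trans hcap)) (hcol K hK1 (hKM.trans hcap)) htK (hinv m hm1 hmM)
    have h6 := tri (fsub (fbh m) (fbp m)) (fsub (fbp m) fβ)
    rw [sub_add_sub_cancel] at h6
    have h7 := hbias m hma.le
    change N (bh m - bp m) ≤ _ at h5
    change _ ≤ 1 / 4 * pen K + _ at h3
    change ∑ i ∈ Finset.range m, N ((bh (κ (i + 1)) - bp (κ (i + 1))) - (bh (κ i) - bp (κ i)))
      ≤ _ at h1
    change ∑ i ∈ Finset.range m, N (bp (κ (i + 1)) - bp (κ i)) ≤ B at h2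
    have h8 := hpen0 a ha haM
    have h9 := hexc0 K
    linarith

end ErrorBound

/-! ### Properties of the Gaussian sample -/

section SampleProperties

variable {H : Type*} [NormedAddCommGroup H] [InnerProductSpace ℝ H]
  {ψ : HilbertBasis ℕ ℝ H} {n : ℕ} {T : H →L[ℝ] H}
  (hsym : ∀ x y, inner ℝ (T x) y = inner ℝ x (T y))
  (hpos : ∀ x, x ≠ 0 → 0 < inner ℝ (T x) x) {σ : ℝ} (hσ : 0 < σ) (β : H)
include hsym hpos hσ

theorem isGoodSample_of_notMem_gramDev {M : ℕ} {z : Fin n → H × ℝ}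
    (hz : z ∉ gramDev n fun j => whitened ψ T σ β M j) :
    IsGoodSample ψ T M (σ ^ 2 + inner ℝ (T β) β) (fun i => (z i).1)
      (fun i => inner ℝ β (z i).1 + σ * (z i).2) := by
  have hspan : ∀ h ∈ Submodule.span ℝ (ψ '' Set.Iio M),
      |(n : ℝ)⁻¹ * ‖sampleMap (fun i => (z i).1) h‖ ^ 2 - inner ℝ (T h) h|
        ≤ 1 / 2 * inner ℝ (T h) h := by
    intro h hh
    have h1 := abs_sum_sq_sub_le_of_notMem_gramDev hz
      fun j : Fin (M + 1) => if (j : ℕ) < M then inner ℝ (T h) (gramVec T ψ j) else 0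
    have h2 : ∀ k, ∑ j : Fin (M + 1), (if (j : ℕ) < M then inner ℝ (T h) (gramVec T ψ j) else 0)
        * whitened ψ T σ β M j (z k) = inner ℝ h (z k).1 := by
      intro k
      rw [Fin.sum_univ_castSucc]
      conv_rhs => rw [← gramProj_of_mem_span hsym hpos ψ hh, gramProj, gramPart, sum_inner,
        Finset.sum_range]
      simp [whitened, real_inner_smul_left]
    have h3 : ∑ j : Fin (M + 1),
        (if (j : ℕ) < M then inner ℝ (T h) (gramVec T ψ j) else 0) ^ 2 = inner ℝ (T h) h := by
      rw [Fin.sum_univ_castSucc]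
      conv_rhs => rw [← gramProj_of_mem_span hsym hpos ψ hh, gramProj,
        gram_gramPart hsym hpos ψ, Finset.sum_range]
      simp
    simp_rw [h2] at h1
    rw [h3] at h1
    rw [EuclideanSpace.real_norm_sq_eq]
    exact h1
  have hy : |(n : ℝ)⁻¹ * ∑ i, (inner ℝ β (z i).1 + σ * (z i).2) ^ 2
      - (σ ^ 2 + inner ℝ (T β) β)| ≤ 1 / 2 * (σ ^ 2 + inner ℝ (T β) β) := by
    have h1 := abs_sum_sq_sub_le_of_notMem_gramDev hz
      fun j : Fin (M + 1) => respCoef ψ T σ β M j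
    simp_rw [sum_respCoef_whitened hpos hσ] at h1
    rwa [← Finset.sum_range fun j => respCoef ψ T σ β M j ^ 2,
      sum_sq_respCoef hsym hpos hσ] at h1
  refine ⟨fun h hh => ?_, fun h hh => ?_, ?_, ?_⟩
  · have := abs_le.1 (hspan h hh); linarith
  · have := abs_le.1 (hspan h hh); linarith
  · have := abs_le.1 hy; linarith
  · have := abs_le.1 hy; linarith

theorem hasColumns_whitened (K : ℕ) (z : Fin n → H × ℝ) :
    HasColumns ψ T β (fun i => (z i).1) (fun i => inner ℝ β (z i).1 + σ * (z i).2)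
      (σ ^ 2 + inner ℝ (T β) β) K
      (smoothMax (extZero (sampleCols (fun j => whitened ψ T σ β K j) z)) (K + 1)) := by
  have hξ : ∀ j < K, extZero (sampleCols (fun j => whitened ψ T σ β K j) z) j
      = sampleMap (fun i => (z i).1) (gramVec T ψ j) := by
    intro j hj
    rw [extZero_of_lt _ (by omega)]
    ext i
    simp [sampleCols, whitened, hj]
  refine ⟨_, respCoef ψ T σ β K, rfl, sum_sq_respCoef hsym hpos hσ β K, fun k hk hinv => ?_⟩
  refine sampleMap_betaHat_sub ψ hsym hpos _ _ hk hξ hinv ?_ β fun j hj => if_pos hj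
  rw [Finset.sum_range]
  ext i
  simp_rw [extZero_of_lt _ (Fin.is_lt _)]
  simp [sampleCols, sum_respCoef_whitened hpos hσ β K (z i)]

end SampleProperties

/-! ### Probability of bad samples and size of the excess -/

section Estimates

theorem exp_neg_le_factorial_div {u : ℝ} (hu : 0 < u) (k : ℕ) :
    Real.exp (-u) ≤ k.factorial / u ^ k := by
  rw [Real.exp_neg, inv_le_comm₀ (Real.exp_pos u) (by positivity), inv_div]
  exact Real.pow_div_factorial_le_exp u hu.le k

/-- From `M⁴ ≤ n` follows `(M + 1)² ≤ 4 √n`, so the exponent is at most `-√n / 128`. Of the thirteen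
powers of `√n` gained from the exponential, one pays for the prefactor and twelve give `n⁻⁶`. -/
theorem gramDev_bound_le {M n : ℕ} (hM : 1 ≤ M) (hMn : (M : ℝ) ^ 4 ≤ n) :
    ((M + 1 : ℕ) : ℝ) ^ 2 * (4 * Real.exp (-(n / (32 * ((M + 1 : ℕ) : ℝ) ^ 2))))
      ≤ 16 * (Nat.factorial 13) * 128 ^ 13 * ((n : ℝ) ^ 6)⁻¹ := by
  have hM' : (1 : ℝ) ≤ M := by exact_mod_cast hM
  have hn : (1 : ℝ) ≤ n := (one_le_pow₀ hM').trans hMn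
  set s := √(n : ℝ) with hs
  have hs2 : s ^ 2 = n := Real.sq_sqrt (by linarith)
  have hs0 : 0 < s := Real.sqrt_pos.2 (by linarith)
  have hMs : (M : ℝ) ^ 2 ≤ s := by
    refine Real.le_sqrt_of_sq_le ?_
    rw [← pow_mul]; exact hMn
  have hp : ((M + 1 : ℕ) : ℝ) ^ 2 ≤ 4 * s := by
    push_cast
    nlinarith
  have hp0 : (0 : ℝ) < ((M + 1 : ℕ) : ℝ) ^ 2 := by positivity
  have h1 : s / 128 ≤ n / (32 * ((M + 1 : ℕ) : ℝ) ^ 2) := by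
    rw [div_le_div_iff₀ (by norm_num) (by positivity), ← hs2]
    nlinarith
  have h2 : Real.exp (-(n / (32 * ((M + 1 : ℕ) : ℝ) ^ 2))) ≤ Real.exp (-(s / 128)) :=
    Real.exp_le_exp.2 (by linarith)
  have h3 := exp_neg_le_factorial_div (show 0 < s / 128 by positivity) 13
  calc ((M + 1 : ℕ) : ℝ) ^ 2 * (4 * Real.exp (-(n / (32 * ((M + 1 : ℕ) : ℝ) ^ 2))))
      ≤ 4 * s * (4 * ((Nat.factorial 13) / (s / 128) ^ 13)) := by
        gcongr
        exact h2.trans h3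
    _ = 16 * (Nat.factorial 13) * 128 ^ 13 * ((n : ℝ) ^ 6)⁻¹ := by
        rw [← hs2]
        generalize ((Nat.factorial 13 : ℕ) : ℝ) = c
        field_simp
        norm_num
        ring

/-- The summand in the second condition on the constant `Σ`. -/
noncomputable def sigmaTerm (w l : ℕ → ℝ) (d : ℝ) (m : ℕ) : ℝ :=
  bigDeltaOf w l m * Real.exp (-(m * Real.log (max (bigDeltaOf w l m) (m + 2)) /
        (16 * (1 + Real.log d) * Real.log (m + 2))))

theorem sigmaTerm_eq (w l : ℕ → ℝ) (d : ℝ) (m : ℕ) :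
    sigmaTerm w l d m = bigDeltaOf w l m *
      Real.exp (-(m * logRatio (bigDeltaOf w l m) m / (16 * (1 + Real.log d)))) := by
  unfold sigmaTerm logRatio
  congr 3
  rw [← mul_div_assoc, div_div, mul_comm (Real.log _) (16 * _)]

theorem sigmaTerm_nonneg (w l : ℕ → ℝ) (d : ℝ) (m : ℕ) : 0 ≤ sigmaTerm w l d m :=
  mul_nonneg (bigDelta_nonneg _ _ _) (Real.exp_pos _).le

theorem sum_sigmaTerm_le {w l : ℕ → ℝ} {d S : ℝ} (hS : IsSigma w l d S) (M : ℕ) :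
    ∑ K ∈ Finset.Icc 1 M, ENNReal.ofReal (sigmaTerm w l d K) ≤ ENNReal.ofReal S := by
  refine le_trans ?_ hS.2
  rw [show Finset.Icc 1 M = Finset.Ico 1 (M + 1) from rfl, Finset.sum_Ico_eq_sum_range]
  simp_rw [add_comm 1]
  exact ENNReal.sum_le_tsum _

/-- Since `2 √2 ≤ 3 ≤ e²`, a reserve of `2 K` in the exponent pays for the exponential growth of the
mean of `smoothMax`. -/
theorem exp_mul_pow_le (K : ℕ) : Real.exp (-(2 * K)) * (2 * √2) ^ (K + 1) ≤ 3 := by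
  have h2 : 2 * √2 ≤ 3 := by
    have := Real.sqrt_le_sqrt (show (2 : ℝ) ≤ (3 / 2) ^ 2 by norm_num)
    rw [Real.sqrt_sq (by norm_num)] at this
    linarith
  have h3 : (3 : ℝ) ≤ Real.exp 2 := by
    have := Real.add_one_le_exp (2 : ℝ)
    linarith
  have h4 : Real.exp (-(2 * K)) = (Real.exp 2 ^ K)⁻¹ := by
    rw [Real.exp_neg, ← Real.exp_nat_mul, mul_comm]
  rw [h4, pow_succ, ← mul_assoc, ← one_mul (3 : ℝ)]
  refine mul_le_mul ?_ h2 (by positivity) zero_le_one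
  rw [inv_mul_le_iff₀ (by positivity), mul_one]
  exact pow_le_pow_left₀ (by positivity) (h2.trans h3) K

variable {H : Type*} [NormedAddCommGroup H] [InnerProductSpace ℝ H] [CompleteSpace H]
  {ψ : HilbertBasis ℕ ℝ H} {n : ℕ} {w b l : ℕ → ℝ} {T : H →L[ℝ] H} {d E : ℝ}
  {x : Fin n → H} {y : Fin n → ℝ}

/-- The positive part of `log Θ - 21 / 4 · K L` is at most `Θ exp (-21 / 4 · K L)`, which is linear
in `Θ` and hence integrable. Of the exponent, `K L / 8` covers the exponential in the term of `Σ`,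
and `2 K ≤ 2 K L` is kept for the mean of `Θ`. -/
theorem noiseExcess_le (hG : IsGoodSample ψ T (dimCap w n) E x y) (hd : 1 ≤ d)
    (hT : T ∈ opClass ψ l d) (hwt : WeightAssumption w b l) (hE : 0 ≤ E) {K : ℕ} (hK : 1 ≤ K)
    (hKM : K ≤ dimCap w n) {Θ : ℝ≥0∞} (hΘ : 1 ≤ Θ) (hΘt : Θ ≠ ⊤) :
    noiseExcess ψ w x E K Θ
      ≤ 256 * d * E * (n : ℝ)⁻¹ * (sigmaTerm w l d K * Real.exp (-(2 * K))) * Θ.toReal := by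
  have hD : bigDelta w (covHat ψ x) K ≤ 2 * d * bigDeltaOf w l K := by
    have := bigDelta_le_bigDeltaOf hwt.l_pos hwt.w_pos (α := 1 / (2 * d)) (by positivity)
      (fun k hk => hG.isSandwiched hwt.l_pos hwt.l_summable hd hT (hk.trans hKM))
    rwa [one_div, div_inv_eq_mul, mul_comm] at this
  have hL := hG.logRatio_ge hd hT hwt hK hKM
  have hL1 := one_le_logRatio (bigDelta w (covHat ψ x) K) hK
  have hΘ0 : 0 < Θ.toReal := ENNReal.toReal_pos (zero_lt_one.trans_le hΘ).ne' hΘt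
  have hΘ1 : 1 ≤ Θ.toReal := by
    rw [← ENNReal.toReal_one]
    exact ENNReal.toReal_mono hΘt hΘ
  have hlog : 0 ≤ Real.log d := Real.log_nonneg hd
  rw [sigmaTerm_eq]
  unfold noiseExcess
  generalize logRatio (bigDelta w (covHat ψ x) K) K = L at hL hL1 ⊢
  have hD0 := bigDelta_nonneg w (covHat ψ x) K
  generalize bigDelta w (covHat ψ x) K = D at hD hD0 ⊢
  generalize logRatio (bigDeltaOf w l K) K = L' at hL ⊢
  have hD0' : 0 ≤ bigDeltaOf w l K := bigDelta_nonneg _ _ _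
  generalize bigDeltaOf w l K = D' at hD hD0' ⊢
  have hK' : (1 : ℝ) ≤ K := by exact_mod_cast hK
  have h1 : L' / (16 * (1 + Real.log d)) ≤ 1 / 8 * L := by
    rw [div_le_iff₀ (by positivity)]
    linarith
  have h2 : max 0 (Real.log Θ.toReal - 21 / 4 * (K * L))
      ≤ Θ.toReal * (Real.exp (-(K * L' / (16 * (1 + Real.log d)))) * Real.exp (-(2 * K))) := by
    have h3 : max 0 (Real.log Θ.toReal - 21 / 4 * (K * L))
        ≤ Real.exp (Real.log Θ.toReal - 21 / 4 * (K * L)) := by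
      refine max_le (Real.exp_pos _).le ?_
      have := Real.add_one_le_exp (Real.log Θ.toReal - 21 / 4 * (K * L))
      linarith
    refine h3.trans ?_
    rw [sub_eq_add_neg, Real.exp_add, Real.exp_log hΘ0, ← Real.exp_add]
    refine mul_le_mul_of_nonneg_left (Real.exp_le_exp.2 ?_) hΘ0.le
    rw [mul_div_assoc]
    have h4 := mul_le_mul_of_nonneg_left h1 (zero_le_one.trans hK')
    have h5 : (K : ℝ) ≤ K * L := le_mul_of_one_le_right (by linarith) hL1
    linarith
  calc 128 * (D * E * (n : ℝ)⁻¹) * max 0 (Real.log Θ.toReal - 21 / 4 * (K * L))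
      ≤ 128 * ((2 * d * D') * E * (n : ℝ)⁻¹) * (Θ.toReal *
        (Real.exp (-(K * L' / (16 * (1 + Real.log d)))) * Real.exp (-(2 * K)))) := by
        gcongr
    _ = _ := by ring

end Estimates

/-! ### Moments of the response -/

section Moments

variable {H : Type*} [NormedAddCommGroup H] [InnerProductSpace ℝ H] [CompleteSpace H]
  [SecondCountableTopology H] [MeasurableSpace H] [BorelSpace H]
  {ρ : Measure (H × ℝ)} {T : H →L[ℝ] H} (hρ : IsGaussianDesign ρ T)
include hρ

omit [CompleteSpace H] in
theorem map_designFun_eq {h : H} {c : ℝ} (h1 : inner ℝ (T h) h + c * c = 1) :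
    ρ.map (designFun h c) = gaussianReal 0 1 := by
  have := hρ.gaussian
  rw [IsGaussian.map_eq_gaussianReal, hρ.integral_designFun,
    variance_of_integral_eq_zero (by fun_prop) (hρ.integral_designFun h c)]
  have h2 := hρ.integral_designFun_mul h h c c
  simp_rw [← sq] at h2
  rw [h2, sq, h1, Real.toNNReal_one]

omit [CompleteSpace H] in
theorem lintegral_response {σ : ℝ} (β : H) (hE : 0 < σ ^ 2 + inner ℝ (T β) β) (n : ℕ) :
    ∫⁻ z, ENNReal.ofReal ((∑ i, (inner ℝ β (z i).1 + σ * (z i).2) ^ 2) ^ 2)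
        ∂(Measure.pi fun _ : Fin n => ρ)
      ≤ ENNReal.ofReal (64 * n ^ 2 * (σ ^ 2 + inner ℝ (T β) β) ^ 2) ∧
    ∫⁻ z, ENNReal.ofReal (∑ i, (inner ℝ β (z i).1 + σ * (z i).2) ^ 2)
        ∂(Measure.pi fun _ : Fin n => ρ)
      ≤ ENNReal.ofReal (8 * n * (σ ^ 2 + inner ℝ (T β) β)) := by
  have := hρ.gaussian
  set E := σ ^ 2 + inner ℝ (T β) β with hEdef
  set s := √E with hs
  have hs2 : s ^ 2 = E := Real.sq_sqrt hE.le
  have hs0 : s ≠ 0 := (Real.sqrt_pos.2 hE).ne'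
  set f := designFun (s⁻¹ • β) (s⁻¹ * σ) with hf
  have hmap : ρ.map f = gaussianReal 0 1 := by
    refine map_designFun_eq hρ ?_
    rw [map_smul, real_inner_smul_left, real_inner_smul_right]
    field_simp
    rw [hs2]
    linarith
  have hfm : Measurable f := f.continuous.measurable
  have h1 : ∀ z : Fin n → H × ℝ, ∑ i, (inner ℝ β (z i).1 + σ * (z i).2) ^ 2
      = E * ∑ i, f (z i) ^ 2 := fun z => by
    rw [← hs2, Finset.mul_sum]
    refine Finset.sum_congr rfl fun i _ => ?_
    rw [hf, designFun_apply, real_inner_smul_left]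
    field_simp
  have hm : Measurable fun z : Fin n → H × ℝ => ∑ i, f (z i) ^ 2 := by fun_prop
  simp_rw [h1, mul_pow]
  constructor
  · simp_rw [ENNReal.ofReal_mul (sq_nonneg E)]
    rw [lintegral_const_mul _ (by fun_prop), mul_comm (64 * (n : ℝ) ^ 2),
      ENNReal.ofReal_mul (sq_nonneg E)]
    exact mul_le_mul' le_rfl (lintegral_sq_sum_sq_le hfm hmap n)
  · simp_rw [ENNReal.ofReal_mul hE.le]
    rw [lintegral_const_mul _ (by fun_prop), mul_comm (8 * (n : ℝ)), ENNReal.ofReal_mul hE.le]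
    exact mul_le_mul' le_rfl (lintegral_sum_sq_le hfm hmap n)

end Moments

/-! ### Pointwise error bounds -/

section PointwiseBounds

variable {H : Type*} [NormedAddCommGroup H] [InnerProductSpace ℝ H]
  {ψ : HilbertBasis ℕ ℝ H} {n : ℕ} {w b l : ℕ → ℝ} {T : H →L[ℝ] H} {d r σ : ℝ} {β : H}

theorem wNormSq_adaptiveEstimator_sub_le (hwt : WeightAssumption w b l) (hn : 1 ≤ n)
    (hβ : wNormSq ψ b β ≤ ENNReal.ofReal r) (x : Fin n → H) (y : Fin n → ℝ) :
    wNormSq ψ w (adaptiveEstimator ψ w 96 x y - β)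
      ≤ 2 * ENNReal.ofReal (n * ∑ i, y i ^ 2) + 2 * ENNReal.ofReal r := by
  refine (wNormSq_sub_le ψ (fun j => (hwt.w_pos j).le) _ _).trans ?_
  have hM := dimBound_mem hwt.w_first hn fun m => invNorm (covHat ψ x m)
  have hm := (mHat_spec ψ (w := w) 96 x y hM.1).2.1
  refine add_le_add (mul_le_mul' le_rfl ?_)
    (mul_le_mul' le_rfl ((wNormSq_le_of_weight_le ψ hwt.w_le_b β).trans hβ))
  exact wNormSq_betaHat_le ψ hwt.w_pos x y fun j hj =>
    weight_le_of_lt_dimCap hwt.w_first hn ((hj.trans_le hm).trans_le hM.2)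

variable [CompleteSpace H]

theorem inner_apply_self_le (hd : 1 ≤ d) (hT : T ∈ opClass ψ l d) (hwt : WeightAssumption w b l)
    (hr : 0 ≤ r) (hβ : wNormSq ψ b β ≤ ENNReal.ofReal r) : inner ℝ (T β) β ≤ d * r := by
  refine (opClass_inner_le ψ (fun j => (hwt.l_pos j).le) hwt.l_summable hd hT β).1.trans ?_
  refine mul_le_mul_of_nonneg_left ?_ (by linarith)
  rw [← ENNReal.ofReal_le_ofReal_iff hr,
    ofReal_inner_diagOp ψ (fun j => (hwt.l_pos j).le) hwt.l_summable]
  refine le_trans (wNormSq_le_of_weight_le ψ (fun j => ?_) β) hβ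
  have h1 := hwt.l_antitone (Nat.zero_le j)
  have h2 := hwt.b_inv_antitone (Nat.zero_le j)
  simp only [hwt.b_first, inv_one] at h2
  rw [hwt.l_first] at h1
  exact h1.trans ((inv_le_one₀ (hwt.b_pos j)).1 h2)

theorem sigmaTerm_pos (hwt : WeightAssumption w b l) {m : ℕ} (hm : 1 ≤ m) :
    0 < sigmaTerm w l d m := by
  have h := weight_le_bigDeltaOf hwt.l_pos hwt.w_pos (j := 0) (m := m) (by omega)
  rw [hwt.w_first, hwt.l_first, mul_one] at h
  exact mul_pos (by linarith) (Real.exp_pos _)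

/-- The dimension `K` that ends the chain is random; the sum over all possible `K` dominates its
excess and can be integrated term by term. -/
theorem wNormSq_adaptiveEstimator_sub_le_of_good {E : ℝ} {x : Fin n → H} {y : Fin n → ℝ}
    (hG : IsGoodSample ψ T (dimCap w n) E x y) (hd : 1 ≤ d) (hT : T ∈ opClass ψ l d)
    (hwt : WeightAssumption w b l) (hn : 1 ≤ n) (hn2 : 2 * d ≤ n) (hE : 0 < E) (hr : 0 ≤ r)
    (hβ : wNormSq ψ b β ≤ ENNReal.ofReal r) {Θ : ℕ → ℝ≥0∞} (hΘ1 : ∀ K, 1 ≤ Θ K)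
    (hcol : ∀ K, HasColumns ψ T β x y E K (Θ K)) :
    wNormSq ψ w (adaptiveEstimator ψ w 96 x y - β)
      ≤ ENNReal.ofReal ((48384 * d * (1 + Real.log (2 * d)) * E + 16 * d ^ 6 * r)
          * RDiamond w b l d n)
        + ∑ K ∈ Finset.Icc 1 (dimCap w n), ENNReal.ofReal
            (512 * d * E * (n : ℝ)⁻¹ * (sigmaTerm w l d K * Real.exp (-(2 * K)))) * Θ K := by
  have hn0 : (0 : ℝ) < n := by exact_mod_cast hn
  have hd0 : 0 < d := by linarith
  have hc : ∀ K, 1 ≤ K →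
      0 < 512 * d * E * (n : ℝ)⁻¹ * (sigmaTerm w l d K * Real.exp (-(2 * K))) := fun K hK => by
    have := sigmaTerm_pos (d := d) hwt hK
    have := Real.exp_pos (-(2 * (K : ℝ)))
    positivity
  by_cases hΘ : ∀ K, 1 ≤ K → K ≤ dimCap w n → Θ K ≠ ⊤
  · set a := mDiamond w b l d n with ha
    obtain ⟨ha1, haM, -⟩ := argminUpTo_mem (dimBound_mem hwt.w_first hn
      fun m => ENNReal.ofReal (16 * d ^ 3 * (l (m - 1))⁻¹)).1 (tradeOff w b l n)
    change 1 ≤ a at ha1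
    change a ≤ dimLower w l d n at haM
    have haM' := haM.trans (hG.dimLower_le hd hT hwt hn)
    obtain ⟨K, hK1, hKM, hle⟩ := exists_wNormSq_adaptiveEstimator_sub_le hG hd hT hwt hn hn2 hE.le
      hr hβ hΘ (fun K _ _ => hcol K) ha1 haM'
    have hpen := hG.penHat_le hd hT hwt hn hE.le hn2 ha1 haM'
    have hexc := noiseExcess_le hG hd hT hwt hE.le hK1 hKM (hΘ1 K) (hΘ K hK1 hKM)
    have hfin : wNormSq ψ w (adaptiveEstimator ψ w 96 x y - β) ≠ ⊤ :=
      ne_top_of_le_ne_top (ENNReal.add_ne_top.2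
        ⟨ENNReal.mul_ne_top (by norm_num) ENNReal.ofReal_ne_top,
          ENNReal.mul_ne_top (by norm_num) ENNReal.ofReal_ne_top⟩)
        (wNormSq_adaptiveEstimator_sub_le hwt hn hβ x y)
    have hR1 : w (a - 1) / b (a - 1) ≤ RDiamond w b l d n := le_max_left _ _
    have hR2 : smallDeltaOf w l a / n ≤ RDiamond w b l d n := le_max_right _ _
    have hR0 : 0 ≤ RDiamond w b l d n :=
      (div_nonneg (hwt.w_pos _).le (hwt.b_pos _).le).trans hR1
    have hlog : 0 ≤ Real.log (2 * d) := Real.log_nonneg (by linarith)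
    have h1 : 16128 * d * (1 + Real.log (2 * d)) * E * (smallDeltaOf w l a / n)
        ≤ 16128 * d * (1 + Real.log (2 * d)) * E * RDiamond w b l d n := by gcongr
    have h2 : d ^ 6 * (w (a - 1) / b (a - 1)) * r ≤ d ^ 6 * RDiamond w b l d n * r := by gcongr
    have hsum : ENNReal.ofReal
          (512 * d * E * (n : ℝ)⁻¹ * (sigmaTerm w l d K * Real.exp (-(2 * K)))) * Θ K
        ≤ ∑ K ∈ Finset.Icc 1 (dimCap w n), ENNReal.ofReal
            (512 * d * E * (n : ℝ)⁻¹ * (sigmaTerm w l d K * Real.exp (-(2 * K)))) * Θ K :=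
      Finset.single_le_sum (f := fun K : ℕ => ENNReal.ofReal
            (512 * d * E * (n : ℝ)⁻¹ * (sigmaTerm w l d K * Real.exp (-(2 * K)))) * Θ K)
        (fun _ _ => zero_le) (Finset.mem_Icc.2 ⟨hK1, hKM⟩)
    refine le_trans ?_ (add_le_add le_rfl hsum)
    rw [← ENNReal.ofReal_toReal (hΘ K hK1 hKM), ← ENNReal.ofReal_mul (hc K hK1).le,
      ← ENNReal.ofReal_add (by positivity)
        (mul_nonneg (hc K hK1).le ENNReal.toReal_nonneg), ← ENNReal.ofReal_toReal hfin]
    refine ENNReal.ofReal_le_ofReal (hle.trans ?_)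
    linarith
  -- If some `Θ K` is infinite, so is the right-hand side, because the coefficient of `Θ K` is
  -- strictly positive.
  · push Not at hΘ
    obtain ⟨K, hK1, hKM, hK⟩ := hΘ
    refine le_top.trans (le_of_eq (Eq.symm ?_))
    rw [ENNReal.add_eq_top]
    right
    rw [ENNReal.sum_eq_top]
    refine ⟨K, Finset.mem_Icc.2 ⟨hK1, hKM⟩, ?_⟩
    rw [hK, ENNReal.mul_top]
    exact (ENNReal.ofReal_pos.2 (hc K hK1)).ne'

end PointwiseBounds

/-! ### Integration of the error bounds -/

section RiskBound

variable {H : Type*} [NormedAddCommGroup H] [InnerProductSpace ℝ H] [CompleteSpace H]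
  [SecondCountableTopology H] [MeasurableSpace H] [BorelSpace H]
  {ψ : HilbertBasis ℕ ℝ H} {n : ℕ} {w b l : ℕ → ℝ} {T : H →L[ℝ] H} {d r σ S : ℝ} {β : H}
  {ρ : Measure (H × ℝ)}

theorem one_le_of_isSigma (hwt : WeightAssumption w b l) (hS : IsSigma w l d S) : 1 ≤ S := by
  have h := (ENNReal.le_tsum (f := fun j => ENNReal.ofReal (l j)) 0).trans hS.1
  rw [hwt.l_first, ENNReal.ofReal_one, ENNReal.one_le_ofReal] at h
  exact h

/-- When `n < 2 d`, the crude bound of order `n² E + r` is already of order `1 / n` with a constant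
depending on `d`. -/
theorem risk_le_of_lt (hd : 1 ≤ d) (hT : T ∈ opClass ψ l d) (hwt : WeightAssumption w b l)
    (hn : 1 ≤ n) (hn2 : (n : ℝ) < 2 * d) (hσ : 0 < σ) (hr : 0 ≤ r)
    (hβ : wNormSq ψ b β ≤ ENNReal.ofReal r) (hρ : IsGaussianDesign ρ T) :
    risk ψ w (fun X Y => adaptiveEstimator ψ w 96 X Y) σ β ρ (n := n)
      ≤ ENNReal.ofReal (132 * d ^ 4 * (σ ^ 2 + r) * (n : ℝ)⁻¹) := by
  have hn0 : (0 : ℝ) < n := by exact_mod_cast hn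
  have := hρ.gaussian
  have hTβ := inner_apply_self_le hd hT hwt hr hβ
  have hTβ0 := gram_nonneg hT.2.1 β
  set E := σ ^ 2 + inner ℝ (T β) β with hE
  have hE0 : 0 < E := by positivity
  have hEd : E ≤ d * (σ ^ 2 + r) := by nlinarith [sq_nonneg σ]
  have hmom := (lintegral_response hρ β hE0 n (σ := σ)).2
  unfold risk
  calc ∫⁻ z : Fin n → H × ℝ, wNormSq ψ w (adaptiveEstimator ψ w 96 (fun i => (z i).1)
        (fun i => inner ℝ β (z i).1 + σ * (z i).2) - β) ∂(Measure.pi fun _ => ρ)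
      ≤ ∫⁻ z : Fin n → H × ℝ, (ENNReal.ofReal (2 * n) * ENNReal.ofReal
          (∑ i, (inner ℝ β (z i).1 + σ * (z i).2) ^ 2) + ENNReal.ofReal (2 * r))
          ∂(Measure.pi fun _ => ρ) := by
        refine lintegral_mono fun z => (wNormSq_adaptiveEstimator_sub_le hwt hn hβ _ _).trans ?_
        rw [ENNReal.ofReal_mul hn0.le, ENNReal.ofReal_mul zero_le_two,
          ENNReal.ofReal_mul zero_le_two, ENNReal.ofReal_ofNat, mul_assoc]
    _ ≤ ENNReal.ofReal (2 * n) * ENNReal.ofReal (8 * n * E) + ENNReal.ofReal (2 * r) := by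
        rw [lintegral_add_right _ measurable_const, lintegral_const, measure_univ, mul_one,
          lintegral_const_mul' _ _ ENNReal.ofReal_ne_top]
        exact add_le_add (mul_le_mul' le_rfl hmom) le_rfl
    _ = ENNReal.ofReal (16 * n ^ 2 * E + 2 * r) := by
        rw [← ENNReal.ofReal_mul (by positivity), ← ENNReal.ofReal_add (by positivity)
          (by positivity)]
        congr 1
        ring
    _ ≤ _ := by
        refine ENNReal.ofReal_le_ofReal ?_
        rw [← div_eq_mul_inv, le_div_iff₀ hn0]
        have hd1 : 1 ≤ d ^ 3 := one_le_pow₀ hd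
        have hdd : d ≤ d ^ 4 := le_self_pow₀ hd (by norm_num)
        have h3 : (n : ℝ) ^ 3 ≤ 8 * d ^ 3 := by
          calc (n : ℝ) ^ 3 ≤ (2 * d) ^ 3 := by gcongr
            _ = 8 * d ^ 3 := by ring
        have h4 : 16 * (n : ℝ) ^ 3 * E ≤ 16 * (8 * d ^ 3) * (d * (σ ^ 2 + r)) := by gcongr
        have h5 : 2 * r * n ≤ 2 * r * (2 * d) := by gcongr
        have h6 : r * d ≤ (σ ^ 2 + r) * d ^ 4 := by
          have : r ≤ σ ^ 2 + r := by nlinarith [sq_nonneg σ]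
          gcongr
        nlinarith

/-- The probability that a sample is not good is at most this constant times `n⁻⁶`. -/
noncomputable def devConst : ℝ := 16 * (Nat.factorial 13) * 128 ^ 13

/-- The oracle bound is used on good samples and the crude bound on the others. The set of bad
samples is built from the largest dimension only, whereas the factors `Θ K` are integrated over all
samples. -/
theorem risk_le_of_ge (hd : 1 ≤ d) (hT : T ∈ opClass ψ l d) (hwt : WeightAssumption w b l)
    (hn : 1 ≤ n) (hn2 : 2 * d ≤ n) (hσ : 0 < σ) (hr : 0 ≤ r)
    (hβ : wNormSq ψ b β ≤ ENNReal.ofReal r) (hρ : IsGaussianDesign ρ T) (hS : IsSigma w l d S) :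
    risk ψ w (fun X Y => adaptiveEstimator ψ w 96 X Y) σ β ρ (n := n)
      ≤ ENNReal.ofReal ((48384 * d ^ 2 * (1 + Real.log (2 * d)) + 16 * d ^ 6) * (σ ^ 2 + r)
            * RDiamond w b l d n
          + (1600 * d ^ 2 + 3 * devConst * d) * (σ ^ 2 + r) * S * (n : ℝ)⁻¹) := by
  have hn0 : (0 : ℝ) < n := by exact_mod_cast hn
  have hn1 : (1 : ℝ) ≤ n := by exact_mod_cast hn
  have := hρ.gaussian
  have hsym := opClass_symm ψ hT
  have hpos := hT.2.1
  have hTβ := inner_apply_self_le hd hT hwt hr hβ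
  have hTβ0 := gram_nonneg hpos β
  set E := σ ^ 2 + inner ℝ (T β) β with hE
  have hE0 : 0 < E := by positivity
  have hEd : E ≤ d * (σ ^ 2 + r) := by nlinarith [sq_nonneg σ]
  have hS1 := one_le_of_isSigma hwt hS
  have hlog : 0 ≤ Real.log (2 * d) := Real.log_nonneg (by linarith)
  have hR0 : 0 ≤ RDiamond w b l d n :=
    (div_nonneg (hwt.w_pos _).le (hwt.b_pos _).le).trans (le_max_left _ _)
  have hdev : 0 ≤ devConst := by unfold devConst; positivity
  set M := dimCap w n with hM
  set μ := Measure.pi fun _ : Fin n => ρ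
  set bad : Set (Fin n → H × ℝ) := gramDev n fun j => whitened ψ T σ β M j with hbad
  have hbadm : MeasurableSet bad :=
    measurableSet_gramDev n fun j => (whitened ψ T σ β M j).continuous.measurable
  have hbadP : μ bad ≤ ENNReal.ofReal (devConst * ((n : ℝ) ^ 6)⁻¹) :=
    (measure_gramDev_le (whitened ψ T σ β M) (integral_whitened β M hρ)
      (integral_whitened_mul hsym hpos hσ β M hρ) hn).trans (ENNReal.ofReal_le_ofReal
        (gramDev_bound_le (one_le_dimCap hwt.w_first hn) (dimCap_pow_le hwt.w_first hn)))
  set Θ : ℕ → (Fin n → H × ℝ) → ℝ≥0∞ := fun K z =>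
    smoothMax (extZero (sampleCols (fun j => whitened ψ T σ β K j) z)) (K + 1) with hΘ
  have hΘm : ∀ K, Measurable (Θ K) := fun K => (measurable_smoothMax (K + 1)).comp
    (measurable_sampleCols fun j => (whitened ψ T σ β K j).continuous.measurable)
  have hΘi : ∀ K, ∫⁻ z, Θ K z ∂μ ≤ ENNReal.ofReal ((2 * √2) ^ (K + 1)) := fun K =>
    lintegral_smoothMax_sampleCols (whitened ψ T σ β K) (integral_whitened β K hρ)
      (integral_whitened_mul hsym hpos hσ β K hρ) n
  set c : ℕ → ℝ := fun K =>
    512 * d * E * (n : ℝ)⁻¹ * (sigmaTerm w l d K * Real.exp (-(2 * K))) with hc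
  set A := (48384 * d * (1 + Real.log (2 * d)) * E + 16 * d ^ 6 * r) * RDiamond w b l d n
  set Q : (Fin n → H × ℝ) → ℝ := fun z => ∑ i, (inner ℝ β (z i).1 + σ * (z i).2) ^ 2 with hQ
  have hQm : Measurable Q := by fun_prop
  have hbound : ∀ z : Fin n → H × ℝ, wNormSq ψ w (adaptiveEstimator ψ w 96 (fun i => (z i).1)
        (fun i => inner ℝ β (z i).1 + σ * (z i).2) - β)
      ≤ (ENNReal.ofReal A + ∑ K ∈ Finset.Icc 1 M, ENNReal.ofReal (c K) * Θ K z)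
        + (ENNReal.ofReal (((n : ℝ) ^ 3 * E)⁻¹) * ENNReal.ofReal (Q z ^ 2)
          + bad.indicator (fun _ => ENNReal.ofReal (n ^ 5 * E + 2 * r)) z) := by
    intro z
    by_cases hz : z ∈ bad
    · refine le_trans ?_ le_add_self
      refine (wNormSq_adaptiveEstimator_sub_le hwt hn hβ _ _).trans ?_
      rw [Set.indicator_of_mem hz, ← ENNReal.ofReal_mul (by positivity),
        ← ENNReal.ofReal_add (by positivity) (by positivity), ← ENNReal.ofReal_ofNat 2,
        ← ENNReal.ofReal_mul zero_le_two, ← ENNReal.ofReal_mul zero_le_two,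
        ← ENNReal.ofReal_add (by positivity) (by positivity)]
      refine ENNReal.ofReal_le_ofReal ?_
      change 2 * (n * Q z) + 2 * r ≤ _
      -- This form of the arithmetic–geometric mean inequality avoids Hölder on the bad set: the
      -- square term has mean at most `64 E / n`, and the constant `n⁵ E` meets a probability of
      -- order `n⁻⁶`.
      have h1 : 2 * (n * Q z) ≤ ((n : ℝ) ^ 3 * E)⁻¹ * Q z ^ 2 + n ^ 5 * E := by
        have h2 : ((n : ℝ) ^ 3 * E)⁻¹ * Q z ^ 2 + n ^ 5 * E - 2 * (n * Q z)
            = ((n : ℝ) ^ 3 * E)⁻¹ * (Q z - n ^ 4 * E) ^ 2 := by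
          field_simp
          ring
        have h3 : 0 ≤ ((n : ℝ) ^ 3 * E)⁻¹ * (Q z - n ^ 4 * E) ^ 2 := by positivity
        linarith
      linarith
    · refine le_trans ?_ le_self_add
      exact wNormSq_adaptiveEstimator_sub_le_of_good
        (isGoodSample_of_notMem_gramDev hsym hpos hσ β hz) hd hT hwt hn hn2 hE0 hr hβ
        (Θ := fun K => Θ K z) (fun K => one_le_smoothMax _ _)
        (fun K => hasColumns_whitened hsym hpos hσ β K z)
  have hc0 : ∀ K, 0 ≤ c K := fun K => by
    have := sigmaTerm_nonneg w l d K
    positivity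
  have hsum : ∑ K ∈ Finset.Icc 1 M, ENNReal.ofReal (c K) * ∫⁻ z, Θ K z ∂μ
      ≤ ENNReal.ofReal (1536 * d * E * (n : ℝ)⁻¹ * S) := by
    rw [ENNReal.ofReal_mul (by positivity)]
    refine le_trans ?_ (mul_le_mul' le_rfl (sum_sigmaTerm_le hS M))
    rw [Finset.mul_sum]
    refine Finset.sum_le_sum fun K _ => ?_
    refine (mul_le_mul' le_rfl (hΘi K)).trans ?_
    rw [← ENNReal.ofReal_mul (hc0 K), ← ENNReal.ofReal_mul (by positivity)]
    refine ENNReal.ofReal_le_ofReal ?_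
    have h1 := exp_mul_pow_le K
    have h2 : 0 ≤ 512 * d * E * (n : ℝ)⁻¹ * sigmaTerm w l d K := by
      have := sigmaTerm_nonneg w l d K
      positivity
    have h3 := mul_le_mul_of_nonneg_left h1 h2
    calc c K * (2 * √2) ^ (K + 1) = 512 * d * E * (n : ℝ)⁻¹ * sigmaTerm w l d K *
          (Real.exp (-(2 * K)) * (2 * √2) ^ (K + 1)) := by rw [hc]; ring
      _ ≤ _ := h3
      _ = _ := by ring
  have hAr : 0 ≤ A := by positivity
  unfold risk
  calc ∫⁻ z, wNormSq ψ w (adaptiveEstimator ψ w 96 (fun i => (z i).1)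
        (fun i => inner ℝ β (z i).1 + σ * (z i).2) - β) ∂μ
      ≤ ∫⁻ z, ((ENNReal.ofReal A + ∑ K ∈ Finset.Icc 1 M, ENNReal.ofReal (c K) * Θ K z)
        + (ENNReal.ofReal (((n : ℝ) ^ 3 * E)⁻¹) * ENNReal.ofReal (Q z ^ 2)
          + bad.indicator (fun _ => ENNReal.ofReal (n ^ 5 * E + 2 * r)) z)) ∂μ :=
        lintegral_mono hbound
    _ = (ENNReal.ofReal A + ∑ K ∈ Finset.Icc 1 M, ENNReal.ofReal (c K) * ∫⁻ z, Θ K z ∂μ)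
        + (ENNReal.ofReal (((n : ℝ) ^ 3 * E)⁻¹) * ∫⁻ z, ENNReal.ofReal (Q z ^ 2) ∂μ
          + ENNReal.ofReal (n ^ 5 * E + 2 * r) * μ bad) := by
        have m1 : Measurable fun z => ∑ K ∈ Finset.Icc 1 M, ENNReal.ofReal (c K) * Θ K z :=
          Finset.measurable_sum _ fun K _ => (hΘm K).const_mul _
        have m2 : Measurable fun z => ENNReal.ofReal A
            + ∑ K ∈ Finset.Icc 1 M, ENNReal.ofReal (c K) * Θ K z := measurable_const.add m1
        rw [lintegral_add_left m2, lintegral_add_left measurable_const,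
          lintegral_const, measure_univ, mul_one, lintegral_finsetSum _ fun K _ =>
            (hΘm K).const_mul _, lintegral_add_right _ (measurable_const.indicator hbadm),
          lintegral_const_mul' _ _ ENNReal.ofReal_ne_top, lintegral_indicator_const hbadm]
        simp_rw [lintegral_const_mul' _ _ ENNReal.ofReal_ne_top]
    _ ≤ (ENNReal.ofReal A + ENNReal.ofReal (1536 * d * E * (n : ℝ)⁻¹ * S))
        + (ENNReal.ofReal (((n : ℝ) ^ 3 * E)⁻¹) * ENNReal.ofReal (64 * n ^ 2 * E ^ 2)
          + ENNReal.ofReal (n ^ 5 * E + 2 * r) * ENNReal.ofReal (devConst * ((n : ℝ) ^ 6)⁻¹)) :=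
        add_le_add (add_le_add le_rfl hsum) (add_le_add
          (mul_le_mul' le_rfl (lintegral_response hρ β hE0 n).1) (mul_le_mul' le_rfl hbadP))
    _ = ENNReal.ofReal ((A + 1536 * d * E * (n : ℝ)⁻¹ * S)
          + (((n : ℝ) ^ 3 * E)⁻¹ * (64 * n ^ 2 * E ^ 2)
            + (n ^ 5 * E + 2 * r) * (devConst * ((n : ℝ) ^ 6)⁻¹))) := by
        rw [← ENNReal.ofReal_add hAr (by positivity), ← ENNReal.ofReal_mul (by positivity),
          ← ENNReal.ofReal_mul (by positivity),
          ← ENNReal.ofReal_add (by positivity) (by positivity),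
          ← ENNReal.ofReal_add (by positivity) (by positivity)]
    _ ≤ _ := by
        refine ENNReal.ofReal_le_ofReal ?_
        set V := σ ^ 2 + r with hV
        have hV0 : 0 ≤ V := by positivity
        have hrV : r ≤ V := by nlinarith [sq_nonneg σ]
        have hdev0 := hdev
        have b1 : A ≤ (48384 * d ^ 2 * (1 + Real.log (2 * d)) + 16 * d ^ 6) * V
            * RDiamond w b l d n := by
          refine mul_le_mul_of_nonneg_right ?_ hR0
          have h1 : 48384 * d * (1 + Real.log (2 * d)) * E
              ≤ 48384 * d * (1 + Real.log (2 * d)) * (d * V) := by gcongr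
          have h2 : 16 * d ^ 6 * r ≤ 16 * d ^ 6 * V := by gcongr
          linarith
        have b2 : 1536 * d * E * (n : ℝ)⁻¹ * S ≤ 1536 * d * (d * V) * (n : ℝ)⁻¹ * S := by gcongr
        have hSn : V * (n : ℝ)⁻¹ ≤ V * S * (n : ℝ)⁻¹ := by
          refine mul_le_mul_of_nonneg_right ?_ (by positivity)
          exact le_mul_of_one_le_right hV0 hS1
        have b3 : ((n : ℝ) ^ 3 * E)⁻¹ * (64 * n ^ 2 * E ^ 2)
            ≤ 64 * d ^ 2 * (V * S * (n : ℝ)⁻¹) := by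
          have h1 : ((n : ℝ) ^ 3 * E)⁻¹ * (64 * n ^ 2 * E ^ 2) = 64 * (E * (n : ℝ)⁻¹) := by
            field_simp
          rw [h1]
          have h2 : E ≤ d ^ 2 * V := hEd.trans (by
            refine mul_le_mul_of_nonneg_right ?_ hV0
            nlinarith)
          calc 64 * (E * (n : ℝ)⁻¹) ≤ 64 * (d ^ 2 * V * (n : ℝ)⁻¹) := by gcongr
            _ = 64 * d ^ 2 * (V * (n : ℝ)⁻¹) := by ring
            _ ≤ _ := by gcongr
        have b4 : (n ^ 5 * E + 2 * r) * (devConst * ((n : ℝ) ^ 6)⁻¹)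
            ≤ 3 * devConst * d * (V * S * (n : ℝ)⁻¹) := by
          have h1 : (n : ℝ) ^ 5 * E + 2 * r ≤ n ^ 5 * (3 * d * V) := by
            have h2 : r ≤ n ^ 5 * (d * V) := by
              calc r ≤ V := hrV
                _ = 1 * (1 * V) := by ring
                _ ≤ n ^ 5 * (d * V) := by
                  gcongr
                  exact one_le_pow₀ hn1
            have h3 : (n : ℝ) ^ 5 * E ≤ n ^ 5 * (d * V) := by gcongr
            linarith
          calc (n ^ 5 * E + 2 * r) * (devConst * ((n : ℝ) ^ 6)⁻¹)
              ≤ n ^ 5 * (3 * d * V) * (devConst * ((n : ℝ) ^ 6)⁻¹) := by gcongr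
            _ = 3 * devConst * d * (V * (n : ℝ)⁻¹) := by
              generalize devConst = D
              field_simp
            _ ≤ _ := by gcongr
        linarith

end RiskBound
end FunctionalRegression

theorem theorem3p2 (d : ℝ) (hd : 1 ≤ d) :
    ∃ K : ℝ, 0 < K ∧
      ∀ (H : Type*) [NormedAddCommGroup H] [InnerProductSpace ℝ H] [CompleteSpace H]
        [SecondCountableTopology H] [MeasurableSpace H] [BorelSpace H]
        (ψ : HilbertBasis ℕ ℝ H) (w b l : ℕ → ℝ),
        FunctionalRegression.WeightAssumption w b l →
        ∀ σ r S : ℝ, 0 < σ → 0 < r → FunctionalRegression.IsSigma w l d S →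
        ∀ n : ℕ, 1 ≤ n →
          FunctionalRegression.maxRisk ψ w
              (fun (X : Fin n → H) (Y : Fin n → ℝ) =>
                FunctionalRegression.adaptiveEstimator ψ w 96 X Y)
              σ (FunctionalRegression.ellipsoid ψ b r) (FunctionalRegression.opClass ψ l d)
            ≤ ENNReal.ofReal
                (K * (σ ^ 2 + r) * (FunctionalRegression.RDiamond w b l d n + S / n)) := by
  open FunctionalRegression in
  have hlog : 0 ≤ Real.log (2 * d) := Real.log_nonneg (by linarith)
  have hdev : 0 ≤ devConst := by unfold devConst; positivity
  refine ⟨48384 * d ^ 2 * (1 + Real.log (2 * d)) + 16 * d ^ 6 + (1600 * d ^ 2 + 3 * devConst * d)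
    + 132 * d ^ 4, by positivity, ?_⟩
  intro H _ _ _ _ _ _ ψ w b l hwt σ r S hσ hr hS n hn
  have hn0 : (0 : ℝ) < n := by exact_mod_cast hn
  have hS1 := one_le_of_isSigma hwt hS
  have hR0 : 0 ≤ RDiamond w b l d n :=
    (div_nonneg (hwt.w_pos _).le (hwt.b_pos _).le).trans (le_max_left _ _)
  unfold maxRisk
  refine iSup₂_le fun β hβ => iSup₂_le fun T hT => iSup₂_le fun ρ hρ => ?_
  set A := 48384 * d ^ 2 * (1 + Real.log (2 * d)) + 16 * d ^ 6 with hA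
  set B := 1600 * d ^ 2 + 3 * devConst * d with hB
  have hA0 : 0 ≤ A := by positivity
  have hB0 : 0 ≤ B := by positivity
  have hsr : 0 ≤ σ ^ 2 + r := by positivity
  have hSn : 0 ≤ S * (n : ℝ)⁻¹ := by positivity
  have hV := mul_nonneg hsr hR0
  have hW := mul_nonneg hsr hSn
  rw [div_eq_mul_inv]
  -- Below `2 d` the crude bound has order `1 / n`, which `S / n` dominates because `S ≥ l 0 = 1`.
  rcases lt_or_ge (n : ℝ) (2 * d) with h | h
  · refine (risk_le_of_lt hd hT hwt hn h hσ hr.le hβ hρ).trans (ENNReal.ofReal_le_ofReal ?_)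
    have h1 : (σ ^ 2 + r) * (n : ℝ)⁻¹ ≤ (σ ^ 2 + r) * (S * (n : ℝ)⁻¹) :=
      mul_le_mul_of_nonneg_left (le_mul_of_one_le_left (by positivity) hS1) hsr
    have hD : 0 ≤ 132 * d ^ 4 := by positivity
    generalize 132 * d ^ 4 = D at hD ⊢
    nlinarith [mul_nonneg hA0 hV, mul_nonneg hA0 hW, mul_nonneg hB0 hV, mul_nonneg hB0 hW,
      mul_nonneg hD hV, mul_le_mul_of_nonneg_left h1 hD]
  · refine (risk_le_of_ge hd hT hwt hn h hσ hr.le hβ hρ hS).trans (ENNReal.ofReal_le_ofReal ?_)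
    have hD : 0 ≤ 132 * d ^ 4 := by positivity
    generalize 132 * d ^ 4 = D at hD ⊢
    nlinarith [mul_nonneg hA0 hW, mul_nonneg hB0 hV, mul_nonneg hD hV, mul_nonneg hD hW]
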